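/- Fix reals $0<p_2<p_1<1$ and let $\rho=\log(1/p_1)/\log(1/p_2)$. There are a query program $P$ for a randomized word RAM and a constant $C$, both depending only on $p_1,p_2$, such that the following holds. Let $M$ be a metric space, $c\ge 1$, $r>0$, and let $\mathcal H$ be a monotone $(c,r,p_1,p_2)$-LSH family on $M$: a random function $h$ on $M$ with $\Pr[h(x)=h(y)]\ge p_1$ if $\mathrm{dist}(x,y)\le r$, with $\Pr[h(x)=h(y)]\le p_2$ if $\mathrm{dist}(x,y)\ge cr$, and with $\Pr[h(x)=h(y)]$ non-increasing in $\mathrm{dist}(x,y)$. Let $S\subset M$ be a dataset of $n$ points and let $Q$ be a number of queries, with $nQ\ge 2$. Write $B_S(q,R)=\{p\in S:\mathrm{dist}(p,q)\le R\}$ and $n(q,R)=|B_S(q,R)|$. Cost model: a machine word holds a number below $(nQ)^C$, i.e. $O(\log(nQ))$ bits. Space is the number of words of memory plus the number of stored hash functions; the points of $S$ are stored separately. A distance test between the query and a point of $S$, and a comparison of the values of a stored hash function at the query and at a point of $S$, take time $d\ge 1$ ($d$ is the dimension of $M$); every other instruction, including drawing a uniform element of $\{0,\dots,k-1\}$ for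 a word $k$, takes time $1$. Preprocessing draws independent hash functions from $\mathcal H$ (the setup randomness $R_{\mathrm{setup}}$) and fills the memory by a measurable function of $S$ and of them; each query runs $P$ on this memory with fresh randomness, and its changes of the memory are undone when it ends. An answer is a point of $S$ or $\perp$. It is a correct answer to the $(c,r)$-ANN query $q$ if it is a point of $B_S(q,cr)$, or if it is $\perp$ and $B_S(q,r)=\emptyset$. For every such $M,\mathcal H,c,r,d,n,Q,S$ there is such a data structure using at most $C\,n^{1+\rho}\log(nQ)$ space, with at most $C\,n^{\rho}\log(nQ)$ hash tables, each of which uses a concatenation of some of the stored hash functions, such that, with $C(q)$ the set of the points of $S$ that share a bucket with $q$ in some table: 1. (Fixed queries.) For every $q\in M$, with probability at least $1-\frac1{nQ}$ over $R_{\mathrm{setup}}$, $B_S(q,r)\subseteq C(q)$. For every value of $R_{\mathrm{setup}}$ for which this inclusion holds, the answer to $q$ is exactly uniformly distributed on $B_S(q,r)$ if this set is non-empty, and is $\perp$ otherwise; so its law does not depend on $R_{\mathrm{setup}}$. The expected query time, over $R_{\mathrm{setup}}$ and the randomness of the query, is at most $C\,T(q)$, where $$T(q)=d\Big(n^{\rho}+\frac{n(q,cr)}{n(q,r)+1}\Big)\log(nQ).$$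 2. (Adversarial robustness.) For every adversary who chooses each of $Q$ queries $q_1,\dots,q_Q$ as a function of the previous queries and answers, with probability at least $1-\frac1n$ all $Q$ answers are correct, and with probability at least $1-\frac1n$ the inclusion $B_S(q_i,r)\subseteq C(q_i)$ holds in all $Q$ rounds (so that every round is answered exactly fairly). For each $i\le Q$ the expected time of round $i$ is at most $\mathbb E[C\,T(q_i)]$. -/

import Mathlib

open MeasureTheory
open scoped ENNReal

noncomputable section

namespace FairANN

/-! ### Near neighbours and locality sensitive hashing -/

/-- The indices of the data points in `B_S(q, R)`, for a dataset `S` of `n` distinct points. -/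
def nbhd {M : Type*} [MetricSpace M] {n : ℕ} (S : Fin n ↪ M) (q : M) (R : ℝ) : Finset (Fin n) :=
  open Classical in Finset.univ.filter (fun i => dist (S i) q ≤ R)

/-- `n(q, R) = |B_S(q, R)|`. -/
def density {M : Type*} [MetricSpace M] {n : ℕ} (S : Fin n ↪ M) (q : M) (R : ℝ) : ℕ :=
  (nbhd S q R).card

/-- The random hash function `h ω`, `ω ∼ μ`, is a monotone `(c, r, p₁, p₂)`-LSH family on `M` with
bucket labels in `U`. The order of the labels has no meaning; it only lets a machine search among
them. -/
structure IsLSH {M Ω U : Type*} [MetricSpace M] [MeasurableSpace Ω] [LinearOrder U]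
    (μ : Measure Ω) (h : Ω → M → U) (c r p₁ p₂ : ℝ) : Prop where
  measurableSet_lt : ∀ x y, MeasurableSet {ω | h ω x < h ω y}
  near : ∀ x y, dist x y ≤ r → p₁ ≤ μ.real {ω | h ω x = h ω y}
  far : ∀ x y, c * r ≤ dist x y → μ.real {ω | h ω x = h ω y} ≤ p₂
  mono : ∀ x y x' y', dist x y < dist x' y' →
    μ.real {ω | h ω x' = h ω y'} ≤ μ.real {ω | h ω x = h ω y}

/-- The LSH exponent `ρ = log (1/p₁) / log (1/p₂)`. -/
def rho (p₁ p₂ : ℝ) : ℝ := Real.log (1 / p₁) / Real.log (1 / p₂)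

/-- An answer to a query: the index of a data point, or `none` for `⊥`. -/
abbrev Answer (n : ℕ) : Type := Option (Fin n)

/-- `a` is a correct answer to the query `q` of the `(c, r)`-ANN problem: a returned point has to
lie in `B_S(q, cr)`, and `⊥` is allowed only if `B_S(q, r)` is empty. -/
def Correct {M : Type*} [MetricSpace M] {n : ℕ} (S : Fin n ↪ M) (c r : ℝ) (q : M) :
    Answer n → Prop
  | some i => i ∈ nbhd S q (c * r)
  | none => nbhd S q r = ∅

/-- The exactly fair answer: uniform on `B_S(q, r)` if this is non-empty, and `⊥` otherwise. -/
def fairLaw {M : Type*} [MetricSpace M] {n : ℕ} (S : Fin n ↪ M) (r : ℝ) (q : M) :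
    PMF (Answer n) :=
  open Classical in
  if hne : (nbhd S q r).Nonempty then (PMF.uniformOfFinset (nbhd S q r) hne).map some
  else PMF.pure none

/-! ### A randomized word RAM -/

/-- Binary operations on machine words. -/
inductive Op
  | add | sub | mul | div | mod | lt

/-- Arithmetic on words, which are the numbers below `W` (subtraction is truncated). -/
def Op.eval (W : ℕ) : Op → ℕ → ℕ → ℕ
  | add, a, b => (a + b) % W
  | sub, a, b => a - b
  | mul, a, b => (a * b) % W
  | div, a, b => a / b
  | mod, a, b => a % b
  | lt, a, b => if a < b then 1 else 0

/-- Query programs. Registers are named by numbers. -/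
inductive Cmd
  /-- `x := k` -/
  | const (x k : ℕ)
  /-- `x := y o z` -/
  | arith (o : Op) (x y z : ℕ)
  /-- `x := mem[y]` -/
  | load (x y : ℕ)
  /-- `mem[x] := y` -/
  | store (x y : ℕ)
  /-- `x :=` a fresh uniformly random element of `{0, …, y - 1}` -/
  | rand (x y : ℕ)
  /-- `x := 1` if the data point with index `y` is within distance `r` of the query, else `x := 0` -/
  | near (x y : ℕ)
  /-- evaluate the stored hash function number `y` at the query and at the data point with index
  `z`, and set `x := 0`, `1`, `2` if the label of the query is equal to, less than, greater than the
  label of the data point -/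
  | hash (x y z : ℕ)
  /-- first `a`, then `b` -/
  | seq (a b : Cmd)
  /-- if `x ≠ 0` then `a` else `b` -/
  | cond (x : ℕ) (a b : Cmd)
  /-- while `x ≠ 0` do `a` -/
  | loop (x : ℕ) (a : Cmd)

/-- What stays fixed while a query is processed: the bound `W` on machine words, the number `size`
of memory cells, the time `d` of one distance or hash computation, and the results of those
computations. -/
structure Env where
  W : ℕ
  size : ℕ
  d : ℕ
  near : ℕ → ℕ
  hash : ℕ → ℕ → ℕ

/-- Contents of the registers and of the memory. -/
structure State where
  reg : ℕ → ℕ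
  mem : ℕ → ℕ

def State.setReg (σ : State) (x v : ℕ) : State := { σ with reg := Function.update σ.reg x v }

/-- Writing outside the `size` memory cells has no effect. -/
def State.setMem (σ : State) (size a v : ℕ) : State :=
  if a < size then { σ with mem := Function.update σ.mem a v } else σ

/-- The commands that remain to be executed, and the state. The machine has halted when no command
remains. -/
abbrev Config : Type := List Cmd × State

/-- The uniform distribution on `{0, …, k - 1}`, and `0` if `k = 0`. -/
def uniformBelow : ℕ → PMF ℕ
  | 0 => PMF.pure 0
  | k + 1 => PMF.uniformOfFinset (Finset.range (k + 1)) Finset.nonempty_range_add_one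

/-- One step of the machine. -/
def step (E : Env) : Config → PMF Config
  | ([], σ) => PMF.pure ([], σ)
  | (.const x k :: K, σ) => PMF.pure (K, σ.setReg x (k % E.W))
  | (.arith o x y z :: K, σ) => PMF.pure (K, σ.setReg x (o.eval E.W (σ.reg y) (σ.reg z)))
  | (.load x y :: K, σ) => PMF.pure (K, σ.setReg x (σ.mem (σ.reg y)))
  | (.store x y :: K, σ) => PMF.pure (K, σ.setMem E.size (σ.reg x) (σ.reg y))
  | (.rand x y :: K, σ) => (uniformBelow (σ.reg y)).map (fun v => (K, σ.setReg x v))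
  | (.near x y :: K, σ) => PMF.pure (K, σ.setReg x (E.near (σ.reg y)))
  | (.hash x y z :: K, σ) => PMF.pure (K, σ.setReg x (E.hash (σ.reg y) (σ.reg z)))
  | (.seq a b :: K, σ) => PMF.pure (a :: b :: K, σ)
  | (.cond x a b :: K, σ) => PMF.pure (if σ.reg x ≠ 0 then (a :: K, σ) else (b :: K, σ))
  | (.loop x a :: K, σ) => PMF.pure (if σ.reg x ≠ 0 then (a :: .loop x a :: K, σ) else (K, σ))

/-- The time of the next step: `d` for a distance or hash computation, `1` for anything else, and
`0` after halting. -/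
def stepCost (E : Env) : Config → ℕ
  | ([], _) => 0
  | (.near _ _ :: _, _) => E.d
  | (.hash _ _ _ :: _, _) => E.d
  | (_ :: _, _) => 1

/-- The distribution of the configuration after `t` steps. -/
def run (E : Env) : ℕ → Config → PMF Config
  | 0, κ => PMF.pure κ
  | t + 1, κ => (step E κ).bind (run E t)

/-- The expected running time, infinite if the machine fails to halt with positive probability. -/
def expTime (E : Env) (κ : Config) : ℝ≥0∞ :=
  ∑' t : ℕ, ∑' κ' : Config, run E t κ κ' * (stepCost E κ' : ℝ≥0∞)

/-- Register `0` holds the answer: `i + 1` for the data point with index `i`, and otherwise `⊥`. -/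
def decode (n v : ℕ) : Answer n :=
  if hv : v - 1 < n then (if v = 0 then none else some ⟨v - 1, hv⟩) else none

/-- The probability that the machine halts with answer `a`. -/
def ansProb (E : Env) (κ : Config) {n : ℕ} (a : Answer n) : ℝ≥0∞ :=
  ⨆ t : ℕ, (run E t κ).toOuterMeasure {κ' | κ'.1 = [] ∧ decode n (κ'.2.reg 0) = a}

/-! ### LSH data structures -/

/-- The result of preprocessing a dataset. The setup randomness is a tuple `ω` of `funs` hash
functions, which will be drawn independently from the LSH family; `init ω` is the content of the
`size` memory cells. Each of the `tables` hash tables uses the concatenation of the hash functions in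
`parts`. -/
structure DataStructure (Ω : Type*) [MeasurableSpace Ω] (W : ℕ) where
  funs : ℕ
  tables : ℕ
  parts : Fin tables → Finset (Fin funs)
  size : ℕ
  init : (Fin funs → Ω) → Fin size → ℕ
  measurable_init : Measurable init
  init_lt : ∀ ω a, init ω a < W

section
variable {M Ω U : Type*} [MetricSpace M] [MeasurableSpace Ω] [LinearOrder U] {n W : ℕ}

/-- The candidate set `C(q)`: the data points that share a bucket with `q` in some hash table. -/
def candidates (D : DataStructure Ω W) (h : Ω → M → U) (S : Fin n ↪ M) (ω : Fin D.funs → Ω)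
    (q : M) : Set (Fin n) :=
  {i | ∃ t, ∀ j ∈ D.parts t, h (ω j) (S i) = h (ω j) q}

/-- The event that the candidate set of `q` contains `B_S(q, r)`. -/
def Covered (D : DataStructure Ω W) (h : Ω → M → U) (S : Fin n ↪ M) (r : ℝ) (ω : Fin D.funs → Ω)
    (q : M) : Prop :=
  ∀ i ∈ nbhd S q r, i ∈ candidates D h S ω q

/-- The machine on which the query `q` is processed. -/
def queryEnv (D : DataStructure Ω W) (h : Ω → M → U) (S : Fin n ↪ M) (r : ℝ) (d : ℕ)
    (ω : Fin D.funs → Ω) (q : M) : Env :=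
  open Classical in
  { W := W
    size := D.size
    d := d
    near := fun i => if hi : i < n then (if dist (S ⟨i, hi⟩) q ≤ r then 1 else 0) else 0
    hash := fun j i =>
      if hj : j < D.funs then
        if hi : i < n then
          if h (ω ⟨j, hj⟩) q < h (ω ⟨j, hj⟩) (S ⟨i, hi⟩) then 1
          else if h (ω ⟨j, hj⟩) (S ⟨i, hi⟩) < h (ω ⟨j, hj⟩) q then 2 else 0
        else 0
      else 0 }

/-- Every query starts from the memory left by the preprocessing (a query may use the memory as
scratch space, but its changes are undone when it ends) and with all registers `0`. -/
def queryStart (D : DataStructure Ω W) (P : Cmd) (ω : Fin D.funs → Ω) : Config :=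
  ([P], { reg := fun _ => 0, mem := fun a => if ha : a < D.size then D.init ω ⟨a, ha⟩ else 0 })

/-- The law of the answer to `q`, over the fresh randomness of the query, for given setup
randomness `ω`. -/
def ansLaw (D : DataStructure Ω W) (P : Cmd) (h : Ω → M → U) (S : Fin n ↪ M) (r : ℝ)
    (ω : Fin D.funs → Ω) (q : M) (a : Answer n) : ℝ≥0∞ :=
  -- the time parameter is irrelevant for the answer
  ansProb (queryEnv D h S r 1 ω q) (queryStart D P ω) a

/-- The expected time of the query `q`, over the fresh randomness of the query, for given setup
randomness `ω`. -/
def queryTime (D : DataStructure Ω W) (P : Cmd) (h : Ω → M → U) (S : Fin n ↪ M) (r : ℝ) (d : ℕ)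
    (ω : Fin D.funs → Ω) (q : M) : ℝ≥0∞ :=
  expTime (queryEnv D h S r d ω q) (queryStart D P ω)

/-- The law of the setup randomness. -/
def setupLaw (D : DataStructure Ω W) (μ : Measure Ω) : Measure (Fin D.funs → Ω) :=
  Measure.pi fun _ => μ

end

/-! ### The adversarial game -/

/-- An adversary chooses the next query from the queries and answers so far. -/
abbrev Adversary (M : Type*) (n : ℕ) : Type _ := List (M × Answer n) → M

/-- The probability that all of the next `k` rounds of the game, played after the history `H`,
satisfy `ok query answer`, when a query `q` is answered by `a` with probability `law q a`. -/
def winProb {M : Type*} {n : ℕ} (law : M → Answer n → ℝ≥0∞) (B : Adversary M n)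
    (ok : M → Answer n → Prop) : ℕ → List (M × Answer n) → ℝ≥0∞
  | 0, _ => 1
  | k + 1, H =>
    open Classical in
    ∑ a, if ok (B H) a then law (B H) a * winProb law B ok k (H ++ [(B H, a)]) else 0

/-- The expected value of `f` at the query that the adversary makes after `k` further rounds. -/
def expAtRound {M : Type*} {n : ℕ} (law : M → Answer n → ℝ≥0∞) (B : Adversary M n)
    (f : M → ℝ≥0∞) : ℕ → List (M × Answer n) → ℝ≥0∞
  | 0, H => f (B H)
  | k + 1, H => ∑ a, law (B H) a * expAtRound law B f k (H ++ [(B H, a)])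

/-- `d (n^ρ + n(q, cr) / (n(q, r) + 1)) log (nQ)` -/
def timeBound {M : Type*} [MetricSpace M] {n : ℕ} (S : Fin n ↪ M) (c r ρ : ℝ) (d Q : ℕ)
    (q : M) : ℝ :=
  d * ((n : ℝ) ^ ρ + density S q (c * r) / (density S q r + 1)) * Real.log (n * Q)

end FairANN

end

open FairANN

/-! Fairness and robustness have one source. Whenever the candidate set covers `B_S(q, r)`, the
answer is exactly uniform on that ball, so its law carries no information about the setup randomness
(`ansLaw_of_covered`). Against an adaptive adversary the real game thus agrees in law with a game
answered by `fairLaw` until the first uncovered query. In the fair game the queries are independent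
of the setup, each is uncovered with probability at most `1/(2nQ)`, and a union bound over the
rounds suffices (`le_setLIntegral_winProb`). For the time, `expAtRound_le_fair` charges the
worst-case query time to uncovered rounds, which are rare enough to make this harmless, and
`le_setLIntegral_expAtRound` leads back from the fair game to the real one at the price of a factor
two.

Coverage at low cost comes from tables made of two halves. Each of `R` repetitions has `m` first and
`m` second half tables, each concatenating `kap` hash functions with `n * p₂ ^ (2 * kap) ≤ 1`; every
pair of a first and a second half is a table. Let `p` be the infimum of the collision probabilities
at distance at most `r`, and `m` about `p ^ (-kap)`. A repetition misses a near point only if all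
its first halves or all its second halves separate the point from the query, which has probability
at most `2 * (3/8)` (`measure_not_meets_le`). By monotonicity a point beyond distance `r` collides
under one hash function with probability at most `p`, hence meets the query in at most `4 * R`
tables on average; a point beyond `c * r` meets it in at most a fraction `1/n` of the tables. There
are `R * m ^ 2` tables, of order `n ^ ρ * log (nQ)`, but only `2 * R * m` half tables, so a binary
search in every half table, with about `log n` lexicographic comparisons of length about `log n`,
fits into the time bound (`exists_parameters`).

Once the query is located in all half tables, static perfect hashing (`exists_perfect_hash`) finds
each of its buckets in constant time. A uniformly random bucket position hits a point `x` with
probability proportional to the number `deg x` of tables it shares with the query. Random tables are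
then drawn until one of these `deg x` tables appears, and `x` is accepted if it is the table where
`x` was hit. This happens with probability `1 / deg x`, so the accepted point is uniform on the near
candidates. A linear scan runs alongside and certifies that there is none.

On the machine only upper bounds are proved, for the functional `val`, which adds the price of all
steps and a reward at halting. For the sampling loop they come from a potential that solves the
linear equations of the underlying Markov chain (`Sampling.val_le_of_nonempty`). The upper bounds
for the probabilities of the answers sum to `1`, and finite expected time excludes loss of mass, so
all of them are equalities (`ansProb_query`). -/

namespace FairANN

/-! ### Step-indexed expectations of machine runs -/

/-- The expected value of `θ` times the number of steps plus the reward `r` of the final state,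
counting only runs that halt in fewer than the given number of steps for the reward. -/
noncomputable def val (E : Env) (θ : ℝ≥0∞) (r : State → ℝ≥0∞) : ℕ → Config → ℝ≥0∞
  | 0, _ => 0
  | _ + 1, ([], σ) => r σ
  | N + 1, (c :: K, σ) => θ + ∑' κ', step E (c :: K, σ) κ' * val E θ r N κ'

lemma val_le_succ (E : Env) (θ : ℝ≥0∞) (r : State → ℝ≥0∞) (N : ℕ) :
    ∀ κ, val E θ r N κ ≤ val E θ r (N + 1) κ := by
  induction N with
  | zero => intro κ; simp [val]
  | succ N ih =>
    rintro ⟨K, σ⟩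
    cases K with
    | nil => simp [val]
    | cons c K =>
      simp only [val]
      gcongr
      exact ih _

lemma tsum_pure_mul {α : Type*} (a : α) (f : α → ℝ≥0∞) :
    ∑' b, (PMF.pure a) b * f b = f a := by
  classical
  rw [tsum_eq_single a]
  · simp
  · intro b hb
    simp [PMF.pure_apply, hb]

lemma tsum_bind_mul {α β : Type*} (p : PMF α) (g : α → PMF β) (f : β → ℝ≥0∞) :
    ∑' b, (p.bind g) b * f b = ∑' a, p a * ∑' b, g a b * f b := by
  simp only [PMF.bind_apply, ← ENNReal.tsum_mul_right, ← ENNReal.tsum_mul_left]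
  rw [ENNReal.tsum_comm]
  simp only [mul_assoc]

lemma run_halted (E : Env) (σ : State) (t : ℕ) : run E t ([], σ) = PMF.pure ([], σ) := by
  induction t with
  | zero => rfl
  | succ t ih => simp [run, step, ih]

lemma stepCost_le (E : Env) (hd : 1 ≤ E.d) (κ : Config) : stepCost E κ ≤ E.d := by
  rcases κ with ⟨_ | ⟨c, K⟩, σ⟩
  · simp [stepCost]
  · cases c <;> simp [stepCost, hd]

lemma one_le_stepCost (E : Env) (hd : 1 ≤ E.d) (c : Cmd) (K : List Cmd) (σ : State) :
    1 ≤ stepCost E (c :: K, σ) := by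
  cases c <;> simp [stepCost, hd]

/-- Every step is charged the price `E.d` of the most expensive one, so that time and answer
probabilities become instances of the same functional `val`. -/
lemma sum_cost_le_val (E : Env) (hd : 1 ≤ E.d) (N : ℕ) : ∀ κ,
    ∑ t ∈ Finset.range N, ∑' κ' : Config, run E t κ κ' * (stepCost E κ' : ℝ≥0∞) ≤
      val E E.d (fun _ => 0) N κ := by
  induction N with
  | zero => intro κ; simp
  | succ N ih =>
    rintro ⟨_ | ⟨c, K⟩, σ⟩
    · simp only [run_halted, tsum_pure_mul]
      simp [stepCost]
    · rw [Finset.sum_range_succ']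
      simp only [val, run, tsum_bind_mul, tsum_pure_mul]
      rw [add_comm]
      refine add_le_add (by exact_mod_cast stepCost_le E hd _) ?_
      rw [← Summable.tsum_finsetSum (fun _ _ => ENNReal.summable)]
      refine ENNReal.tsum_le_tsum fun κ' => ?_
      rw [← Finset.mul_sum]
      gcongr
      exact ih κ'

lemma expTime_le_of_val (E : Env) (hd : 1 ≤ E.d) (κ : Config) (B : ℝ≥0∞)
    (h : ∀ N, val E E.d (fun _ => 0) N κ ≤ B) : expTime E κ ≤ B := by
  rw [expTime, ENNReal.tsum_eq_iSup_nat]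
  exact iSup_le fun N => (sum_cost_le_val E hd N κ).trans (h N)

/-- With free steps and an indicator as reward, `val` is a halting probability. The index is shifted
by one because `val` uses one unit of fuel to notice that the machine has halted. -/
lemma run_measure_eq_val (E : Env) (A : State → Prop) [DecidablePred A] (t : ℕ) : ∀ κ,
    (run E t κ).toOuterMeasure {κ' | κ'.1 = [] ∧ A κ'.2} =
      val E 0 (fun σ => if A σ then 1 else 0) (t + 1) κ := by
  induction t with
  | zero =>
    rintro ⟨_ | ⟨c, K⟩, σ⟩
    · simp [run, val, PMF.toOuterMeasure_pure_apply]
    · simp [run, val, PMF.toOuterMeasure_pure_apply]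
  | succ t ih =>
    rintro ⟨_ | ⟨c, K⟩, σ⟩
    · simp [run_halted, val, PMF.toOuterMeasure_pure_apply]
    · rw [run, PMF.toOuterMeasure_bind_apply]
      rw [val, zero_add]
      simp only [ih]

lemma ansProb_le_of_val (E : Env) (κ : Config) {n : ℕ} (a : Answer n) (B : ℝ≥0∞)
    (h : ∀ N, val E 0 (fun σ => if decode n (σ.reg 0) = a then 1 else 0) N κ ≤ B) :
    ansProb E κ a ≤ B := by
  refine iSup_le fun t => ?_
  rw [run_measure_eq_val E (fun σ => decode n (σ.reg 0) = a)]
  exact h (t + 1)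

/-- A configuration has either halted, and is then counted under the answer it decodes to, or its
next step costs at least `1`. -/
lemma one_le_halted_add (E : Env) (hd : 1 ≤ E.d) (t : ℕ) (κ : Config) {n : ℕ} :
    1 ≤ (∑ a : Answer n, (run E t κ).toOuterMeasure {κ' | κ'.1 = [] ∧ decode n (κ'.2.reg 0) = a}) +
      ∑' κ' : Config, run E t κ κ' * (stepCost E κ' : ℝ≥0∞) := by
  classical
  rw [← (run E t κ).tsum_coe]
  simp only [PMF.toOuterMeasure_apply]
  rw [← Summable.tsum_finsetSum (fun _ _ => ENNReal.summable), ← ENNReal.tsum_add]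
  refine ENNReal.tsum_le_tsum fun κ' => ?_
  rcases κ' with ⟨_ | ⟨c, K⟩, σ⟩
  · refine le_add_right ?_
    refine le_trans ?_ (Finset.single_le_sum (f := fun a : Answer n => Set.indicator
      {κ' : Config | κ'.1 = [] ∧ decode n (κ'.2.reg 0) = a} (fun x => run E t κ x) ([], σ))
      (fun _ _ => zero_le) (Finset.mem_univ (decode n (σ.reg 0))))
    simp
  · refine le_add_left ?_
    have := one_le_stepCost E hd c K σ
    calc run E t κ (c :: K, σ) = run E t κ (c :: K, σ) * 1 := by simp
      _ ≤ _ := by gcongr; exact_mod_cast this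

/-- The expected costs of the single steps are summable, hence tend to `0`, and they dominate the
probability of still running. -/
lemma one_le_sum_ansProb (E : Env) (hd : 1 ≤ E.d) (κ : Config) (h : expTime E κ ≠ ∞) {n : ℕ} :
    1 ≤ ∑ a : Answer n, ansProb E κ a := by
  have h0 := ENNReal.tendsto_atTop_zero_of_tsum_ne_top h
  refine ENNReal.le_of_forall_pos_le_add fun ε hε _ => ?_
  have hε' : (0 : ℝ≥0∞) < ε := by exact_mod_cast hε
  obtain ⟨t, ht⟩ := (h0.eventually (gt_mem_nhds hε')).exists
  refine (one_le_halted_add E hd t κ (n := n)).trans (add_le_add ?_ ht.le)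
  exact Finset.sum_le_sum fun a _ => le_iSup
    (fun t => (run E t κ).toOuterMeasure {κ' | κ'.1 = [] ∧ decode n (κ'.2.reg 0) = a}) t

/-! ### Deterministic runs -/

/-- The machine gets from the first configuration to the second one by at most the given number of
deterministic steps. -/
inductive Red (E : Env) : Config → Config → ℕ → Prop
  | refl (κ : Config) (t : ℕ) : Red E κ κ t
  | step {c : Cmd} {K : List Cmd} {σ : State} {κ₁ κ' : Config} {t : ℕ} :
      step E (c :: K, σ) = PMF.pure κ₁ → Red E κ₁ κ' t → Red E (c :: K, σ) κ' (t + 1)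

lemma Red.mono {E : Env} {κ κ' : Config} {t t' : ℕ} (h : Red E κ κ' t) (ht : t ≤ t') :
    Red E κ κ' t' := by
  induction h generalizing t' with
  | refl κ t => exact .refl _ _
  | step h1 _ ih =>
    obtain ⟨s, rfl⟩ : ∃ s, t' = s + 1 := ⟨t' - 1, by omega⟩
    exact .step h1 (ih (by omega))

lemma Red.trans {E : Env} {κ κ' κ'' : Config} {t t' : ℕ} (h : Red E κ κ' t)
    (h' : Red E κ' κ'' t') : Red E κ κ'' (t + t') := by
  induction h with
  | refl κ t => exact h'.mono (by omega)
  | step h1 _ ih => exact (Red.step h1 (ih h')).mono (by omega)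

/-- Deterministic stretches are skipped at the price `θ` per step. The fuel on the right need not be
reduced, since `val` increases with the fuel. -/
lemma val_red {E : Env} {κ κ' : Config} {t : ℕ} (h : Red E κ κ' t) (θ : ℝ≥0∞)
    (r : State → ℝ≥0∞) (N : ℕ) : val E θ r N κ ≤ θ * t + val E θ r N κ' := by
  induction h generalizing N with
  | refl κ t => exact le_add_self
  | @step c K σ κ₁ κ' t h1 _ ih =>
    cases N with
    | zero => simp [val]
    | succ N =>
      rw [val, h1, tsum_pure_mul]
      calc θ + val E θ r N κ₁ ≤ θ + (θ * t + val E θ r N κ') := by gcongr; exact ih N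
        _ ≤ θ + (θ * t + val E θ r (N + 1) κ') := by gcongr; exact val_le_succ E θ r N κ'
        _ = _ := by push_cast; ring

/-- The command leads from the first state to the second one by at most the given number of
deterministic steps. -/
def Run (E : Env) (c : Cmd) (σ σ' : State) (t : ℕ) : Prop :=
  ∀ K, Red E (c :: K, σ) (K, σ') t

lemma Run.mono {E : Env} {c : Cmd} {σ σ' : State} {t t' : ℕ} (h : Run E c σ σ' t) (ht : t ≤ t') :
    Run E c σ σ' t' := fun K => (h K).mono ht

lemma Run.seq {E : Env} {a b : Cmd} {σ σ' σ'' : State} {t t' : ℕ} (h : Run E a σ σ' t)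
    (h' : Run E b σ' σ'' t') : Run E (.seq a b) σ σ'' (t + t' + 1) :=
  fun K => .step (by rfl) ((h (b :: K)).trans (h' K))

/-- Commands without loops and random choices. -/
def straight : Cmd → Prop
  | .rand _ _ => False
  | .loop _ _ => False
  | .seq a b => straight a ∧ straight b
  | .cond _ a b => straight a ∧ straight b
  | _ => True

/-- A bound for the number of steps of a command without loops. -/
def steps : Cmd → ℕ
  | .seq a b => steps a + steps b + 1
  | .cond _ a b => steps a + steps b + 1
  | _ => 1

/-- The effect of a command without loops and random choices. -/
def ex (E : Env) : Cmd → State → State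
  | .const x k, σ => σ.setReg x (k % E.W)
  | .arith o x y z, σ => σ.setReg x (o.eval E.W (σ.reg y) (σ.reg z))
  | .load x y, σ => σ.setReg x (σ.mem (σ.reg y))
  | .store x y, σ => σ.setMem E.size (σ.reg x) (σ.reg y)
  | .near x y, σ => σ.setReg x (E.near (σ.reg y))
  | .hash x y z, σ => σ.setReg x (E.hash (σ.reg y) (σ.reg z))
  | .seq a b, σ => ex E b (ex E a σ)
  | .cond x a b, σ => if σ.reg x ≠ 0 then ex E a σ else ex E b σ
  | _, σ => σ

lemma run_ex (E : Env) : ∀ (c : Cmd) (σ : State), straight c → Run E c σ (ex E c σ) (steps c)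
  | .const x k, σ, _ => fun K => .step rfl (.refl _ _)
  | .arith o x y z, σ, _ => fun K => .step rfl (.refl _ _)
  | .load x y, σ, _ => fun K => .step rfl (.refl _ _)
  | .store x y, σ, _ => fun K => .step rfl (.refl _ _)
  | .near x y, σ, _ => fun K => .step rfl (.refl _ _)
  | .hash x y z, σ, _ => fun K => .step rfl (.refl _ _)
  | .seq a b, σ, h => (run_ex E a σ h.1).seq (run_ex E b _ h.2)
  | .cond x a b, σ, h => fun K => by
    by_cases hx : σ.reg x ≠ 0
    · refine .step (κ₁ := (a :: K, σ)) (by simp [step, hx]) ?_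
      simp only [ex, if_pos hx]
      exact (run_ex E a σ h.1 K).mono (by omega)
    · refine .step (κ₁ := (b :: K, σ)) (by simp only [step, if_neg hx]) ?_
      simp only [ex, if_neg hx]
      exact (run_ex E b σ h.2 K).mono (by omega)

/-- `while x < y do body`, using register `c` for the test. -/
def whileLt (c x y : ℕ) (body : Cmd) : Cmd :=
  .seq (.arith .lt c x y) (.loop c (.seq body (.arith .lt c x y)))

/-- The state after the test `x < y`. -/
def State.test (σ : State) (c x y : ℕ) : State :=
  σ.setReg c (if σ.reg x < σ.reg y then 1 else 0)

lemma red_test (E : Env) (c x y : ℕ) (K : List Cmd) (σ : State) :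
    Red E (.arith .lt c x y :: K, σ) (K, σ.test c x y) 1 := .step rfl (.refl _ _)

/-- The first argument of `Inv` is a strictly decreasing variant and so bounds the number of
iterations. The invariant is required right after the test of the condition, which is where the loop
command reads its register. An iteration costs the body and three further steps: entering the loop,
splitting the sequence, and the next test. -/
lemma run_whileLt {E : Env} {c x y : ℕ} {body : Cmd} (hcx : c ≠ x) (hcy : c ≠ y)
    (Inv : ℕ → State → Prop) (B : ℕ)
    (hbody : ∀ v σ, Inv v σ → σ.reg x < σ.reg y →
      ∃ σ', Run E body σ σ' B ∧ ∃ v' < v, Inv v' (σ'.test c x y))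
    (v : ℕ) (σ : State) (h0 : Inv v (σ.test c x y)) :
    ∃ σ', Run E (whileLt c x y body) σ σ' (v * (B + 3) + 3) ∧
      (∃ v', Inv v' σ') ∧ ¬ σ'.reg x < σ'.reg y := by
  have key : ∀ (v : ℕ) (σ : State), Inv v (σ.test c x y) → ∃ σ', (∃ v', Inv v' σ') ∧ ¬ σ'.reg x < σ'.reg y ∧
      ∀ K, Red E (.loop c (.seq body (.arith .lt c x y)) :: K, σ.test c x y) (K, σ')
        (v * (B + 3) + 1) := by
    intro v
    induction v using Nat.strong_induction_on with
    | _ v ih =>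
    intro σ h
    have hx : (σ.test c x y).reg x = σ.reg x := by
      simp [State.test, State.setReg, Function.update_of_ne hcx.symm]
    have hy : (σ.test c x y).reg y = σ.reg y := by
      simp [State.test, State.setReg, Function.update_of_ne hcy.symm]
    have hc : (σ.test c x y).reg c = if σ.reg x < σ.reg y then 1 else 0 := by
      simp [State.test, State.setReg]
    by_cases hlt : σ.reg x < σ.reg y
    · obtain ⟨σ₁, hrun, v', hv', hinv⟩ := hbody v _ h (by rw [hx, hy]; exact hlt)
      obtain ⟨σ', h1, h2, h3⟩ := ih v' hv' σ₁ hinv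
      refine ⟨σ', h1, h2, fun K => ?_⟩
      have hs : Red E (.loop c (.seq body (.arith .lt c x y)) :: K, σ.test c x y)
          (K, σ') ((B + (1 + (v' * (B + 3) + 1))) + 1 + 1) := by
        refine .step (κ₁ := (.seq body (.arith .lt c x y) ::
          .loop c (.seq body (.arith .lt c x y)) :: K, σ.test c x y)) ?_ ?_
        · simp [step, hc, hlt]
        · refine .step rfl ((hrun _).trans ((red_test E c x y _ _).trans (h3 K)))
      refine hs.mono ?_
      have : (v' + 1) * (B + 3) ≤ v * (B + 3) := Nat.mul_le_mul_right _ hv'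
      linarith
    · refine ⟨_, ⟨v, h⟩, by rw [hx, hy]; exact hlt, fun K => ?_⟩
      refine (Red.step (κ₁ := (K, σ.test c x y)) ?_ (.refl _ 0)).mono (by omega)
      simp [step, hc, hlt]
  obtain ⟨σ', h1, h2, h3⟩ := key v σ h0
  refine ⟨σ', fun K => ?_, h1, h2⟩
  exact (Red.step rfl ((red_test E c x y _ _).trans (h3 K))).mono (by omega)

lemma val_rand (E : Env) (θ : ℝ≥0∞) (r : State → ℝ≥0∞) (N x y k : ℕ) (K : List Cmd) (σ : State)
    (hk : σ.reg y = k) (hk0 : 0 < k) :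
    val E θ r (N + 1) (.rand x y :: K, σ) =
      θ + (∑ z ∈ Finset.range k, val E θ r N (K, σ.setReg x z)) / k := by
  obtain ⟨k, rfl⟩ : ∃ j, k = j + 1 := ⟨k - 1, by omega⟩
  rw [val, step, hk, PMF.map, tsum_bind_mul]
  simp only [Function.comp_apply, tsum_pure_mul]
  congr 1
  rw [tsum_eq_sum (s := Finset.range (k + 1))]
  · rw [ENNReal.div_eq_inv_mul, Finset.mul_sum]
    refine Finset.sum_congr rfl fun z hz => ?_
    rw [uniformBelow, PMF.uniformOfFinset_apply_of_mem _ hz]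
    simp
  · intro z hz
    rw [uniformBelow, PMF.uniformOfFinset_apply_of_notMem _ hz, zero_mul]

end FairANN
namespace FairANN

/-! ### Static perfect hashing -/

lemma card_collide_lt {p : ℕ} (hp : p.Prime) {x y s : ℕ} (hxy : y < x) (hx : x < p) :
    s * ((Finset.Ioc 0 (p - 1)).filter fun a => (a * x % p) % s = (a * y % p) % s).card ≤
      2 * (p - 1) := by
  have hp0 := hp.pos
  set A := (Finset.Ioc 0 (p - 1)).filter fun a => (a * x % p) % s = (a * y % p) % s
  set D := (Finset.Ioc 0 (p - 1)).filter fun b => s ∣ b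
  have hδ : ∀ a ∈ Finset.Ioc 0 (p - 1), a * (x - y) % p ∈ Finset.Ioc 0 (p - 1) := by
    intro a ha
    rw [Finset.mem_Ioc] at ha ⊢
    have h1 := Nat.mod_lt (a * (x - y)) hp0
    refine ⟨Nat.pos_of_ne_zero fun h0 => ?_, by omega⟩
    rcases (Nat.Prime.dvd_mul hp).1 (Nat.dvd_of_mod_eq_zero h0) with h | h
    · exact absurd (Nat.le_of_dvd ha.1 h) (by omega)
    · exact absurd (Nat.le_of_dvd (by omega) h) (by omega)
  have hinj : Set.InjOn (fun a => a * (x - y) % p) (A : Set ℕ) := by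
    intro a ha b hb hab
    have ha' := Finset.mem_Ioc.1 (Finset.mem_filter.1 (Finset.mem_coe.1 ha)).1
    have hb' := Finset.mem_Ioc.1 (Finset.mem_filter.1 (Finset.mem_coe.1 hb)).1
    have hc : Nat.Coprime p (x - y) :=
      (Nat.Prime.coprime_iff_not_dvd hp).2 fun h => absurd (Nat.le_of_dvd (by omega) h) (by omega)
    have h1 : a ≡ b [MOD p] := Nat.ModEq.cancel_right_of_coprime hc hab
    exact Nat.ModEq.eq_of_lt_of_lt h1 (by omega) (by omega)
  have hsub : A.image (fun a => a * (x - y) % p) ⊆ D ∪ D.image (fun b => p - b) := by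
    intro b hb
    obtain ⟨a, ha, rfl⟩ := Finset.mem_image.1 hb
    obtain ⟨ha1, ha2⟩ := Finset.mem_filter.1 ha
    have hd := hδ a ha1
    have hd' := Finset.mem_Ioc.1 hd
    set d := a * (x - y) % p
    have hX := Nat.mod_lt (a * x) hp0
    have hY := Nat.mod_lt (a * y) hp0
    have hsum : a * x % p = (a * y % p + d) % p := by
      rw [← Nat.add_mod, ← Nat.mul_add]
      congr 2; omega
    rw [Finset.mem_union]
    set X := a * x % p
    set Y := a * y % p
    by_cases hlt : Y + d < p
    · left
      rw [Nat.mod_eq_of_lt hlt] at hsum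
      refine Finset.mem_filter.2 ⟨hd, ?_⟩
      have := (Nat.modEq_iff_dvd' (by omega)).1 (show Y ≡ X [MOD s] from ha2.symm)
      rwa [hsum, Nat.add_sub_cancel_left] at this
    · right
      have h2 : X = Y + d - p := by
        rw [hsum, Nat.mod_eq_sub_mod (by omega), Nat.mod_eq_of_lt (by omega)]
      refine Finset.mem_image.2 ⟨p - d, Finset.mem_filter.2 ⟨?_, ?_⟩, by omega⟩
      · rw [Finset.mem_Ioc]; omega
      · have := (Nat.modEq_iff_dvd' (by omega)).1 (show X ≡ Y [MOD s] from ha2)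
        have h3 : Y - X = p - d := by omega
        rwa [h3] at this
  have hD : s * D.card ≤ p - 1 := by
    rw [Nat.Ioc_filter_dvd_card_eq_div]
    exact Nat.mul_div_le _ _
  calc s * A.card = s * (A.image (fun a => a * (x - y) % p)).card := by
        rw [Finset.card_image_of_injOn hinj]
    _ ≤ s * (D.card + D.card) := by
        gcongr
        refine (Finset.card_le_card hsub).trans ((Finset.card_union_le _ _).trans ?_)
        exact add_le_add le_rfl Finset.card_image_le
    _ ≤ _ := by linarith

lemma card_collide_le {p : ℕ} (hp : p.Prime) {x y s : ℕ} (hxy : x ≠ y) (hx : x < p) (hy : y < p) :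
    s * ((Finset.Ioc 0 (p - 1)).filter fun a => (a * x % p) % s = (a * y % p) % s).card ≤
      2 * (p - 1) := by
  rcases lt_or_gt_of_ne hxy with h | h
  · simp only [eq_comm (a := (_ * x % p) % s)]
    exact card_collide_lt hp h hy
  · exact card_collide_lt hp h hx

/-- Some multiplier does at least as well as the average over all `p - 1` of them, and each pair of
keys collides for few multipliers by `card_collide_le`. -/
lemma exists_multiplier {p : ℕ} (hp : p.Prime) (T : Finset ℕ) (hT : ∀ x ∈ T, x < p) (s : ℕ) :
    ∃ a < p,
      s * (T.offDiag.filter fun z => (a * z.1 % p) % s = (a * z.2 % p) % s).card ≤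
        2 * T.offDiag.card := by
  have hne : (Finset.Ioc 0 (p - 1)).Nonempty := ⟨1, by
    rw [Finset.mem_Ioc]; have := hp.two_le; omega⟩
  obtain ⟨a, ha, h⟩ := Finset.exists_le_of_sum_le (s := Finset.Ioc 0 (p - 1)) hne
    (f := fun a => s * (T.offDiag.filter fun z => (a * z.1 % p) % s = (a * z.2 % p) % s).card)
    (g := fun _ => 2 * T.offDiag.card) (by
      simp only [Finset.card_filter]
      rw [← Finset.mul_sum, Finset.sum_comm, Finset.mul_sum, Finset.sum_const, Nat.card_Ioc,
        smul_eq_mul]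
      calc _ ≤ ∑ z ∈ T.offDiag, 2 * (p - 1) := by
            refine Finset.sum_le_sum fun z hz => ?_
            rw [Finset.mem_offDiag] at hz
            rw [← Finset.card_filter]
            exact card_collide_le hp hz.2.2 (hT _ hz.1) (hT _ hz.2.1)
        _ = _ := by rw [Finset.sum_const, smul_eq_mul, Nat.sub_zero]; ring)
  exact ⟨a, by have := Finset.mem_Ioc.1 ha; have := hp.two_le; omega, h⟩

/-- The slot of the key `x` in a two-level hash table. -/
def slot (p N α : ℕ) (β off sz : ℕ → ℕ) (x : ℕ) : ℕ :=
  off (α * x % p % N) + β (α * x % p % N) * x % p % sz (α * x % p % N)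

/-- This is the two-level scheme of Fredman, Komlós and Szemerédi: a first multiplier with linearly
many colliding pairs, then an injective second-level function for each first-level bucket. -/
lemma exists_perfect_hash {p : ℕ} (hp : p.Prime) (T : Finset ℕ) (hT : ∀ x ∈ T, x < p) {N : ℕ}
    (hN : 0 < N) (hTN : T.card ≤ N) :
    ∃ (α : ℕ) (β off sz : ℕ → ℕ), α < p ∧ (∀ i, β i < p) ∧ (∀ i, 0 < sz i) ∧
      (∀ i < N, off i + sz i ≤ 5 * N) ∧ Set.InjOn (slot p N α β off sz) T := by
  obtain ⟨α, hα, hcol⟩ := exists_multiplier hp T hT N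
  let F : ℕ → Finset ℕ := fun i => T.filter fun x => α * x % p % N = i
  -- Being larger than twice the number of ordered pairs, this size makes the bound of
  -- `exists_multiplier` less than one collision, that is, none.
  let sz : ℕ → ℕ := fun i => 2 * (F i).offDiag.card + 1
  let off : ℕ → ℕ := fun i => ∑ j ∈ Finset.range i, sz j
  have hβ : ∀ i, ∃ b < p, sz i *
      ((F i).offDiag.filter fun z => (b * z.1 % p) % sz i = (b * z.2 % p) % sz i).card ≤
        2 * (F i).offDiag.card := fun i =>
    exists_multiplier hp (F i) (fun x hx => hT x (Finset.mem_filter.1 hx).1) (sz i)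
  choose β hβp hβc using hβ
  have hβ0 : ∀ i, ∀ x ∈ F i, ∀ y ∈ F i, (β i * x % p) % sz i = (β i * y % p) % sz i → x = y := by
    intro i x hx y hy h
    by_contra hne
    have h1 : 1 ≤ ((F i).offDiag.filter fun z =>
        (β i * z.1 % p) % sz i = (β i * z.2 % p) % sz i).card :=
      Finset.card_pos.2 ⟨(x, y), Finset.mem_filter.2
        ⟨Finset.mem_offDiag.2 ⟨hx, hy, hne⟩, h⟩⟩
    have h2 := hβc i
    have h3 : sz i * 1 ≤ 2 * (F i).offDiag.card := (Nat.mul_le_mul_left _ h1).trans h2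
    simp only [sz] at h3
    omega
  have hoff : ∀ i j, i < j → off i + sz i ≤ off j := by
    intro i j hij
    rw [← Finset.sum_range_succ]
    exact Finset.sum_le_sum_of_subset (Finset.range_subset_range.2 hij)
  refine ⟨α, β, off, sz, hα, hβp, fun i => Nat.succ_pos _, ?_, ?_⟩
  · intro i hi
    -- The sizes sum to `N` plus twice the number of ordered pairs colliding on the first level, and
    -- there are at most `2 * N` such pairs.
    have h1 : off N ≤ 5 * N := by
      have hfib : ∑ i ∈ Finset.range N, (F i).offDiag.card =
          (T.offDiag.filter fun z => (α * z.1 % p) % N = (α * z.2 % p) % N).card := by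
        rw [Finset.card_eq_sum_card_fiberwise (f := fun z : ℕ × ℕ => α * z.1 % p % N)
          (t := Finset.range N)]
        · refine Finset.sum_congr rfl fun i _ => ?_
          congr 1
          ext ⟨x, y⟩
          simp only [F, Finset.mem_offDiag, Finset.mem_filter]
          constructor
          · rintro ⟨⟨h1, h2⟩, ⟨h3, h4⟩, h5⟩
            exact ⟨⟨⟨h1, h3, h5⟩, h2.trans h4.symm⟩, h2⟩
          · rintro ⟨⟨⟨h1, h3, h5⟩, h6⟩, h2⟩
            exact ⟨⟨h1, h2⟩, ⟨h3, h6.symm.trans h2⟩, h5⟩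
        · intro z _
          exact Finset.mem_coe.2 (Finset.mem_range.2 (Nat.mod_lt _ hN))
      have hc : (T.offDiag.filter fun z => (α * z.1 % p) % N = (α * z.2 % p) % N).card ≤
          2 * N := by
        refine Nat.le_of_mul_le_mul_left (hcol.trans ?_) hN
        rw [Finset.offDiag_card]
        have : T.card * T.card ≤ N * N := Nat.mul_le_mul hTN hTN
        calc _ ≤ 2 * (N * N) := by omega
          _ = _ := by ring
      simp only [off, sz, Finset.sum_add_distrib, ← Finset.mul_sum, hfib, Finset.sum_const,
        Finset.card_range, smul_eq_mul]
      omega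
    exact (hoff i N hi).trans h1
  · intro x hx y hy h
    have hr : ∀ x i, β i * x % p % sz i < sz i := fun x i => Nat.mod_lt _ (Nat.succ_pos _)
    simp only [slot] at h
    have hi : α * x % p % N = α * y % p % N := by
      rcases lt_trichotomy (α * x % p % N) (α * y % p % N) with h1 | h1 | h1
      · have h2 := hoff _ _ h1
        have h3 := hr x (α * x % p % N)
        omega
      · exact h1
      · have h2 := hoff _ _ h1
        have h3 := hr y (α * y % p % N)
        omega
    rw [hi] at h
    exact hβ0 (α * y % p % N) x (Finset.mem_filter.2 ⟨hx, hi⟩) y (Finset.mem_filter.2 ⟨hy, rfl⟩)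
      (by omega)

end FairANN
namespace FairANN

/-! ### Macros -/

@[simp] lemma setReg_reg (σ : State) (x v y : ℕ) :
    (σ.setReg x v).reg y = if y = x then v else σ.reg y := by
  simp [State.setReg, Function.update_apply]

@[simp] lemma setReg_mem (σ : State) (x v : ℕ) : (σ.setReg x v).mem = σ.mem := rfl

@[simp] lemma test_reg (σ : State) (c x y z : ℕ) :
    (σ.test c x y).reg z = if z = c then (if σ.reg x < σ.reg y then 1 else 0) else σ.reg z := by
  simp [State.test]

@[simp] lemma test_mem (σ : State) (c x y : ℕ) : (σ.test c x y).mem = σ.mem := rfl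

/-- Entry `i` of the array number `r`. The memory interleaves 17 arrays. -/
def arr (σ : State) (r i : ℕ) : ℕ := σ.mem (17 * i + r)

/-- Change an array entry. -/
def State.putArr (σ : State) (r i v : ℕ) : State :=
  { σ with mem := Function.update σ.mem (17 * i + r) v }

@[simp] lemma arr_setReg (σ : State) (x v r i : ℕ) : arr (σ.setReg x v) r i = arr σ r i := rfl

@[simp] lemma arr_test (σ : State) (c x y r i : ℕ) : arr (σ.test c x y) r i = arr σ r i := rfl

@[simp] lemma putArr_reg (σ : State) (r i v : ℕ) : (σ.putArr r i v).reg = σ.reg := rfl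

lemma arr_putArr (σ : State) {r r' i i' v : ℕ} (hr : r < 17) (hr' : r' < 17) :
    arr (σ.putArr r i v) r' i' = if r' = r ∧ i' = i then v else arr σ r' i' := by
  simp only [arr, State.putArr, Function.update_apply]
  congr 1
  apply propext
  constructor
  · intro h; omega
  · rintro ⟨rfl, rfl⟩; rfl

infixr:60 " ;; " => Cmd.seq

/-- Read entry `reg y` of the array `r`. -/
def get (x r y : ℕ) : Cmd :=
  .const 30 17 ;; .arith .mul 30 30 y ;; .const 31 r ;; .arith .add 30 30 31 ;; .load x 30

/-- Write `reg x` to entry `reg y` of the array `r`. -/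
def put (r y x : ℕ) : Cmd :=
  .const 30 17 ;; .arith .mul 30 30 y ;; .const 31 r ;; .arith .add 30 30 31 ;; .store 30 x

/-- Copy register `y` to register `x`. -/
def copy (x y : ℕ) : Cmd := .const 30 0 ;; .arith .add x y 30

/-- Set register `x` to a nonzero value if and only if the registers `y` and `z` differ. -/
def differ (x y z : ℕ) : Cmd := .arith .sub 30 y z ;; .arith .sub x z y ;; .arith .add x x 30

lemma State.ext' {σ σ' : State} (h : ∀ z, σ.reg z = σ'.reg z) (hm : σ.mem = σ'.mem) : σ = σ' := by
  cases σ; cases σ'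
  simp only [State.mk.injEq]
  exact ⟨funext h, hm⟩

lemma ex_get {E : Env} {σ : State} {x r y : ℕ} (hy : y < 30)
    (hW : 17 * σ.reg y + r < E.W) :
    ex E (get x r y) σ =
      ((σ.setReg 31 r).setReg 30 (17 * σ.reg y + r)).setReg x (arr σ r (σ.reg y)) := by
  have hW' : 17 * σ.reg y + r < E.W := hW
  have hy' : y ≠ 30 := by omega
  have hr' : r < E.W := by omega
  -- At index `0` the constant `17` may itself be reduced modulo `E.W`, but it is then multiplied by
  -- `0`. At any other index the address bound implies `17 < E.W`.
  by_cases h0 : σ.reg y = 0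
  · refine State.ext' (fun z => ?_) rfl
    simp only [get, ex, setReg_reg, setReg_mem, Op.eval, arr, hy', if_false, if_true]
    simp [h0, Nat.mod_eq_of_lt hr']
    grind
  · have h17 : 17 < E.W ∨ (17 * σ.reg y + r < E.W ∧ 17 = E.W) := by omega
    rcases h17 with h17 | h17
    · refine State.ext' (fun z => ?_) rfl
      simp only [get, ex, setReg_reg, setReg_mem, Op.eval, arr, hy', if_false, if_true]
      simp [Nat.mod_eq_of_lt hr', Nat.mod_eq_of_lt h17, Nat.mod_eq_of_lt hW']
      grind
    · omega

lemma ex_put {E : Env} {σ : State} {x r y : ℕ} (hx : x < 30) (hy : y < 30)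
    (hW : 17 * σ.reg y + r < E.W) (hs : 17 * σ.reg y + r < E.size) :
    ex E (put r y x) σ =
      ((σ.setReg 31 r).setReg 30 (17 * σ.reg y + r)).putArr r (σ.reg y) (σ.reg x) := by
  have hy' : y ≠ 30 := by omega
  have hx' : x ≠ 30 := by omega
  have hx'' : x ≠ 31 := by omega
  have hr' : r < E.W := by omega
  have e : ex E (.const 30 17 ;; .arith .mul 30 30 y ;; .const 31 r ;; .arith .add 30 30 31) σ =
      (σ.setReg 31 r).setReg 30 (17 * σ.reg y + r) := by
    refine State.ext' (fun z => ?_) rfl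
    simp only [ex, setReg_reg, Op.eval, hy', if_false, if_true]
    simp [Nat.mod_eq_of_lt hr', Nat.mod_eq_of_lt hW]
    grind
  have : ex E (put r y x) σ = ex E (.store 30 x)
      (ex E (.const 30 17 ;; .arith .mul 30 30 y ;; .const 31 r ;; .arith .add 30 30 31) σ) := rfl
  rw [this, e]
  simp [ex, State.setMem, hs, State.putArr, hx', hx'']

lemma ex_copy {E : Env} {σ : State} {x y : ℕ} (hy : y < 30) (hW : σ.reg y < E.W) :
    ex E (copy x y) σ = (σ.setReg 30 0).setReg x (σ.reg y) := by
  have hy' : y ≠ 30 := by omega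
  refine State.ext' (fun z => ?_) rfl
  simp [copy, ex, Op.eval, hy', Nat.mod_eq_of_lt hW]

/-- A number that is nonzero if and only if `a` and `b` differ. -/
def diffVal (a b : ℕ) : ℕ := b - a + (a - b)

@[simp] lemma diffVal_eq_zero (a b : ℕ) : diffVal a b = 0 ↔ a = b := by
  unfold diffVal; omega

lemma ex_differ {E : Env} {σ : State} {x y z : ℕ} (hx : x < 30) (hy : y < 30) (hz : z < 30)
    (hyW : σ.reg y < E.W) (hzW : σ.reg z < E.W) :
    ex E (differ x y z) σ = (σ.setReg 30 (σ.reg y - σ.reg z)).setReg x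
      (diffVal (σ.reg y) (σ.reg z)) := by
  have hx' : 30 ≠ x := by omega
  have hy' : y ≠ 30 := by omega
  have hz' : z ≠ 30 := by omega
  have : σ.reg z - σ.reg y + (σ.reg y - σ.reg z) < E.W := by omega
  refine State.ext' (fun w => ?_) rfl
  simp [differ, ex, Op.eval, diffVal, hy', hz', hx', Nat.mod_eq_of_lt this]
  grind

end FairANN
namespace FairANN

/-! ### The first phase of a query: locating the query in every half table -/

/-- The parameters of a memory image, and its content. -/
structure Image where
  (n kap G L N p alpha X : ℕ)
  T : ℕ → ℕ → ℕ

/-- The numerical bounds under which the query program runs without overflow. -/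
structure Image.Fits (I : Image) (E : Env) : Prop where
  size : E.size = 17 * I.X
  hW : 17 * I.X ≤ E.W
  addr : ∀ i < I.X, ∀ r < 17, 17 * i + r < E.W
  addr' : ∀ i < I.X, ∀ r < 17, 17 * i + r < E.size
  n_pos : 0 < I.n
  L_pos : 0 < I.L
  N_pos : 0 < I.N
  p_pos : 0 < I.p
  Gn : I.G * I.n ≤ I.X
  G_le : I.G < I.X
  L_le : 3 * I.L < I.X
  N_le : I.N ≤ I.X
  X_gt : 7 < I.X
  Gkap : I.G * I.kap + I.kap < E.W
  n_lt : 2 * I.n + 2 < E.W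
  key : (I.L * (I.n + 1) + I.n) * (I.n + 1) + I.n + 1 < E.W
  keyp : (I.L * (I.n + 1) + I.n) * (I.n + 1) + I.n < I.p
  pp : I.p * I.p ≤ E.W
  Z : 3 * (I.n * I.L) + I.L + I.n < E.W

/-- The state holds the memory image, and its parameters are in the registers. -/
structure Loaded (I : Image) (σ : State) : Prop where
  r1 : σ.reg 1 = I.n
  r2 : σ.reg 2 = I.kap
  r3 : σ.reg 3 = I.G
  r4 : σ.reg 4 = I.L
  r5 : σ.reg 5 = I.N
  r6 : σ.reg 6 = I.p
  r7 : σ.reg 7 = I.alpha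
  r8 : σ.reg 8 = 1
  mem : ∀ r < 12, ∀ i < I.X, arr σ r i = I.T r i

/-- The first nonzero value among `f i, …, f (i + k - 1)`, and `0` if there is none. -/
def lexCmp (f : ℕ → ℕ) : ℕ → ℕ → ℕ
  | _, 0 => 0
  | i, k + 1 => if f i ≠ 0 then f i else lexCmp f (i + 1) k

/-- Compare the query with the data point in register `14` lexicographically. -/
def lexLoop : Cmd :=
  whileLt 24 15 2
    (.hash 16 18 14 ;; .arith .add 18 18 8 ;; .arith .add 15 15 8 ;;
      .cond 16 (copy 15 2) (.const 29 0))

lemma run_lexLoop {E : Env} {σ : State} {k f z : ℕ} (h2 : σ.reg 2 = k) (h8 : σ.reg 8 = 1)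
    (h14 : σ.reg 14 = z) (h15 : σ.reg 15 = 0) (h16 : σ.reg 16 = 0) (h18 : σ.reg 18 = f)
    (hW : f + k < E.W) :
    ∃ σ', Run E lexLoop σ σ' (k * 14 + 3) ∧ σ'.reg 16 = lexCmp (fun j => E.hash j z) f k ∧
      σ'.mem = σ.mem ∧
      ∀ y, y < 15 ∨ (18 < y ∧ y < 24) ∨ (24 < y ∧ y < 29) → σ'.reg y = σ.reg y := by
  -- Either the first `l` labels agree and the remaining `v` ones decide the comparison, or a
  -- difference has been found and the counter has been moved to `k`, which ends the loop early.
  let Inv : ℕ → State → Prop := fun v τ =>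
    (((∃ l, l + v = k ∧ τ.reg 15 = l ∧ τ.reg 18 = f + l ∧ τ.reg 16 = 0 ∧
      lexCmp (fun j => E.hash j z) f k = lexCmp (fun j => E.hash j z) (f + l) v) ∨
      (τ.reg 15 = k ∧ τ.reg 16 = lexCmp (fun j => E.hash j z) f k)) ∧ τ.mem = σ.mem ∧
      ∀ y, y < 15 ∨ (18 < y ∧ y < 24) ∨ (24 < y ∧ y < 29) → τ.reg y = σ.reg y)
  have key := run_whileLt (E := E) (c := 24) (x := 15) (y := 2)
    (body := .hash 16 18 14 ;; .arith .add 18 18 8 ;; .arith .add 15 15 8 ;;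
      .cond 16 (copy 15 2) (.const 29 0)) (by norm_num) (by norm_num) Inv 11 ?_ k σ ?_
  · obtain ⟨σ', hrun, ⟨v, hinv, hm, hr⟩, hlt⟩ := key
    refine ⟨σ', hrun, ?_, hm, hr⟩
    rw [hr 2 (by omega), h2] at hlt
    rcases hinv with ⟨l, h1, h2, h3, h4, h5⟩ | ⟨_, h⟩
    · obtain rfl : v = 0 := by omega
      rw [h4, h5, lexCmp]
    · exact h
  · rintro v τ ⟨hinv, hm, hr⟩ hlt
    rw [hr 2 (by omega), h2] at hlt
    have t2 : τ.reg 2 = k := by rw [hr 2 (by omega), h2]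
    have t8 : τ.reg 8 = 1 := by rw [hr 8 (by omega), h8]
    have t14 : τ.reg 14 = z := by rw [hr 14 (by omega), h14]
    rcases hinv with ⟨l, h1, h2', h3, h4, h5⟩ | ⟨h, _⟩
    swap
    · omega
    obtain ⟨w, rfl⟩ : ∃ w, v = w + 1 := ⟨v - 1, by omega⟩
    have w1 : f + l + 1 < E.W := by omega
    have w2 : l + 1 < E.W := by omega
    have w3 : k < E.W := by omega
    refine ⟨_, run_ex E _ τ (by simp [straight, copy]), w, by omega, ?_⟩
    rw [lexCmp] at h5
    by_cases hz : E.hash (f + l) z = 0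
    · rw [if_neg (by simpa using hz)] at h5
      refine ⟨Or.inl ⟨l + 1, ?_, ?_, ?_, ?_, ?_⟩, ?_, ?_⟩
      · omega
      · simp [ex, t8, t14, h2', h3, hz, Op.eval, Nat.mod_eq_of_lt w2]
      · simp [ex, t8, t14, h2', h3, hz, Op.eval, Nat.mod_eq_of_lt w1, ← add_assoc]
      · simp [ex, t8, t14, h2', h3, hz, Op.eval]
      · exact h5
      · simp [ex, t8, t14, h2', h3, hz, Op.eval, hm]
      · intro y hy
        rw [← hr y hy]
        simp only [test_reg, ex, t8, t14, h2', h3, hz, Op.eval, setReg_reg]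
        simp
        grind
    · rw [if_pos hz] at h5
      refine ⟨Or.inr ⟨?_, ?_⟩, ?_, ?_⟩
      · simp [ex, t2, t8, t14, h2', h3, hz, Op.eval, ex_copy, w3]
      · simp [ex, t2, t8, t14, h2', h3, hz, Op.eval, ex_copy, w3, h5]
      · simp [ex, t2, t8, t14, h2', h3, hz, Op.eval, ex_copy, w3, hm]
      · intro y hy
        rw [← hr y hy]
        simp [ex, t2, t8, t14, h2', h3, hz, Op.eval, ex_copy, w3]
        grind
  · refine ⟨Or.inl ⟨0, by omega, by simp [h15], by simp [h18], by simp [h16], by simp⟩, rfl, ?_⟩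
    intro y hy
    simp
    grind

/-- Compare the query with a data point in the half table `g`. -/
def Image.cm (I : Image) (E : Env) (g x : ℕ) : ℕ := lexCmp (fun j => E.hash j x) (g * I.kap) I.kap

/-- What the image has to fulfil in relation to the query: the points of each half table are sorted
with respect to the query, and the group numbers describe the equality of labels. -/
structure Image.Sorted (I : Image) (E : Env) : Prop where
  cm_le : ∀ g < I.G, ∀ x < I.n, I.cm E g x ≤ 2
  ord_lt : ∀ g < I.G, ∀ i < I.n, I.T 1 (g * I.n + i) < I.n
  ord_surj : ∀ g < I.G, ∀ x < I.n, ∃ i < I.n, I.T 1 (g * I.n + i) = x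
  ord_one : ∀ g < I.G, ∀ i j, i ≤ j → j < I.n →
    I.cm E g (I.T 1 (g * I.n + i)) = 1 → I.cm E g (I.T 1 (g * I.n + j)) = 1
  ord_two : ∀ g < I.G, ∀ i j, i ≤ j → j < I.n →
    I.cm E g (I.T 1 (g * I.n + j)) = 2 → I.cm E g (I.T 1 (g * I.n + i)) = 2
  gid_lt : ∀ g < I.G, ∀ x < I.n, I.T 2 (g * I.n + x) < I.n
  gid : ∀ g < I.G, ∀ x < I.n, ∀ y < I.n, I.cm E g x = 0 →
    (I.T 2 (g * I.n + y) = I.T 2 (g * I.n + x) ↔ I.cm E g y = 0)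

/-- `v` is the group number of the query in the half table `g`. -/
def Image.IsGroup (I : Image) (E : Env) (g v : ℕ) : Prop :=
  v ≤ I.n ∧ ∀ x < I.n, (I.T 2 (g * I.n + x) = v ↔ I.cm E g x = 0)

/-- Binary search for the query in the half table in register `10`. -/
def searchLoop : Cmd :=
  whileLt 25 11 12
    ((.arith .add 13 11 12 ;; .const 19 2 ;; .arith .div 13 13 19 ;; .arith .mul 19 10 1 ;;
        .arith .add 19 19 13 ;; get 14 1 19 ;; .const 15 0 ;; .const 16 0 ;; .arith .mul 18 10 2) ;;
      lexLoop ;;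
      .cond 16
        (.arith .sub 16 16 8 ;; .cond 16 (.arith .add 11 13 8) (copy 12 13))
        (.arith .mul 19 10 1 ;; .arith .add 19 19 14 ;; get 20 2 19 ;; copy 12 11))

/-- The invariant says that the query is greater than all points before register `11` and less than
all points from register `12` on. The gap at least halves in each round, so `I.n.size` rounds
suffice. On equality the gap is closed by hand after reading the group number. -/
lemma run_searchLoop {I : Image} {E : Env} (hF : I.Fits E) (hS : I.Sorted E) {σ : State}
    (hL : Loaded I σ) {g : ℕ} (hg : g < I.G) (h10 : σ.reg 10 = g) (h11 : σ.reg 11 = 0)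
    (h12 : σ.reg 12 = I.n) (h20 : σ.reg 20 = I.n) :
    ∃ σ', Run E searchLoop σ σ' (I.n.size * (I.kap * 14 + 61) + 3) ∧ I.IsGroup E g (σ'.reg 20) ∧
      σ'.mem = σ.mem ∧ ∀ y, y < 11 ∨ (25 < y ∧ y < 29) → σ'.reg y = σ.reg y := by
  let Inv : ℕ → State → Prop := fun v τ =>
    (τ.reg 12 ≤ I.n ∧ τ.reg 12 - τ.reg 11 < 2 ^ v ∧
      ((τ.reg 20 = I.n ∧ (∀ i < τ.reg 11, i < I.n → I.cm E g (I.T 1 (g * I.n + i)) = 2) ∧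
        ∀ i, τ.reg 12 ≤ i → i < I.n → I.cm E g (I.T 1 (g * I.n + i)) = 1) ∨
      (τ.reg 12 ≤ τ.reg 11 ∧ I.IsGroup E g (τ.reg 20)))) ∧ τ.mem = σ.mem ∧
      ∀ y, y < 11 ∨ (25 < y ∧ y < 29) → τ.reg y = σ.reg y
  have key := run_whileLt (E := E) (c := 25) (x := 11) (y := 12)
    (body := (.arith .add 13 11 12 ;; .const 19 2 ;; .arith .div 13 13 19 ;; .arith .mul 19 10 1 ;;
        .arith .add 19 19 13 ;; get 14 1 19 ;; .const 15 0 ;; .const 16 0 ;; .arith .mul 18 10 2) ;;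
      lexLoop ;;
      .cond 16
        (.arith .sub 16 16 8 ;; .cond 16 (.arith .add 11 13 8) (copy 12 13))
        (.arith .mul 19 10 1 ;; .arith .add 19 19 14 ;; get 20 2 19 ;; copy 12 11))
    (by norm_num) (by norm_num) Inv (I.kap * 14 + 58) ?_ I.n.size σ ?_
  · obtain ⟨σ', hrun, ⟨v, ⟨h1, h2, hinv⟩, hm, hr⟩, hlt⟩ := key
    refine ⟨σ', hrun, ?_, hm, hr⟩
    rcases hinv with ⟨h3, h4, h5⟩ | ⟨_, h⟩
    -- The search ended without equality, so every point differs from the query. The default group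
    -- number `n` is then right, because those of the data points are below `n`.
    · refine ⟨h3.le, fun x hx => ?_⟩
      have hne : I.cm E g x ≠ 0 := by
        obtain ⟨i, hi, rfl⟩ := hS.ord_surj g hg x hx
        by_cases hi' : i < σ'.reg 11
        · rw [h4 i hi' hi]; norm_num
        · rw [h5 i (by omega) hi]; norm_num
      have := hS.gid_lt g hg x hx
      simp only [hne, iff_false]
      omega
    · exact h
  · rintro v τ ⟨⟨h1, h2, hinv⟩, hm, hr⟩ hlt
    obtain ⟨h3, h4, h5⟩ : τ.reg 20 = I.n ∧
        (∀ i < τ.reg 11, i < I.n → I.cm E g (I.T 1 (g * I.n + i)) = 2) ∧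
        ∀ i, τ.reg 12 ≤ i → i < I.n → I.cm E g (I.T 1 (g * I.n + i)) = 1 := by
      rcases hinv with h | h
      · exact h
      · omega
    have t1 : τ.reg 1 = I.n := by rw [hr 1 (by omega), hL.r1]
    have t2 : τ.reg 2 = I.kap := by rw [hr 2 (by omega), hL.r2]
    have t8 : τ.reg 8 = 1 := by rw [hr 8 (by omega), hL.r8]
    have t10 : τ.reg 10 = g := by rw [hr 10 (by omega), h10]
    obtain ⟨w, rfl⟩ : ∃ w, v = w + 1 := ⟨v - 1, by
      rcases Nat.eq_zero_or_pos v with rfl | h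
      · simp at h2; omega
      · omega⟩
    rw [pow_succ] at h2
    have hn := hF.n_lt
    have hgn : g * I.n + I.n ≤ I.X := by
      refine le_trans ?_ hF.Gn
      rw [← Nat.succ_mul]
      exact Nat.mul_le_mul_right _ hg
    have hgk : g * I.kap + I.kap < E.W := by
      refine lt_of_le_of_lt ?_ hF.Gkap
      exact Nat.add_le_add_right (Nat.mul_le_mul_right _ hg.le) _
    have hX := hF.hW
    have hX0 := hF.X_gt
    generalize hlo : τ.reg 11 = lo at *
    generalize hhi : τ.reg 12 = hi at *
    obtain ⟨mid, hmid⟩ : ∃ mid, mid = (lo + hi) / 2 := ⟨_, rfl⟩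
    have hmid1 : lo ≤ mid := by omega
    have hmid2 : mid < hi := by omega
    have w1 : lo + hi < E.W := by omega
    have w2 : 2 < E.W := by omega
    have w3 : g * I.n < E.W := by omega
    have w4 : g * I.n + mid < E.W := by omega
    have w5 : 17 * (g * I.n + mid) + 1 < E.W := hF.addr _ (by omega) _ (by norm_num)
    have w6 : g * I.kap < E.W := by omega
    obtain ⟨x, hx⟩ : ∃ x, x = I.T 1 (g * I.n + mid) := ⟨_, rfl⟩
    have hxn : x < I.n := by rw [hx]; exact hS.ord_lt g hg mid (by omega)
    have harr : ∀ r < 12, ∀ i < I.X, arr τ r i = I.T r i := by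
      intro r hr i hi
      rw [← hL.mem r hr i hi]; simp only [arr, hm]
    have harr1 : arr τ 1 (g * I.n + mid) = x := by rw [hx]; exact harr 1 (by norm_num) _ (by omega)
    have w7 : g * I.n + x < E.W := by omega
    have w8 : 17 * (g * I.n + x) + 2 < E.W := hF.addr _ (by omega) _ (by norm_num)
    have w9 : mid + 1 < E.W := by omega
    have w10 : lo < E.W := by omega
    have w11 : mid < E.W := by omega
    set A : Cmd := (.arith .add 13 11 12 ;; .const 19 2 ;; .arith .div 13 13 19 ;;
        .arith .mul 19 10 1 ;;
        .arith .add 19 19 13 ;; get 14 1 19 ;; .const 15 0 ;; .const 16 0 ;; .arith .mul 18 10 2)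
      with hA
    have hAr : ∀ y, (ex E A τ).reg y = if y = 13 then mid else if y = 14 then x else
        if y = 15 then 0 else if y = 16 then 0 else if y = 18 then g * I.kap else
        if y = 19 then g * I.n + mid else if y = 30 then 17 * (g * I.n + mid) + 1 else
        if y = 31 then 1 else τ.reg y := by
      intro y
      simp [hA, ex, Op.eval, t1, t2, t10, hlo, hhi, ex_get, Nat.mod_eq_of_lt, w1, w2, w3, w4,
        w5, w6, ← hmid, harr1]
      grind
    have hAm : (ex E A τ).mem = τ.mem := by simp [hA, ex, Op.eval, get]
    obtain ⟨σ₂, run₂, c16, m₂, r₂⟩ := run_lexLoop (E := E) (σ := ex E A τ) (k := I.kap)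
      (f := g * I.kap) (z := x) (by simp [hAr, t2]) (by simp [hAr, t8]) (by simp [hAr])
      (by simp [hAr]) (by simp [hAr]) (by simp [hAr]) hgk
    have hcm : σ₂.reg 16 = I.cm E g x := c16
    have s : ∀ y, y < 13 ∨ (19 < y ∧ y < 24) ∨ (24 < y ∧ y < 29) → σ₂.reg y = τ.reg y := by
      intro y hy
      rw [r₂ y (by omega), hAr]
      have : y ≠ 13 ∧ y ≠ 14 ∧ y ≠ 15 ∧ y ≠ 16 ∧ y ≠ 18 ∧ y ≠ 19 ∧ y ≠ 30 ∧ y ≠ 31 := by omega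
      simp [this]
    have s13 : σ₂.reg 13 = mid := by rw [r₂ 13 (by omega), hAr]; simp
    have s14 : σ₂.reg 14 = x := by rw [r₂ 14 (by omega), hAr]; simp
    have s1 := (s 1 (by omega)).trans t1
    have s8 := (s 8 (by omega)).trans t8
    have s10 := (s 10 (by omega)).trans t10
    have s11 := (s 11 (by omega)).trans hlo
    have s12 := (s 12 (by omega)).trans hhi
    have s20 := (s 20 (by omega)).trans h3
    have harr2 : arr σ₂ 2 (g * I.n + x) = I.T 2 (g * I.n + x) := by
      rw [← harr 2 (by norm_num) _ (by omega)]; simp only [arr, m₂, hAm]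
    have hmem2 : σ₂.mem = σ.mem := by rw [m₂, hAm, hm]
    have hfr : ∀ y, y < 11 ∨ (25 < y ∧ y < 29) → σ₂.reg y = σ.reg y := fun y hy =>
      (s y (by omega)).trans (hr y hy)
    refine ⟨_, ((run_ex E A τ (by simp [hA, straight, get])).seq (run₂.seq
      (run_ex E _ σ₂ (by simp [straight, get, copy])))).mono (by simp [hA, steps, get, copy]; omega),
      w, by omega, ?_⟩
    have hcases : I.cm E g x = 0 ∨ I.cm E g x = 1 ∨ I.cm E g x = 2 := by
      have := hS.cm_le g hg x hxn
      omega
    rcases hcases with hc | hc | hc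
    · have hq : I.IsGroup E g (I.T 2 (g * I.n + x)) :=
        ⟨(hS.gid_lt g hg x hxn).le, fun y hy => hS.gid g hg x hxn y hy hc⟩
      refine ⟨⟨?_, ?_, Or.inr ⟨?_, ?_⟩⟩, ?_, ?_⟩
      · simp [ex, hcm, hc, s1, s10, s11, s14, Op.eval, ex_get, ex_copy, Nat.mod_eq_of_lt, w3, w7,
          w8, w10]
        omega
      · simp [ex, hcm, hc, s1, s10, s11, s14, Op.eval, ex_get, ex_copy, Nat.mod_eq_of_lt, w3, w7,
          w8, w10]
      · simp [ex, hcm, hc, s1, s10, s11, s14, Op.eval, ex_get, ex_copy, Nat.mod_eq_of_lt, w3, w7,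
          w8, w10]
      · simp [ex, hcm, hc, s1, s10, s11, s14, Op.eval, ex_get, ex_copy, Nat.mod_eq_of_lt, w3, w7,
          w8, w10, harr2, hq]
      · simp [ex, hcm, hc, s1, s10, s11, s14, Op.eval, ex_get, ex_copy, Nat.mod_eq_of_lt, w3, w7,
          w8, w10, hmem2]
      · intro y hy
        rw [← hfr y hy]
        simp [ex, hcm, hc, s1, s10, s11, s14, Op.eval, ex_get, ex_copy, Nat.mod_eq_of_lt, w3, w7,
          w8, w10]
        grind
    · have hE : ∀ y, y < 15 ∨ (16 < y ∧ y < 25) ∨ (25 < y ∧ y < 29) →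
          ((ex E (.cond 16
          (.arith .sub 16 16 8 ;; .cond 16 (.arith .add 11 13 8) (copy 12 13))
          (.arith .mul 19 10 1 ;; .arith .add 19 19 14 ;; get 20 2 19 ;; copy 12 11)) σ₂).test
            25 11 12).reg y = if y = 12 then mid else σ₂.reg y := by
        intro y hy
        simp [ex, hcm, hc, s8, s13, Op.eval, ex_copy, w11]
        grind
      refine ⟨⟨?_, ?_, Or.inl ⟨?_, ?_, ?_⟩⟩, ?_, ?_⟩
      · rw [hE 12 (by omega)]; simp; omega
      · rw [hE 12 (by omega), hE 11 (by omega)]; simp [s11]; omega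
      · rw [hE 20 (by omega)]; simp [s20]
      · rw [hE 11 (by omega)]; simpa [s11] using h4
      · rw [hE 12 (by omega)]
        intro i hi1 hi2
        exact hS.ord_one g hg mid i (by simpa using hi1) hi2 (by rw [← hx, hc])
      · simp [ex, hcm, hc, s8, s13, Op.eval, ex_copy, w11, hmem2]
      · intro y hy
        rw [hE y (by omega), ← hfr y hy, if_neg (by omega)]
    · have hE : ∀ y, y < 15 ∨ (16 < y ∧ y < 25) ∨ (25 < y ∧ y < 29) →
          ((ex E (.cond 16
          (.arith .sub 16 16 8 ;; .cond 16 (.arith .add 11 13 8) (copy 12 13))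
          (.arith .mul 19 10 1 ;; .arith .add 19 19 14 ;; get 20 2 19 ;; copy 12 11)) σ₂).test
            25 11 12).reg y = if y = 11 then mid + 1 else σ₂.reg y := by
        intro y hy
        simp [ex, hcm, hc, s8, s13, Op.eval, Nat.mod_eq_of_lt w9]
        grind
      refine ⟨⟨?_, ?_, Or.inl ⟨?_, ?_, ?_⟩⟩, ?_, ?_⟩
      · rw [hE 12 (by omega)]; simp [s12]; omega
      · rw [hE 12 (by omega), hE 11 (by omega)]; simp [s12]; omega
      · rw [hE 20 (by omega)]; simp [s20]
      · rw [hE 11 (by omega)]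
        intro i hi1 hi2
        exact hS.ord_two g hg i mid (by simp at hi1; omega) (by omega) (by rw [← hx, hc])
      · rw [hE 12 (by omega)]; simpa [s12] using h5
      · simp [ex, hcm, hc, s8, s13, Op.eval, hmem2]
      · intro y hy
        rw [hE y (by omega), ← hfr y hy, if_neg (by omega)]
  · refine ⟨⟨by simp [h12], by simp [h11, h12]; exact Nat.lt_size_self _, Or.inl ⟨by simp [h20],
      by simp [h11], by simp [h12]; omega⟩⟩, rfl, ?_⟩
    intro y hy
    simp
    grind

/-- Locate the query in every half table. -/
def stageOne : Cmd :=
  .const 10 0 ;; whileLt 26 10 3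
    ((.const 11 0 ;; copy 12 1 ;; copy 20 1) ;; searchLoop ;; (put 12 10 20 ;; .arith .add 10 10 8))

lemma run_stageOne {I : Image} {E : Env} (hF : I.Fits E) (hS : I.Sorted E) {σ : State}
    (hL : Loaded I σ) :
    ∃ σ', Run E stageOne σ σ' (I.G * (I.n.size * (I.kap * 14 + 61) + 40) + 5) ∧ Loaded I σ' ∧
      ∀ g < I.G, I.IsGroup E g (arr σ' 12 g) := by
  let Inv : ℕ → State → Prop := fun v τ =>
    τ.reg 10 + v = I.G ∧ Loaded I τ ∧ ∀ g < τ.reg 10, I.IsGroup E g (arr τ 12 g)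
  have hrun0 := run_ex E (.const 10 0) σ trivial
  have hG := hF.G_le
  have hX := hF.hW
  have hn := hF.n_lt
  have key := run_whileLt (E := E) (c := 26) (x := 10) (y := 3)
    (body := (.const 11 0 ;; copy 12 1 ;; copy 20 1) ;; searchLoop ;;
      (put 12 10 20 ;; .arith .add 10 10 8))
    (by norm_num) (by norm_num) Inv (I.n.size * (I.kap * 14 + 61) + 30) ?_ I.G
    (ex E (.const 10 0) σ) ?_
  · obtain ⟨σ', hrun, ⟨v, h1, h2, h3⟩, hlt⟩ := key
    refine ⟨σ', (hrun0.seq hrun).mono (by simp [steps]; nlinarith), h2, fun g hg => h3 g ?_⟩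
    rw [h2.r3] at hlt
    omega
  · rintro v τ ⟨h1, h2, h3⟩ hlt
    rw [h2.r3] at hlt
    generalize hg : τ.reg 10 = g at *
    set A : Cmd := (.const 11 0 ;; copy 12 1 ;; copy 20 1) with hA
    have w1 : I.n < E.W := by omega
    have hAr : ∀ y, (ex E A τ).reg y = if y = 11 then 0 else if y = 12 then I.n else
        if y = 20 then I.n else if y = 30 then 0 else τ.reg y := by
      intro y
      simp [hA, ex, ex_copy, h2.r1, w1]
      grind
    have hAm : (ex E A τ).mem = τ.mem := by simp [hA, ex, ex_copy, h2.r1, w1]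
    have hLA : Loaded I (ex E A τ) := ⟨by simp [hAr, h2.r1], by simp [hAr, h2.r2],
      by simp [hAr, h2.r3], by simp [hAr, h2.r4], by simp [hAr, h2.r5], by simp [hAr, h2.r6],
      by simp [hAr, h2.r7], by simp [hAr, h2.r8],
      fun r hr i hi => by rw [← h2.mem r hr i hi]; simp only [arr, hAm]⟩
    obtain ⟨σ₂, run₂, hgr, m₂, r₂⟩ := run_searchLoop hF hS hLA hlt (by simp [hAr, hg])
      (by simp [hAr]) (by simp [hAr]) (by simp [hAr])
    have s : ∀ y, y < 11 ∨ (25 < y ∧ y < 29) → σ₂.reg y = τ.reg y := by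
      intro y hy
      rw [r₂ y hy, hAr]
      have : y ≠ 11 ∧ y ≠ 12 ∧ y ≠ 20 ∧ y ≠ 30 := by omega
      simp [this]
    have s10 : σ₂.reg 10 = g := (s 10 (by omega)).trans hg
    have s8 : σ₂.reg 8 = 1 := (s 8 (by omega)).trans h2.r8
    have w2 : 17 * g + 12 < E.W := hF.addr g (by omega) 12 (by norm_num)
    have w3 : 17 * g + 12 < E.size := hF.addr' g (by omega) 12 (by norm_num)
    have w4 : g + 1 < E.W := by omega
    have hm : ∀ r i, arr σ₂ r i = arr τ r i := fun r i => by simp only [arr, m₂, hAm]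
    set B : Cmd := (put 12 10 20 ;; .arith .add 10 10 8) with hB
    have hBr : ∀ y, y < 30 → ((ex E B σ₂).test 26 10 3).reg y =
        if y = 26 then (if g + 1 < σ₂.reg 3 then 1 else 0) else
        if y = 10 then g + 1 else σ₂.reg y := by
      intro y hy
      simp [hB, ex, ex_put, s10, s8, w2, w3, Op.eval, Nat.mod_eq_of_lt w4]
      grind
    have hBa : ∀ r i, r < 17 → arr ((ex E B σ₂).test 26 10 3) r i =
        if r = 12 ∧ i = g then σ₂.reg 20 else arr τ r i := by
      intro r i hr
      simp [hB, ex, ex_put, s10, w2, w3, Op.eval, arr_putArr, hr, hm]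
    refine ⟨_, ((run_ex E A τ (by simp [hA, straight, copy])).seq (run₂.seq
      (run_ex E B σ₂ (by simp [hB, straight, put])))).mono
        (by simp [hA, hB, steps, copy, put]; omega), v - 1, by omega, ?_, ?_, ?_⟩
    · rw [hBr 10 (by omega)]; simp; omega
    · exact ⟨by rw [hBr _ (by omega)]; simp [s, h2.r1], by rw [hBr _ (by omega)]; simp [s, h2.r2],
        by rw [hBr _ (by omega)]; simp [s, h2.r3], by rw [hBr _ (by omega)]; simp [s, h2.r4],
        by rw [hBr _ (by omega)]; simp [s, h2.r5], by rw [hBr _ (by omega)]; simp [s, h2.r6],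
        by rw [hBr _ (by omega)]; simp [s, h2.r7], by rw [hBr _ (by omega)]; simp [s, h2.r8],
        fun r hr i hi => by rw [hBa r i (by omega), if_neg (by omega), h2.mem r hr i hi]⟩
    · intro g' hg'
      rw [hBr 10 (by omega)] at hg'
      rw [hBa 12 g' (by norm_num)]
      by_cases h : g' = g
      · subst h; simpa using hgr
      · rw [if_neg (by simp [h])]
        exact h3 g' (by simp at hg'; omega)
  · refine ⟨by simp [ex], ⟨by simp [ex, hL.r1], by simp [ex, hL.r2], by simp [ex, hL.r3],
      by simp [ex, hL.r4], by simp [ex, hL.r5], by simp [ex, hL.r6], by simp [ex, hL.r7],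
      by simp [ex, hL.r8], fun r hr i hi => hL.mem r hr i hi⟩, by simp [ex]⟩

end FairANN
namespace FairANN

/-! ### The second phase of a query: finding the buckets -/

/-- The dictionary key of the bucket `(u, v)` of the table `t`. -/
def Image.keyOf (I : Image) (t u v : ℕ) : ℕ := (t * (I.n + 1) + u) * (I.n + 1) + v

/-- The dictionary slot of a key. -/
def Image.slotOf (I : Image) (k : ℕ) : ℕ := slot I.p I.N I.alpha (I.T 5) (I.T 6) (I.T 7) k

/-- The length of the bucket with a given key. -/
def Image.bucketLen (I : Image) (k : ℕ) : ℕ :=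
  if I.T 8 (I.slotOf k) = k + 1 then I.T 10 (I.slotOf k) else 0

/-- The position of the bucket with a given key. -/
def Image.bucketStart (I : Image) (k : ℕ) : ℕ := I.T 9 (I.slotOf k)

/-- The tables of the image form a dictionary that leads from the keys to lists of at most `n`
points. -/
structure Image.Dict (I : Image) (E : Env) : Prop where
  T_lt : ∀ r i, I.T r i < E.W
  ga_lt : ∀ t < I.L, I.T 3 t < I.G
  gb_lt : ∀ t < I.L, I.T 4 t < I.G
  alpha_lt : I.alpha < I.p
  beta_lt : ∀ i < I.N, I.T 5 i < I.p
  sz_pos : ∀ i < I.N, 0 < I.T 7 i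
  off_le : ∀ i < I.N, I.T 6 i + I.T 7 i ≤ I.X
  len_le : ∀ t < I.L, ∀ u ≤ I.n, ∀ v ≤ I.n, I.bucketLen (I.keyOf t u v) ≤ I.n
  start_le : ∀ t < I.L, ∀ u ≤ I.n, ∀ v ≤ I.n, 0 < I.bucketLen (I.keyOf t u v) →
    I.bucketStart (I.keyOf t u v) + I.bucketLen (I.keyOf t u v) ≤ I.X
  point_lt : ∀ t < I.L, ∀ u ≤ I.n, ∀ v ≤ I.n, ∀ i < I.bucketLen (I.keyOf t u v),
    I.T 11 (I.bucketStart (I.keyOf t u v) + i) < I.n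
  point_inj : ∀ t < I.L, ∀ u ≤ I.n, ∀ v ≤ I.n, ∀ i < I.bucketLen (I.keyOf t u v),
    ∀ j < I.bucketLen (I.keyOf t u v), I.T 11 (I.bucketStart (I.keyOf t u v) + i) =
      I.T 11 (I.bucketStart (I.keyOf t u v) + j) → i = j
  point_iff : ∀ t < I.L, ∀ u ≤ I.n, ∀ v ≤ I.n, ∀ x < I.n,
    (∃ i < I.bucketLen (I.keyOf t u v), I.T 11 (I.bucketStart (I.keyOf t u v) + i) = x) ↔
      I.T 2 (I.T 3 t * I.n + x) = u ∧ I.T 2 (I.T 4 t * I.n + x) = v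

/-- The bucket of the query in the table `t`, if `qid` are the group numbers of the query. -/
def Image.qkey (I : Image) (qid : ℕ → ℕ) (t : ℕ) : ℕ :=
  I.keyOf t (qid (I.T 3 t)) (qid (I.T 4 t))

/-- Look up the bucket of the query in the table in register `10`. -/
def lookupKey : Cmd :=
  get 12 3 10 ;; get 12 12 12 ;; get 13 4 10 ;; get 13 12 13 ;; .arith .add 23 1 8 ;;
    .arith .mul 14 10 23 ;; .arith .add 14 14 12 ;; .arith .mul 14 14 23 ;; .arith .add 14 14 13

/-- Find the dictionary slot of the key in register `14`. -/
def lookupSlot : Cmd :=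
  .arith .mul 15 7 14 ;; .arith .mod 15 15 6 ;; .arith .mod 15 15 5 ;; get 16 5 15 ;;
    .arith .mul 16 16 14 ;; .arith .mod 16 16 6 ;; get 17 7 15 ;; .arith .mod 16 16 17 ;;
    get 18 6 15 ;; .arith .add 16 18 16

/-- Store the bucket found in the dictionary slot in register `16`. -/
def lookupBucket : Cmd :=
  get 19 8 16 ;; .arith .add 14 14 8 ;; differ 20 19 14 ;;
    .cond 20 (.const 21 0) (get 21 10 16) ;; put 13 10 21 ;; .arith .add 11 11 21 ;;
    get 22 9 16 ;; put 14 10 22 ;; .arith .add 10 10 8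

/-- Find the buckets of the query in all tables, and the sum of their sizes. -/
def stageTwo : Cmd :=
  (.const 10 0 ;; .const 11 0) ;;
    whileLt 26 10 4 (lookupKey ;; lookupSlot ;; lookupBucket)

lemma Image.keyOf_le (I : Image) {t u v : ℕ} (ht : t < I.L) (hu : u ≤ I.n) (hv : v ≤ I.n) :
    I.keyOf t u v ≤ (I.L * (I.n + 1) + I.n) * (I.n + 1) + I.n := by
  unfold Image.keyOf
  gcongr

/-- Keys and multipliers are below `p` and `p * p ≤ E.W`, so no product overflows. A perfect hash
function sends absent keys to arbitrary slots, hence the comparison with the stored key. It is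
stored increased by one, which lets an empty slot contain `0` and match nothing. -/
lemma lookup_spec {I : Image} {E : Env} (hF : I.Fits E) (hD : I.Dict E) {σ : State}
    (hL : Loaded I σ) {qid : ℕ → ℕ} (hq : ∀ g < I.G, qid g ≤ I.n)
    (hqid : ∀ g < I.G, arr σ 12 g = qid g) {t m : ℕ} (ht : t < I.L) (h10 : σ.reg 10 = t)
    (h11 : σ.reg 11 = m) (hm : m ≤ I.n * t) :
    ∃ σ', ex E (lookupKey ;; lookupSlot ;; lookupBucket) σ = σ' ∧ σ'.reg 10 = t + 1 ∧
      σ'.reg 11 = m + I.bucketLen (I.qkey qid t) ∧ (∀ y < 10, σ'.reg y = σ.reg y) ∧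
      ∀ r < 17, ∀ i, arr σ' r i =
        if r = 13 ∧ i = t then I.bucketLen (I.qkey qid t) else
        if r = 14 ∧ i = t then I.bucketStart (I.qkey qid t) else arr σ r i := by
  refine ⟨_, rfl, ?_⟩
  have hsplit : ex E (lookupKey ;; lookupSlot ;; lookupBucket) σ =
      ex E lookupBucket (ex E lookupSlot (ex E lookupKey σ)) := rfl
  rw [hsplit]
  clear hsplit
  have hX := hF.hW
  have hGX := hF.G_le
  have hLX := hF.L_le
  have hga := hD.ga_lt t ht
  have hgb := hD.gb_lt t ht
  have hu := hq _ hga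
  have hv := hq _ hgb
  have hk := I.keyOf_le ht hu hv
  have hkW := hF.key
  have hkp := hF.keyp
  have hpp := hF.pp
  have hZ := hF.Z
  have hnW := hF.n_lt
  have hNX := hF.N_le
  have hlen := hD.len_le t ht _ hu _ hv
  have a3 := hL.mem 3 (by norm_num) t (by omega)
  have a4 := hL.mem 4 (by norm_num) t (by omega)
  generalize hu' : qid (I.T 3 t) = u at *
  generalize hv' : qid (I.T 4 t) = v at *
  have hkey : I.qkey qid t = I.keyOf t u v := by rw [Image.qkey, hu', hv']
  rw [hkey]
  have aq3 := hqid _ hga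
  have aq4 := hqid _ hgb
  rw [hu'] at aq3
  rw [hv'] at aq4
  have w1 : 17 * t + 3 < E.W := hF.addr t (by omega) 3 (by norm_num)
  have w2 : 17 * t + 4 < E.W := hF.addr t (by omega) 4 (by norm_num)
  have w3 : 17 * I.T 3 t + 12 < E.W := hF.addr _ (by omega) 12 (by norm_num)
  have w4 : 17 * I.T 4 t + 12 < E.W := hF.addr _ (by omega) 12 (by norm_num)
  have w5 : I.n + 1 < E.W := by omega
  have k1 : (t * (I.n + 1) + u) * (I.n + 1) + v < E.W := by
    rw [Image.keyOf] at hk; omega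
  have k2 : (t * (I.n + 1) + u) * (I.n + 1) < E.W := by omega
  have k3 : t * (I.n + 1) + u < E.W :=
    lt_of_le_of_lt (Nat.le_mul_of_pos_right _ (by omega)) k2
  have k4 : t * (I.n + 1) < E.W := by omega
  have hAr : ∀ y, y < 30 → (ex E lookupKey σ).reg y = if y = 12 then u else if y = 13 then v else
      if y = 14 then I.keyOf t u v else if y = 23 then I.n + 1 else σ.reg y := by
    intro y hy
    simp [lookupKey, ex, ex_get, h10, w1, w2, w3, w4, a3, a4, aq3, aq4, Op.eval, hL.r1, hL.r8,
      Nat.mod_eq_of_lt, w5, k1, k2, k3, k4, Image.keyOf]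
    grind
  have hAm : (ex E lookupKey σ).mem = σ.mem := by simp [lookupKey, get, ex]
  have hAa : ∀ r i, arr (ex E lookupKey σ) r i = arr σ r i := fun r i => by simp only [arr, hAm]
  have hk0 : I.keyOf t u v < I.p := lt_of_le_of_lt hk hkp
  have hk1 : I.keyOf t u v + 1 < E.W := by omega
  generalize hkk : I.keyOf t u v = k at *
  generalize ex E lookupKey σ = σ₁ at *
  have b1 : I.alpha * k < E.W :=
    lt_of_lt_of_le (Nat.mul_lt_mul'' hD.alpha_lt hk0) hpp
  obtain ⟨s, hs⟩ : ∃ s, s = I.alpha * k % I.p % I.N := ⟨_, rfl⟩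
  have hsN : s < I.N := by rw [hs]; exact Nat.mod_lt _ hF.N_pos
  have b2 : I.T 5 s * k < E.W :=
    lt_of_lt_of_le (Nat.mul_lt_mul'' (hD.beta_lt s hsN) hk0) hpp
  have b3 : 17 * s + 5 < E.W := hF.addr s (by omega) 5 (by norm_num)
  have b4 : 17 * s + 7 < E.W := hF.addr s (by omega) 7 (by norm_num)
  have b5 : 17 * s + 6 < E.W := hF.addr s (by omega) 6 (by norm_num)
  have b6 := hD.off_le s hsN
  have b7 := Nat.mod_lt (I.T 5 s * k % I.p) (hD.sz_pos s hsN)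
  have hslot : I.slotOf k = I.T 6 s + I.T 5 s * k % I.p % I.T 7 s := by
    rw [Image.slotOf, slot, hs]
  have b8 : I.slotOf k < I.X := by omega
  have b9 : I.T 6 s + I.T 5 s * k % I.p % I.T 7 s < E.W := by omega
  have a5 := hL.mem 5 (by norm_num) s (by omega)
  have a6 := hL.mem 6 (by norm_num) s (by omega)
  have a7 := hL.mem 7 (by norm_num) s (by omega)
  have hBr : ∀ y, y < 30 → (ex E lookupSlot σ₁).reg y = if y = 16 then I.slotOf k else
      if y = 15 then s else if y = 17 then I.T 7 s else if y = 18 then I.T 6 s else σ₁.reg y := by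
    intro y hy
    simp [lookupSlot, ex, ex_get, hAr, hAa, hL.r5, hL.r6, hL.r7, Op.eval, Nat.mod_eq_of_lt, b1, b2,
      b3, b4, b5, b9, ← hs, a5, a6, a7, hslot]
    grind
  have hBm : (ex E lookupSlot σ₁).mem = σ₁.mem := by simp [lookupSlot, get, ex]
  have hBa : ∀ r i, arr (ex E lookupSlot σ₁) r i = arr σ r i := fun r i => by
    rw [← hAa]; simp only [arr, hBm]
  generalize hsl : I.slotOf k = sl at *
  have a8 := hL.mem 8 (by norm_num) sl b8
  have a9 := hL.mem 9 (by norm_num) sl b8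
  have a10 := hL.mem 10 (by norm_num) sl b8
  have c1 : 17 * sl + 8 < E.W := hF.addr sl b8 8 (by norm_num)
  have c2 : 17 * sl + 9 < E.W := hF.addr sl b8 9 (by norm_num)
  have c3 : 17 * sl + 10 < E.W := hF.addr sl b8 10 (by norm_num)
  have c4 : 17 * t + 13 < E.W := hF.addr t (by omega) 13 (by norm_num)
  have c5 : 17 * t + 13 < E.size := hF.addr' t (by omega) 13 (by norm_num)
  have c6 : 17 * t + 14 < E.W := hF.addr t (by omega) 14 (by norm_num)
  have c7 : 17 * t + 14 < E.size := hF.addr' t (by omega) 14 (by norm_num)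
  have c8 : t + 1 < E.W := by omega
  have c9 := hD.T_lt 8 sl
  have hblen : I.bucketLen k = if I.T 8 sl = k + 1 then I.T 10 sl else 0 := by
    rw [Image.bucketLen, hsl]
  have hbst : I.bucketStart k = I.T 9 sl := by rw [Image.bucketStart, hsl]
  have c10 : m + I.bucketLen k < E.W := by
    have : I.n * (t + 1) ≤ I.n * I.L := Nat.mul_le_mul_left _ ht
    rw [Nat.mul_succ] at this
    omega
  have hAr8 : (ex E lookupSlot σ₁).reg 8 = 1 := by simp [hBr, hAr, hL.r8]
  have hAr10 : (ex E lookupSlot σ₁).reg 10 = t := by simp [hBr, hAr, h10]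
  have hAr11 : (ex E lookupSlot σ₁).reg 11 = m := by simp [hBr, hAr, h11]
  have hAr14 : (ex E lookupSlot σ₁).reg 14 = k := by simp [hBr, hAr]
  have hAr16 : (ex E lookupSlot σ₁).reg 16 = sl := by simp [hBr]
  have hfr : ∀ y < 10, (ex E lookupSlot σ₁).reg y = σ.reg y := by
    intro y hy
    rw [hBr y (by omega), hAr y (by omega)]
    have : y ≠ 12 ∧ y ≠ 13 ∧ y ≠ 14 ∧ y ≠ 15 ∧ y ≠ 16 ∧ y ≠ 17 ∧ y ≠ 18 ∧ y ≠ 23 := by omega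
    simp [this]
  generalize ex E lookupSlot σ₁ = σ₂ at *
  have hCr : ∀ y, y < 12 → (ex E lookupBucket σ₂).reg y =
      if y = 10 then t + 1 else if y = 11 then m + I.bucketLen k else σ₂.reg y := by
    intro y hy
    by_cases h : I.T 8 sl = k + 1
    · have c10' : m + I.T 10 sl < E.W := by rwa [hblen, if_pos h] at c10
      simp [lookupBucket, ex, ex_get, ex_put, ex_differ, Op.eval, hAr8, hAr10, hAr11, hAr14, hAr16,
        hBa, a8, a9, a10, c1, c2, c3, c4, c5, c6, c7, Nat.mod_eq_of_lt, c8, c10', hk1, h, hblen,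
        arr_putArr]
      grind
    · rw [hblen, if_neg h]
      have c11 : m < E.W := by omega
      simp [lookupBucket, ex, ex_get, ex_put, ex_differ, Op.eval, hAr8, hAr10, hAr11, hAr14, hAr16,
        hBa, a8, a9, c1, c2, c4, c5, c6, c7, c9, Nat.mod_eq_of_lt, c8, c11, hk1, h,
        arr_putArr]
      grind
  have hCa : ∀ r < 17, ∀ i, arr (ex E lookupBucket σ₂) r i =
        if r = 13 ∧ i = t then I.bucketLen k else
        if r = 14 ∧ i = t then I.bucketStart k else arr σ r i := by
    intro r hr i
    by_cases h : I.T 8 sl = k + 1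
    · have c10' : m + I.T 10 sl < E.W := by rwa [hblen, if_pos h] at c10
      simp [lookupBucket, ex, ex_get, ex_put, ex_differ, Op.eval, hAr8, hAr10, hAr11, hAr14, hAr16,
        hBa, a8, a9, a10, c1, c2, c3, c4, c5, c6, c7, Nat.mod_eq_of_lt, c8, c10', hk1, h, hblen,
        arr_putArr, hr, hbst]
      grind
    · rw [hblen, if_neg h]
      have c11 : m < E.W := by omega
      simp [lookupBucket, ex, ex_get, ex_put, ex_differ, Op.eval, hAr8, hAr10, hAr11, hAr14, hAr16,
        hBa, a8, a9, c1, c2, c4, c5, c6, c7, c9, Nat.mod_eq_of_lt, c8, c11, hk1, h,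
        arr_putArr, hr, hbst]
      grind
  refine ⟨by rw [hCr 10 (by norm_num)]; simp, by rw [hCr 11 (by norm_num)]; simp, ?_, hCa⟩
  intro y hy
  rw [hCr y (by omega), if_neg (by omega), if_neg (by omega), hfr y hy]

lemma Loaded.congr {I : Image} {σ σ' : State} (h : Loaded I σ)
    (hr : ∀ y, 1 ≤ y → y < 9 → σ'.reg y = σ.reg y)
    (hm : ∀ r < 12, ∀ i, arr σ' r i = arr σ r i) : Loaded I σ' :=
  ⟨(hr 1 (by norm_num) (by norm_num)).trans h.r1, (hr 2 (by norm_num) (by norm_num)).trans h.r2,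
    (hr 3 (by norm_num) (by norm_num)).trans h.r3, (hr 4 (by norm_num) (by norm_num)).trans h.r4,
    (hr 5 (by norm_num) (by norm_num)).trans h.r5, (hr 6 (by norm_num) (by norm_num)).trans h.r6,
    (hr 7 (by norm_num) (by norm_num)).trans h.r7, (hr 8 (by norm_num) (by norm_num)).trans h.r8,
    fun r hr' i hi => (hm r hr' i).trans (h.mem r hr' i hi)⟩

lemma straight_lookup : straight (lookupKey ;; lookupSlot ;; lookupBucket) := by
  simp [lookupKey, lookupSlot, lookupBucket, straight, get, put, differ]

lemma run_stageTwo {I : Image} {E : Env} (hF : I.Fits E) (hD : I.Dict E) {σ : State}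
    (hL : Loaded I σ) {qid : ℕ → ℕ} (hq : ∀ g < I.G, qid g ≤ I.n)
    (hqid : ∀ g < I.G, arr σ 12 g = qid g) :
    ∃ σ', Run E stageTwo σ σ' (I.L * 200 + 10) ∧ Loaded I σ' ∧
      (∀ g < I.G, arr σ' 12 g = qid g) ∧
      (∀ t < I.L, arr σ' 13 t = I.bucketLen (I.qkey qid t)) ∧
      (∀ t < I.L, arr σ' 14 t = I.bucketStart (I.qkey qid t)) ∧
      σ'.reg 11 = ∑ t ∈ Finset.range I.L, I.bucketLen (I.qkey qid t) := by
  let Inv : ℕ → State → Prop := fun v τ => ∃ t, t + v = I.L ∧ τ.reg 10 = t ∧ Loaded I τ ∧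
      (∀ g < I.G, arr τ 12 g = qid g) ∧
      (∀ s < t, arr τ 13 s = I.bucketLen (I.qkey qid s)) ∧
      (∀ s < t, arr τ 14 s = I.bucketStart (I.qkey qid s)) ∧
      τ.reg 11 = ∑ s ∈ Finset.range t, I.bucketLen (I.qkey qid s)
  have hrun0 := run_ex E (.const 10 0 ;; .const 11 0) σ (by simp [straight])
  have key := run_whileLt (E := E) (c := 26) (x := 10) (y := 4)
    (body := lookupKey ;; lookupSlot ;; lookupBucket)
    (by norm_num) (by norm_num) Inv 197 ?_ I.L (ex E (.const 10 0 ;; .const 11 0) σ) ?_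
  · obtain ⟨σ', hrun, ⟨v, t, h1, h2, h3, h4, h5, h6, h7⟩, hlt⟩ := key
    rw [h2, h3.r4] at hlt
    obtain rfl : t = I.L := by omega
    exact ⟨σ', (hrun0.seq hrun).mono (by simp [steps]; omega), h3, h4, h5, h6, h7⟩
  · rintro v τ ⟨t, h1, h2, h3, h4, h5, h6, h7⟩ hlt
    rw [h2, h3.r4] at hlt
    have hm : ∑ s ∈ Finset.range t, I.bucketLen (I.qkey qid s) ≤ I.n * t := by
      refine (Finset.sum_le_card_nsmul _ _ I.n fun s hs => ?_).trans (by simp [mul_comm])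
      have hs' : s < I.L := by rw [Finset.mem_range] at hs; omega
      exact hD.len_le s hs' _ (hq _ (hD.ga_lt s hs')) _ (hq _ (hD.gb_lt s hs'))
    obtain ⟨σ', he, h10, h11, hr, ha⟩ := lookup_spec hF hD h3 hq h4 hlt h2 h7 hm
    refine ⟨σ', he ▸ (run_ex E _ τ straight_lookup).mono (by decide), v - 1, by omega, t + 1,
      by omega, by simp [h10], ?_, ?_, ?_, ?_, ?_⟩
    · refine h3.congr (fun y _ hy => ?_) fun r hr' i => ?_
      · simp [hr y (by omega)]; omega
      · rw [arr_test, ha r (by omega), if_neg (by omega), if_neg (by omega)]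
    · intro g hg
      rw [arr_test, ha 12 (by norm_num), if_neg (by omega), if_neg (by omega), h4 g hg]
    · intro s hs
      rw [arr_test, ha 13 (by norm_num)]
      by_cases hst : s = t
      · simp [hst]
      · simp [hst]; exact h5 s (by omega)
    · intro s hs
      rw [arr_test, ha 14 (by norm_num)]
      by_cases hst : s = t
      · simp [hst]
      · simp [hst]; exact h6 s (by omega)
    · rw [Finset.sum_range_succ]; simp [h11]
  · refine ⟨0, by simp, by simp [ex], ?_, ?_, by simp, by simp, by simp [ex]⟩
    · refine hL.congr (fun y h1 h2 => ?_) fun r hr i => rfl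
      simp [ex]
      grind
    · exact fun g hg => hqid g hg

/-! ### The third phase of a query: cutting the buckets into chunks -/

/-- What the machine knows when sampling starts: the group numbers `qid` of the query, the lengths
and positions of its buckets, and the `e` chunks of length `w` into which they are cut. -/
structure Ready (I : Image) (σ : State) (qid et ec : ℕ → ℕ) (w e : ℕ) : Prop where
  loaded : Loaded I σ
  r9 : σ.reg 9 = w
  r17 : σ.reg 17 = e * w
  q : ∀ g < I.G, arr σ 12 g = qid g
  len : ∀ t < I.L, arr σ 13 t = I.bucketLen (I.qkey qid t)
  start : ∀ t < I.L, arr σ 14 t = I.bucketStart (I.qkey qid t)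
  et : ∀ i < e, arr σ 15 i = et i
  ec : ∀ i < e, arr σ 16 i = ec i

/-- Append a chunk of the bucket of the table in register `10`, or pass to the next table. -/
def chunkStep : Cmd :=
  get 14 13 10 ;; .arith .lt 15 13 14 ;;
    .cond 15 (put 15 12 10 ;; put 16 12 13 ;; .arith .add 12 12 8 ;; .arith .add 13 13 9)
      (.arith .add 10 10 8 ;; .const 13 0)

/-- Cut all buckets into chunks. -/
def stageThree : Cmd :=
  (.arith .div 9 11 4 ;; .arith .add 9 9 8 ;; .const 10 0 ;; .const 12 0 ;; .const 13 0) ;;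
    whileLt 26 10 4 chunkStep ;; .arith .mul 17 12 9

/-- The sum of `F` over the positions in the first `e` chunks. -/
def chunkSum (len et ec : ℕ → ℕ) (w e : ℕ) (F : ℕ → ℕ → ℝ) : ℝ :=
  ∑ i ∈ Finset.range e, ∑ o ∈ Finset.range w,
    if ec i + o < len (et i) then F (et i) (ec i + o) else 0

lemma chunkSum_congr {len et ec et' ec' : ℕ → ℕ} {w e : ℕ} (F : ℕ → ℕ → ℝ)
    (h : ∀ i < e, et i = et' i) (h' : ∀ i < e, ec i = ec' i) :
    chunkSum len et ec w e F = chunkSum len et' ec' w e F := by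
  refine Finset.sum_congr rfl fun i hi => ?_
  rw [h i (Finset.mem_range.1 hi), h' i (Finset.mem_range.1 hi)]

/-- A random position must be translated into a table and an index in constant time, which
concatenated buckets of varying length do not allow. Chunks of equal length `w = m / L + 1` do:
position `y` lies in chunk `y / w` at offset `y % w`. At most one chunk per bucket is incomplete, so
only `L * w ≤ m + L` positions are wasted. The last clause, with an arbitrary `F`, says that the
chunks meet each bucket position exactly once. -/
lemma run_stageThree {I : Image} {E : Env} (hF : I.Fits E) {σ : State}
    (hL : Loaded I σ) {qid : ℕ → ℕ} {m : ℕ} (hqid : ∀ g < I.G, arr σ 12 g = qid g)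
    (hlen : ∀ t < I.L, arr σ 13 t = I.bucketLen (I.qkey qid t))
    (hstart : ∀ t < I.L, arr σ 14 t = I.bucketStart (I.qkey qid t))
    (hle : ∀ t < I.L, I.bucketLen (I.qkey qid t) ≤ I.n)
    (h11 : σ.reg 11 = m) (hm : m = ∑ t ∈ Finset.range I.L, I.bucketLen (I.qkey qid t)) :
    ∃ σ' et ec w e, Run E stageThree σ σ' (I.L * 150 + 20) ∧ Ready I σ' qid et ec w e ∧
      0 < w ∧ w ≤ I.n + 1 ∧ e * w ≤ 2 * m + I.L ∧ e < I.X ∧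
      (∀ i < e, et i < I.L ∧ ec i ≤ I.n) ∧
      ∀ F : ℕ → ℕ → ℝ, chunkSum (fun t => I.bucketLen (I.qkey qid t)) et ec w e F =
        ∑ t ∈ Finset.range I.L, ∑ j ∈ Finset.range (I.bucketLen (I.qkey qid t)), F t j := by
  set len : ℕ → ℕ := fun t => I.bucketLen (I.qkey qid t) with hlendef
  replace hm : m = ∑ t ∈ Finset.range I.L, len t := hm
  obtain ⟨w, hw⟩ : ∃ w, w = m / I.L + 1 := ⟨_, rfl⟩
  have hw0 : 0 < w := by rw [hw]; exact Nat.succ_pos _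
  have hmn : m ≤ I.n * I.L := by
    rw [hm]
    refine (Finset.sum_le_card_nsmul _ _ I.n fun s hs => ?_).trans (by simp [mul_comm])
    exact hle s (Finset.mem_range.1 hs)
  have hwn : w ≤ I.n + 1 := by
    rw [hw]
    exact Nat.add_le_add_right (Nat.div_le_of_le_mul (by rwa [mul_comm])) 1
  have hmw : m ≤ I.L * w := by
    rw [hw]
    exact (Nat.lt_mul_div_succ m hF.L_pos).le
  have hwm : I.L * w ≤ m + I.L := by
    rw [hw, Nat.mul_succ]
    exact Nat.add_le_add_right (Nat.mul_div_le _ _) _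
  have hLX := hF.L_le
  have hX := hF.hW
  have hnW := hF.n_lt
  have hZ := hF.Z
  have w1 : w < E.W := by omega
  set A : Cmd := (.arith .div 9 11 4 ;; .arith .add 9 9 8 ;; .const 10 0 ;; .const 12 0 ;;
    .const 13 0) with hA
  have hAr : ∀ y, (ex E A σ).reg y = if y = 9 then w else if y = 10 then 0 else
      if y = 12 then 0 else if y = 13 then 0 else σ.reg y := by
    intro y
    simp [hA, ex, Op.eval, h11, hL.r4, hL.r8, Nat.mod_eq_of_lt w1, ← hw]
    grind
  -- Here `e` chunks have been cut, `t` is the current table and `c` the offset in its bucket where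
  -- the next chunk starts. Each iteration raises `e` or `t`, which makes the variant drop.
  let Inv : ℕ → State → Prop := fun v τ => ∃ t e c, v = (2 * I.L - e) + (I.L - t) ∧ t ≤ I.L ∧
    τ.reg 9 = w ∧ τ.reg 10 = t ∧ τ.reg 12 = e ∧ τ.reg 13 = c ∧ Loaded I τ ∧
    (∀ g < I.G, arr τ 12 g = qid g) ∧ (∀ t < I.L, arr τ 13 t = len t) ∧
    (∀ t < I.L, arr τ 14 t = I.bucketStart (I.qkey qid t)) ∧
    (∀ i < e, arr τ 15 i < I.L ∧ arr τ 16 i ≤ I.n) ∧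
    e * w ≤ (∑ s ∈ Finset.range t, len s) + t * w + c ∧ e ≤ 2 * I.L ∧
    (t < I.L → c < len t + w) ∧ (t = I.L → c = 0) ∧
    ∀ F : ℕ → ℕ → ℝ, chunkSum len (arr τ 15) (arr τ 16) w e F =
        ∑ s ∈ Finset.range t, ∑ j ∈ Finset.range (len s), F s j +
        ∑ j ∈ Finset.range c, if j < len t then F t j else 0
  have key := run_whileLt (E := E) (c := 26) (x := 10) (y := 4) (body := chunkStep)
    (by norm_num) (by norm_num) Inv 40 ?_ (3 * I.L) (ex E A σ) ?_
  · obtain ⟨σ₁, hrun, ⟨v, t, e, c, hv, ht, h9, h10, h12, h13, hL', hq', hl', hs', hb, he, he2, -,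
      hc, hF'⟩, hlt⟩ := key
    rw [h10, hL'.r4] at hlt
    obtain rfl : t = I.L := by omega
    obtain rfl : c = 0 := hc rfl
    have hee : e * w ≤ 2 * m + I.L := by rw [← hm] at he; omega
    have w2 : e * w < E.W := by
      have : 2 * m ≤ 3 * (I.n * I.L) := by omega
      omega
    refine ⟨_, arr σ₁ 15, arr σ₁ 16, w, e, ((run_ex E A σ (by simp [hA, straight])).seq
      (hrun.seq (run_ex E (.arith .mul 17 12 9) σ₁ trivial))).mono
        (by simp [hA, steps]; omega), ⟨?_, ?_, ?_, hq', hl', hs', fun _ _ => rfl,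
          fun _ _ => rfl⟩, hw0, hwn, hee, by omega, hb, fun F => ?_⟩
    · refine hL'.congr (fun y h1 h2 => ?_) fun r hr i => rfl
      simp [ex]
      grind
    · simp [ex, h9]
    · simp [ex, h9, h12, Op.eval, Nat.mod_eq_of_lt w2]
    · rw [hF' F]; simp [hlendef]
  · rintro v τ ⟨t, e, c, hv, ht, h9, h10, h12, h13, hL', hq', hl', hs', hb, he, he2, hc1, hc0,
      hF'⟩ hlt
    rw [h10, hL'.r4] at hlt
    have hc1 := hc1 hlt
    have hlt' := hle t hlt
    have x1 : 17 * t + 13 < E.W := hF.addr t (by omega) 13 (by norm_num)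
    have x2 : t + 1 < E.W := by omega
    have x3 : t < E.W := by omega
    refine ⟨_, (run_ex E chunkStep τ (by simp [chunkStep, straight, get, put])).mono
      (by decide), ?_⟩
    by_cases hct : c < len t
    -- A chunk is cut only while positions remain, so `e * w < m + L * w ≤ 2 * L * w`. This keeps
    -- the list of chunks within its array.
    · have hel : e < 2 * I.L := by
        have h1 : (∑ s ∈ Finset.range t, len s) + c < m := by
          rw [hm]
          calc _ < (∑ s ∈ Finset.range t, len s) + len t := by omega
            _ = ∑ s ∈ Finset.range (t + 1), len s := (Finset.sum_range_succ _ _).symm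
            _ ≤ _ := Finset.sum_le_sum_of_subset (Finset.range_subset_range.2 hlt)
        have h2 : t * w ≤ I.L * w := Nat.mul_le_mul_right _ ht
        by_contra hge
        have : 2 * I.L * w ≤ e * w := Nat.mul_le_mul_right _ (by omega)
        have h3 : 2 * I.L * w = I.L * w + I.L * w := by ring
        omega
      have x4 : 17 * e + 15 < E.W := hF.addr e (by omega) 15 (by norm_num)
      have x5 : 17 * e + 15 < E.size := hF.addr' e (by omega) 15 (by norm_num)
      have x6 : 17 * e + 16 < E.W := hF.addr e (by omega) 16 (by norm_num)
      have x7 : 17 * e + 16 < E.size := hF.addr' e (by omega) 16 (by norm_num)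
      have x8 : e + 1 < E.W := by omega
      have hlen' : len t ≤ I.n := hlt'
      have x9 : c + w < E.W := by omega
      have hr : ∀ y, y < 14 → (ex E chunkStep τ).reg y = if y = 12 then e + 1 else
          if y = 13 then c + w else τ.reg y := by
        intro y hy
        simp [chunkStep, ex, ex_get, ex_put, Op.eval, h9, h10, h12, h13, hl' t hlt, hct, x1, x4, x5,
          x6, x7, Nat.mod_eq_of_lt, x8, x9, hL'.r8]
        grind
      have ha : ∀ r < 17, ∀ i, arr (ex E chunkStep τ) r i = if r = 15 ∧ i = e then t else
          if r = 16 ∧ i = e then c else arr τ r i := by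
        intro r hr i
        simp [chunkStep, ex, ex_get, ex_put, Op.eval, h9, h10, h12, h13, hl' t hlt, hct, x1, x4, x5,
          x6, x7, hL'.r8, arr_putArr, hr]
        grind
      refine ⟨(2 * I.L - (e + 1)) + (I.L - t), by omega, t, e + 1, c + w, rfl, ht, ?_, ?_, ?_, ?_,
        ?_, ?_, ?_, ?_, ?_, ?_, by omega, by omega, by omega, ?_⟩
      · simp [hr, h9]
      · simp [hr, h10]
      · simp [hr]
      · simp [hr]
      · refine hL'.congr (fun y h1 h2 => ?_) fun r hr i => ?_
        · simp [hr y (by omega)]; grind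
        · rw [arr_test, ha r (by omega), if_neg (by omega), if_neg (by omega)]
      · intro g hg; simp [ha, hq' g hg]
      · intro s hs; simp [ha, hl' s hs]
      · intro s hs; simp [ha, hs' s hs]
      · intro i hi
        simp only [arr_test, ha 15 (by norm_num), ha 16 (by norm_num)]
        by_cases hie : i = e
        · simp [hie]; omega
        · simpa [hie] using hb i (by omega)
      · rw [Nat.succ_mul]; omega
      · intro F
        rw [chunkSum, Finset.sum_range_succ, Finset.sum_range_add, ← add_assoc, ← hF' F]
        congr 1
        · exact chunkSum_congr F (fun i hi => by simp [ha, hi.ne]) fun i hi => by simp [ha, hi.ne]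
        · simp [ha]
    · have hr : ∀ y, y < 14 → (ex E chunkStep τ).reg y = if y = 10 then t + 1 else
          if y = 13 then 0 else τ.reg y := by
        intro y hy
        simp [chunkStep, ex, ex_get, Op.eval, h10, h13, hl' t hlt, hct, x1,
          Nat.mod_eq_of_lt, x2, hL'.r8]
        grind
      have ha : ∀ r i, arr (ex E chunkStep τ) r i = arr τ r i := by
        intro r i
        simp [chunkStep, ex, ex_get, Op.eval, h10, h13, hl' t hlt, hct, x1]
      refine ⟨(2 * I.L - e) + (I.L - (t + 1)), by omega, t + 1, e, 0, rfl, by omega, ?_, ?_, ?_, ?_,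
        ?_, ?_, ?_, ?_, ?_, ?_, by omega, by omega, by omega, ?_⟩
      · simp [hr, h9]
      · simp [hr]
      · simp [hr, h12]
      · simp [hr]
      · refine hL'.congr (fun y h1 h2 => ?_) fun r hr i => ?_
        · simp [hr y (by omega)]; grind
        · rw [arr_test, ha]
      · intro g hg; simp [ha, hq' g hg]
      · intro s hs; simp [ha, hl' s hs]
      · intro s hs; simp [ha, hs' s hs]
      · intro i hi; simpa [ha] using hb i hi
      · rw [Finset.sum_range_succ, Nat.succ_mul]; omega
      · intro F
        rw [Finset.sum_range_succ, Finset.range_zero, Finset.sum_empty, add_zero]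
        have h1 : ∑ j ∈ Finset.range c, (if j < len t then F t j else 0) =
            ∑ j ∈ Finset.range (len t), F t j := by
          rw [← Finset.sum_filter]
          congr 1
          ext j
          simp only [Finset.mem_filter, Finset.mem_range]
          omega
        rw [← h1, ← hF' F]
        exact chunkSum_congr F (fun i hi => by simp [ha]) fun i hi => by simp [ha]
  · refine ⟨0, 0, 0, by omega, by omega, by simp [hAr], by simp [hAr], by simp [hAr], by simp [hAr],
      ?_, hqid, hlen, hstart, by simp, by simp, by omega, by omega, by simp, by simp [chunkSum]⟩
    refine hL.congr (fun y h1 h2 => ?_) fun r hr i => rfl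
    simp [hAr]
    grind

/-! ### Loading the parameters -/

/-- Load the parameters into the registers `1` to `7`. -/
def loadParams : Cmd :=
  .const 10 0 ;; get 1 0 10 ;; .const 10 1 ;; get 2 0 10 ;; .const 10 2 ;; get 3 0 10 ;;
    .const 10 3 ;; get 4 0 10 ;; .const 10 4 ;; get 5 0 10 ;; .const 10 5 ;; get 6 0 10 ;;
    .const 10 6 ;; get 7 0 10 ;; .const 8 1

/-- The parameters of the image are stored in its array `0`. -/
structure Image.Header (I : Image) : Prop where
  n : I.T 0 0 = I.n
  kap : I.T 0 1 = I.kap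
  G : I.T 0 2 = I.G
  L : I.T 0 3 = I.L
  N : I.T 0 4 = I.N
  p : I.T 0 5 = I.p
  alpha : I.T 0 6 = I.alpha

lemma run_loadParams {I : Image} {E : Env} (hF : I.Fits E) (hH : I.Header) {σ : State}
    (hm : ∀ r < 12, ∀ i < I.X, arr σ r i = I.T r i) :
    ∃ σ', Run E loadParams σ σ' 100 ∧ Loaded I σ' := by
  refine ⟨_, (run_ex E loadParams σ (by simp [loadParams, straight, get])).mono (by decide), ?_⟩
  have hX := hF.X_gt
  have hW := hF.hW
  have hw : ∀ k ≤ 7, k % E.W = k := fun k hk => Nat.mod_eq_of_lt (by omega)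
  have h0 : 0 < E.W := by omega
  have h1 : 17 < E.W := by omega
  have h2 : 34 < E.W := by omega
  have h3 : 51 < E.W := by omega
  have h4 : 68 < E.W := by omega
  have h5 : 85 < E.W := by omega
  have h6 : 102 < E.W := by omega
  have hm' : ∀ k < 7, arr σ 0 k = I.T 0 k := fun k hk => hm 0 (by norm_num) k (by omega)
  have hr : ∀ y, y < 9 → (ex E loadParams σ).reg y = if y = 1 then I.n else if y = 2 then I.kap else
      if y = 3 then I.G else if y = 4 then I.L else if y = 5 then I.N else if y = 6 then I.p else
      if y = 7 then I.alpha else if y = 8 then 1 else σ.reg y := by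
    intro y hy
    simp [loadParams, ex, ex_get, hw, hm', h0, h1, h2, h3, h4, h5, h6, hH.n, hH.kap, hH.G, hH.L,
      hH.N, hH.p, hH.alpha]
    interval_cases y <;> simp
  refine ⟨by simp [hr], by simp [hr], by simp [hr], by simp [hr], by simp [hr], by simp [hr],
    by simp [hr], by simp [hr], fun r hr i hi => ?_⟩
  rw [← hm r hr i hi]
  simp [loadParams, ex, ex_get, hw, h0, h1, h2, h3, h4, h5, h6]

end FairANN
namespace FairANN

/-! ### The last phase of a query: sampling -/

/-- The number of random values that the next step of the sampling loop needs. -/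
def prepare : Cmd := .cond 19 (copy 22 4) (copy 22 17)

/-- Decide whether the point in register `20` lies in the bucket of the query in the table in
register `23`; if it does, then accept it if this is the table in register `21`, and otherwise
reject it. -/
def resolve : Cmd :=
  (get 12 3 23 ;; .arith .mul 13 12 1 ;; .arith .add 13 13 20 ;; get 13 2 13 ;; get 12 12 12 ;;
    differ 14 12 13) ;;
  (get 12 4 23 ;; .arith .mul 13 12 1 ;; .arith .add 13 13 20 ;; get 13 2 13 ;; get 12 12 12 ;;
    differ 15 12 13) ;;
  .cond 14 (.const 29 0) (.cond 15 (.const 29 0)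
    (differ 16 23 21 ;; .cond 16 (.const 19 0) (.arith .add 0 20 8 ;; copy 18 17)))

/-- Test whether the position in register `y` holds a near point. -/
def probe (y : ℕ) : Cmd :=
  .arith .div 10 y 9 ;; .arith .mod 12 y 9 ;; get 11 15 10 ;; get 13 16 10 ;;
    .arith .add 13 13 12 ;; get 14 13 11 ;; .arith .lt 16 13 14 ;;
    .cond 16 (get 14 14 11 ;; .arith .add 13 14 13 ;; get 15 11 13 ;; .near 16 15) (.const 29 0)

/-- Probe the random position in register `23` and the next position in register `18`. -/
def probeBoth : Cmd :=
  (probe 23 ;; .cond 16 (.const 19 1 ;; copy 20 15 ;; copy 21 11) (.const 29 0)) ;;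
    (probe 18 ;; .cond 16 (.const 29 0) (.arith .add 18 18 8))

/-- One round of sampling after the random choice. -/
def react : Cmd := .cond 19 resolve probeBoth

/-- Sample until a point is accepted or all positions have been seen. -/
def sampleLoop : Cmd := whileLt 26 18 17 (prepare ;; .rand 23 22 ;; react)

/-- The sampling loop after the test of its condition. -/
def sampleHead : Cmd :=
  .loop 26 (.seq (prepare ;; .rand 23 22 ;; react) (.arith .lt 26 18 17))

/-- The state after a round of sampling with the random value `z`. -/
def afterRound (E : Env) (τ : State) (z : ℕ) : State :=
  (ex E react ((ex E prepare τ).setReg 23 z)).test 26 18 17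

lemma straight_prepare : straight prepare := by simp [prepare, straight, copy]

lemma straight_react : straight react := by
  simp [react, resolve, probeBoth, probe, straight, copy, get, differ]

/-- A round consists of at most `20` deterministic steps, one random draw, and at most `279`
deterministic steps that depend on the value drawn. -/
lemma val_round (E : Env) (θ : ℝ≥0∞) (r : State → ℝ≥0∞) (N : ℕ) (τ : State) {k : ℕ}
    (h26 : τ.reg 26 ≠ 0) (hk : (ex E prepare τ).reg 22 = k) (hk0 : 0 < k) :
    val E θ r (N + 1) ([sampleHead], τ) ≤
      θ * 300 + (∑ z ∈ Finset.range k, val E θ r N ([sampleHead], afterRound E τ z)) / k := by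
  have h1 : Red E ([sampleHead], τ) ([.rand 23 22, react, .arith .lt 26 18 17, sampleHead],
      ex E prepare τ) 20 := by
    refine (Red.step (t := 19) (κ₁ := (.seq (prepare ;; .rand 23 22 ;; react)
      (.arith .lt 26 18 17) :: [sampleHead], τ)) ?_ ?_)
    · simp [sampleHead, step, h26]
    · refine .step (t := 18) rfl (.step (t := 17) rfl ?_)
      have := run_ex E prepare τ straight_prepare [.rand 23 22 ;; react, .arith .lt 26 18 17,
        sampleHead]
      exact (this.trans (.step (t := 0) rfl (.refl _ _))).mono (by decide)
  refine (val_red h1 θ r (N + 1)).trans ?_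
  rw [val_rand E θ r N 23 22 k _ _ hk hk0]
  have h2 : ∀ z, val E θ r N ([react, .arith .lt 26 18 17, sampleHead],
      (ex E prepare τ).setReg 23 z) ≤
        θ * 279 + val E θ r N ([sampleHead], afterRound E τ z) := by
    intro z
    have := (run_ex E react ((ex E prepare τ).setReg 23 z) straight_react
      [.arith .lt 26 18 17, sampleHead]).trans (red_test E 26 18 17 _ _)
    exact_mod_cast val_red (this.mono (t' := 279) (by decide)) θ r N
  have hk1 : (k : ℝ≥0∞) ≠ 0 := by exact_mod_cast hk0.ne'
  have hk2 : (k : ℝ≥0∞) ≠ ∞ := ENNReal.natCast_ne_top k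
  calc _ ≤ θ * 20 + (θ + (∑ z ∈ Finset.range k,
        (θ * 279 + val E θ r N ([sampleHead], afterRound E τ z))) / k) := by
        gcongr
        · simp
        · exact h2 _
    _ = _ := by
        rw [Finset.sum_add_distrib, Finset.sum_const, Finset.card_range, nsmul_eq_mul,
          ENNReal.add_div, mul_comm (k : ℝ≥0∞), ENNReal.mul_div_cancel_right hk1 hk2]
        ring

lemma val_exit (E : Env) (θ : ℝ≥0∞) (r : State → ℝ≥0∞) (N : ℕ) (τ : State) (h26 : τ.reg 26 = 0) :
    val E θ r N ([sampleHead], τ) ≤ θ + r τ := by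
  have h1 : Red E ([sampleHead], τ) ([], τ) 1 := by
    refine Red.step (κ₁ := ([], τ)) ?_ (.refl _ _)
    simp [sampleHead, step, h26]
  refine (val_red h1 θ r N).trans ?_
  cases N <;> simp [val]

/-! ### The effect of a round -/

/-- The point `x` and the query share a bucket in the table `t`. -/
def Image.Coll (I : Image) (qid : ℕ → ℕ) (t x : ℕ) : Prop :=
  I.T 2 (I.T 3 t * I.n + x) = qid (I.T 3 t) ∧ I.T 2 (I.T 4 t * I.n + x) = qid (I.T 4 t)

/-- The `j`-th point in the bucket of the query in the table `t`. -/
def Image.point (I : Image) (qid : ℕ → ℕ) (t j : ℕ) : ℕ :=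
  I.T 11 (I.bucketStart (I.qkey qid t) + j)

lemma Ready.congr {I : Image} {σ σ' : State} {qid et ec : ℕ → ℕ} {w e : ℕ}
    (h : Ready I σ qid et ec w e)
    (hr : ∀ y, 1 ≤ y → y < 10 ∨ y = 17 → σ'.reg y = σ.reg y) (hm : σ'.mem = σ.mem) :
    Ready I σ' qid et ec w e := by
  have ha : ∀ r i, arr σ' r i = arr σ r i := fun r i => by simp only [arr, hm]
  exact ⟨h.loaded.congr (fun y h1 h2 => hr y h1 (by omega)) fun r _ i => ha r i,
    (hr 9 (by norm_num) (by norm_num)).trans h.r9, (hr 17 (by norm_num) (by norm_num)).trans h.r17,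
    fun g hg => (ha _ _).trans (h.q g hg), fun g hg => (ha _ _).trans (h.len g hg),
    fun g hg => (ha _ _).trans (h.start g hg), fun g hg => (ha _ _).trans (h.et g hg),
    fun g hg => (ha _ _).trans (h.ec g hg)⟩

open Classical in
-- The point `x` is pending after a hit in the table `t`, and `z` is a fresh random table. The first
-- `z` that contains `x` in the bucket of the query is uniform among the `deg x` tables with this
-- property, so it equals `t` with probability `1 / deg x`; the number `deg x` is never computed.
-- Acceptance moves the scan pointer to the end, which stops the loop.
lemma resolve_spec {I : Image} {E : Env} (hF : I.Fits E) (hD : I.Dict E) {τ : State}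
    {qid et ec : ℕ → ℕ} {w e : ℕ} (hR : Ready I τ qid et ec w e) (hq : ∀ g < I.G, qid g ≤ I.n)
    (hZ : e * w < E.W) {x t z : ℕ} (hx : x < I.n) (ht : t < I.L) (hz : z < I.L)
    (h20 : τ.reg 20 = x) (h21 : τ.reg 21 = t) (h23 : τ.reg 23 = z) :
    (ex E resolve τ).mem = τ.mem ∧ ∀ y, y < 12 ∨ (16 < y ∧ y < 29) → (ex E resolve τ).reg y =
      if I.Coll qid z x then
        (if z = t then (if y = 0 then x + 1 else if y = 18 then e * w else τ.reg y)
          else if y = 19 then 0 else τ.reg y)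
      else τ.reg y := by
  have hX := hF.hW
  have hGX := hF.G_le
  have hLX := hF.L_le
  have hnW := hF.n_lt
  have hGn := hF.Gn
  have hga := hD.ga_lt z hz
  have hgb := hD.gb_lt z hz
  have hgn : ∀ g < I.G, g * I.n + x < I.X := by
    intro g hg
    have : (g + 1) * I.n ≤ I.G * I.n := Nat.mul_le_mul_right _ hg
    rw [Nat.succ_mul] at this
    omega
  have g1 := hgn _ hga
  have g2 := hgn _ hgb
  have a3 := hR.loaded.mem 3 (by norm_num) z (by omega)
  have a4 := hR.loaded.mem 4 (by norm_num) z (by omega)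
  have a23 := hR.loaded.mem 2 (by norm_num) _ g1
  have a24 := hR.loaded.mem 2 (by norm_num) _ g2
  have q3 := hR.q _ hga
  have q4 := hR.q _ hgb
  have hq3 := hq _ hga
  have hq4 := hq _ hgb
  have b1 : 17 * z + 3 < E.W := hF.addr z (by omega) 3 (by norm_num)
  have b2 : 17 * z + 4 < E.W := hF.addr z (by omega) 4 (by norm_num)
  have b3 : 17 * (I.T 3 z * I.n + x) + 2 < E.W := hF.addr _ g1 2 (by norm_num)
  have b4 : 17 * (I.T 4 z * I.n + x) + 2 < E.W := hF.addr _ g2 2 (by norm_num)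
  have b5 : 17 * I.T 3 z + 12 < E.W := hF.addr _ (by omega) 12 (by norm_num)
  have b6 : 17 * I.T 4 z + 12 < E.W := hF.addr _ (by omega) 12 (by norm_num)
  have b7 : I.T 3 z * I.n < E.W := by omega
  have b8 : I.T 4 z * I.n < E.W := by omega
  have b9 : I.T 3 z * I.n + x < E.W := by omega
  have b10 : I.T 4 z * I.n + x < E.W := by omega
  have b11 := hD.T_lt 2 (I.T 3 z * I.n + x)
  have b12 := hD.T_lt 2 (I.T 4 z * I.n + x)
  have b13 : qid (I.T 3 z) < E.W := by omega
  have b14 : qid (I.T 4 z) < E.W := by omega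
  have b15 : x + 1 < E.W := by omega
  have b16 : z < E.W := by omega
  have b17 : t < E.W := by omega
  set A : Cmd := get 12 3 23 ;; .arith .mul 13 12 1 ;; .arith .add 13 13 20 ;; get 13 2 13 ;;
    get 12 12 12 ;; differ 14 12 13 with hA
  set B : Cmd := get 12 4 23 ;; .arith .mul 13 12 1 ;; .arith .add 13 13 20 ;; get 13 2 13 ;;
    get 12 12 12 ;; differ 15 12 13 with hB
  have hAr : ∀ y, y < 12 ∨ (13 < y ∧ y < 30) → (ex E A τ).reg y = if y = 14 then
      diffVal (qid (I.T 3 z)) (I.T 2 (I.T 3 z * I.n + x)) else τ.reg y := by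
    intro y hy
    simp [hA, ex, ex_get, ex_differ, Op.eval, h20, h23, a3, a23, q3, b1, b3, b5, Nat.mod_eq_of_lt,
      b7, b9, b11, b13, hR.loaded.r1]
    grind
  have hAm : (ex E A τ).mem = τ.mem := by simp [hA, ex, get, differ]
  have hAa : ∀ r i, arr (ex E A τ) r i = arr τ r i := fun r i => by simp only [arr, hAm]
  have hBr : ∀ y, y < 12 ∨ (13 < y ∧ y < 30) → (ex E B (ex E A τ)).reg y = if y = 15 then
      diffVal (qid (I.T 4 z)) (I.T 2 (I.T 4 z * I.n + x)) else if y = 14 then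
      diffVal (qid (I.T 3 z)) (I.T 2 (I.T 3 z * I.n + x)) else τ.reg y := by
    intro y hy
    simp [hB, ex, ex_get, ex_differ, Op.eval, hAr, hAa, h20, h23, a4, a24, q4, b2, b4, b6,
      Nat.mod_eq_of_lt, b8, b10, b12, b14, hR.loaded.r1]
    grind
  have hBm : (ex E B (ex E A τ)).mem = τ.mem := by
    rw [← hAm]; simp [hB, ex, get, differ]
  have hsplit : ex E resolve τ = ex E (.cond 14 (.const 29 0) (.cond 15 (.const 29 0)
    (differ 16 23 21 ;; .cond 16 (.const 19 0) (.arith .add 0 20 8 ;; copy 18 17))))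
      (ex E B (ex E A τ)) := rfl
  rw [hsplit]
  clear hsplit
  generalize ex E B (ex E A τ) = σ₂ at *
  have hC : I.Coll qid z x ↔ (qid (I.T 3 z) = I.T 2 (I.T 3 z * I.n + x) ∧
      qid (I.T 4 z) = I.T 2 (I.T 4 z * I.n + x)) := by
    rw [Image.Coll, eq_comm, eq_comm (a := I.T 2 (I.T 4 z * I.n + x))]
  constructor
  · simp only [ex]
    split_ifs <;> simp [copy, differ, ex, hBm]
  · intro y hy
    by_cases h1 : qid (I.T 3 z) = I.T 2 (I.T 3 z * I.n + x)
    · by_cases h2 : qid (I.T 4 z) = I.T 2 (I.T 4 z * I.n + x)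
      · rw [if_pos (hC.2 ⟨h1, h2⟩)]
        by_cases h3 : z = t
        · subst h3
          simp [ex, ex_differ, ex_copy, hBr, h1, h2, h23, h21, h20, b17, Op.eval,
            hR.loaded.r8, hR.r17, hZ, Nat.mod_eq_of_lt b15]
          grind
        · simp [ex, ex_differ, hBr, h1, h2, h23, h21, h3, b16, b17]
          grind
      · rw [if_neg (by rw [hC]; tauto)]
        simp [ex, hBr, h1, h2]
        grind
    · rw [if_neg (by rw [hC]; tauto)]
      simp [ex, hBr, h1]
      grind

/-- The position `y` holds a near point. -/
def Image.Hit (I : Image) (E : Env) (qid et ec : ℕ → ℕ) (w y : ℕ) : Prop :=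
  ec (y / w) + y % w < I.bucketLen (I.qkey qid (et (y / w))) ∧
    E.near (I.point qid (et (y / w)) (ec (y / w) + y % w)) ≠ 0

open Classical in
lemma probe_spec {I : Image} {E : Env} (hF : I.Fits E) (hD : I.Dict E) {τ : State}
    {qid et ec : ℕ → ℕ} {w e : ℕ} (hR : Ready I τ qid et ec w e) (hq : ∀ g < I.G, qid g ≤ I.n)
    (hw : 0 < w) (hwn : w ≤ I.n + 1) (he : e < I.X)
    (hb : ∀ i < e, et i < I.L ∧ ec i ≤ I.n) {y z : ℕ} (hy : y < 30) (hy' : 17 < y)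
    (hz : z < e * w) (hyz : τ.reg y = z) :
    (ex E (probe y) τ).mem = τ.mem ∧
      (∀ v, v < 10 ∨ (16 < v ∧ v < 29) → (ex E (probe y) τ).reg v = τ.reg v) ∧
      ((ex E (probe y) τ).reg 16 ≠ 0 ↔ I.Hit E qid et ec w z) ∧
      (I.Hit E qid et ec w z → (ex E (probe y) τ).reg 11 = et (z / w) ∧
        (ex E (probe y) τ).reg 15 = I.point qid (et (z / w)) (ec (z / w) + z % w)) := by
  have hX := hF.hW
  have hLX := hF.L_le
  have hnW := hF.n_lt
  obtain ⟨i, hi⟩ : ∃ i, i = z / w := ⟨_, rfl⟩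
  obtain ⟨o, ho⟩ : ∃ o, o = z % w := ⟨_, rfl⟩
  have hie : i < e := by rw [hi]; exact Nat.div_lt_of_lt_mul (by rwa [mul_comm])
  have how : o < w := by rw [ho]; exact Nat.mod_lt _ hw
  obtain ⟨ht, hc⟩ := hb i hie
  simp only [Image.Hit, ← hi, ← ho]
  have hlen := hD.len_le _ ht _ (hq _ (hD.ga_lt _ ht)) _ (hq _ (hD.gb_lt _ ht))
  have hst := hD.start_le _ ht _ (hq _ (hD.ga_lt _ ht)) _ (hq _ (hD.gb_lt _ ht))
  change I.bucketLen (I.qkey qid (et i)) ≤ I.n at hlen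
  change 0 < I.bucketLen (I.qkey qid (et i)) → I.bucketStart (I.qkey qid (et i)) +
    I.bucketLen (I.qkey qid (et i)) ≤ I.X at hst
  have a1 := hR.et i hie
  have a2 := hR.ec i hie
  have a3 := hR.len _ ht
  have a4 := hR.start _ ht
  have b1 : 17 * i + 15 < E.W := hF.addr i (by omega) 15 (by norm_num)
  have b2 : 17 * i + 16 < E.W := hF.addr i (by omega) 16 (by norm_num)
  have b3 : 17 * et i + 13 < E.W := hF.addr _ (by omega) 13 (by norm_num)
  have b4 : 17 * et i + 14 < E.W := hF.addr _ (by omega) 14 (by norm_num)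
  have b5 : ec i + o < E.W := by omega
  have y9 : y ≠ 10 := by omega
  by_cases h : ec i + o < I.bucketLen (I.qkey qid (et i))
  · have hs : I.bucketStart (I.qkey qid (et i)) + (ec i + o) < I.X := by omega
    have b6 : I.bucketStart (I.qkey qid (et i)) + (ec i + o) < E.W := by omega
    have b7 : 17 * (I.bucketStart (I.qkey qid (et i)) + (ec i + o)) + 11 < E.W :=
      hF.addr _ hs 11 (by norm_num)
    have a5 := hR.loaded.mem 11 (by norm_num) _ hs
    have hpt : I.point qid (et i) (ec i + o) =
      I.T 11 (I.bucketStart (I.qkey qid (et i)) + (ec i + o)) := rfl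
    have hr : ∀ v, v < 10 ∨ v = 11 ∨ (14 < v ∧ v < 29) → (ex E (probe y) τ).reg v =
        if v = 11 then et i else if v = 15 then I.point qid (et i) (ec i + o) else
        if v = 16 then E.near (I.point qid (et i) (ec i + o)) else τ.reg v := by
      intro v hv
      simp [probe, ex, ex_get, Op.eval, hyz, hR.r9, ← hi, ← ho, a1, a2, a3, a4, a5, b1, b2, b3, b4,
        Nat.mod_eq_of_lt, b5, b6, b7, h, hpt, y9]
      grind
    refine ⟨?_, fun v hv => ?_, ?_, fun _ => ⟨?_, ?_⟩⟩
    · simp [probe, ex, ex_get, Op.eval, hyz, hR.r9, ← hi, ← ho, a1, a2, a3, a4, b1, b2, b3, b4,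
        Nat.mod_eq_of_lt, b5, b6, b7, h, y9]
    · rw [hr v (by omega), if_neg (by omega), if_neg (by omega), if_neg (by omega)]
    · rw [hr 16 (by omega)]; simp [h]
    · rw [hr 11 (by omega)]; simp
    · rw [hr 15 (by omega)]; simp
  · refine ⟨?_, fun v hv => ?_, ?_, fun h' => absurd h'.1 h⟩
    · simp [probe, ex, ex_get, Op.eval, hyz, hR.r9, ← hi, ← ho, a1, a2, a3, b1, b2, b3,
        Nat.mod_eq_of_lt, b5, h, y9]
    · simp [probe, ex, ex_get, Op.eval, hyz, hR.r9, ← hi, ← ho, a1, a2, a3, b1, b2, b3,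
        Nat.mod_eq_of_lt, b5, h, y9]
      grind
    · simp [probe, ex, ex_get, Op.eval, hyz, hR.r9, ← hi, ← ho, a1, a2, a3, b1, b2, b3,
        Nat.mod_eq_of_lt, b5, h, y9]

open Classical in
-- The pointer in register `18` passes only positions without a near point. It reaches the end by
-- scanning exactly when there is no hit at all, and it stays at the first hit otherwise.
lemma probeBoth_spec {I : Image} {E : Env} (hF : I.Fits E) (hD : I.Dict E) {τ : State}
    {qid et ec : ℕ → ℕ} {w e : ℕ} (hR : Ready I τ qid et ec w e) (hq : ∀ g < I.G, qid g ≤ I.n)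
    (hw : 0 < w) (hwn : w ≤ I.n + 1) (he : e < I.X)
    (hb : ∀ i < e, et i < I.L ∧ ec i ≤ I.n) (hZ : e * w < E.W) {s z : ℕ} (hz : z < e * w)
    (hs : s < e * w) (h18 : τ.reg 18 = s) (h23 : τ.reg 23 = z) (h19 : τ.reg 19 = 0) :
    (ex E probeBoth τ).mem = τ.mem ∧
      (∀ v, v < 10 ∨ v = 17 → (ex E probeBoth τ).reg v = τ.reg v) ∧
      (ex E probeBoth τ).reg 18 = (if I.Hit E qid et ec w s then s else s + 1) ∧
      (I.Hit E qid et ec w z → (ex E probeBoth τ).reg 19 = 1 ∧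
        (ex E probeBoth τ).reg 21 = et (z / w) ∧
        (ex E probeBoth τ).reg 20 = I.point qid (et (z / w)) (ec (z / w) + z % w)) ∧
      (¬ I.Hit E qid et ec w z → (ex E probeBoth τ).reg 19 = 0) := by
  have hX := hF.hW
  have hLX := hF.L_le
  have hnW := hF.n_lt
  obtain ⟨m1, r1, f1, p1⟩ := probe_spec hF hD hR hq hw hwn he hb (y := 23) (by norm_num)
    (by norm_num) hz h23
  set A : Cmd := probe 23 ;; .cond 16 (.const 19 1 ;; copy 20 15 ;; copy 21 11) (.const 29 0) with hA
  have hW1 : 1 % E.W = 1 := Nat.mod_eq_of_lt (by omega)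
  have hAm : (ex E A τ).mem = τ.mem := by
    rw [← m1]; simp only [hA, ex]; split_ifs <;> simp [copy, ex]
  have hAr : ∀ v, v < 10 ∨ v = 17 ∨ v = 18 ∨ v = 23 → (ex E A τ).reg v = τ.reg v := by
    intro v hv
    rw [← r1 v (by omega)]
    simp only [hA, ex]
    split_ifs <;> simp [copy, ex] <;> grind
  have hA1 : I.Hit E qid et ec w z → (ex E A τ).reg 19 = 1 ∧
        (ex E A τ).reg 21 = et (z / w) ∧
        (ex E A τ).reg 20 = I.point qid (et (z / w)) (ec (z / w) + z % w) := by
    intro h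
    have h16 := f1.2 h
    obtain ⟨p11, p15⟩ := p1 h
    have hie : z / w < e := Nat.div_lt_of_lt_mul (by rwa [mul_comm])
    have ht := (hb _ hie).1
    have c1 : et (z / w) < E.W := by omega
    have c2 : I.point qid (et (z / w)) (ec (z / w) + z % w) < E.W := hD.T_lt _ _
    simp only [hA, ex, if_pos h16]
    simp [ex_copy, p11, p15, c1, c2, hW1]
  have hA2 : ¬ I.Hit E qid et ec w z → (ex E A τ).reg 19 = 0 := by
    intro h
    have h16 := fun h' => h (f1.1 h')
    simp only [hA, ex, if_neg h16]
    simp [r1 19 (by norm_num), h19]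
  have hRA : Ready I (ex E A τ) qid et ec w e :=
    hR.congr (fun y h1 h2 => hAr y (by omega)) hAm
  obtain ⟨m2, r2, f2, -⟩ := probe_spec hF hD hRA hq hw hwn he hb (y := 18) (by norm_num)
    (by norm_num) hs ((hAr 18 (by norm_num)).trans h18)
  have hsplit : ex E probeBoth τ = ex E (.cond 16 (.const 29 0) (.arith .add 18 18 8))
    (ex E (probe 18) (ex E A τ)) := rfl
  rw [hsplit]
  have hCr : ∀ v, v < 29 → v ≠ 18 → (ex E (.cond 16 (.const 29 0) (.arith .add 18 18 8))
    (ex E (probe 18) (ex E A τ))).reg v = (ex E (probe 18) (ex E A τ)).reg v := by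
    intro v h1 h2
    simp only [ex]
    split_ifs <;> simp <;> omega
  refine ⟨?_, fun v hv => ?_, ?_, fun h => ?_, fun h => ?_⟩
  · rw [← hAm, ← m2]; simp only [ex]; split_ifs <;> simp
  · rw [hCr v (by omega) (by omega), r2 v (by omega), hAr v (by omega)]
  · have h8 : (ex E (probe 18) (ex E A τ)).reg 8 = 1 := by
      rw [r2 8 (by norm_num), hAr 8 (by norm_num), hR.loaded.r8]
    have h18' : (ex E (probe 18) (ex E A τ)).reg 18 = s := by
      rw [r2 18 (by norm_num), hAr 18 (by norm_num), h18]
    have c3 : s + 1 < E.W := by omega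
    by_cases h : I.Hit E qid et ec w s
    · have h16 := f2.2 h
      simp only [ex, if_pos h16]
      simp [h, h18']
    · have h16 := fun h' => h (f2.1 h')
      simp only [ex, if_neg h16]
      simp [h, h18', h8, Op.eval, Nat.mod_eq_of_lt c3]
  · rw [hCr 19 (by norm_num) (by norm_num), hCr 20 (by norm_num) (by norm_num),
      hCr 21 (by norm_num) (by norm_num), r2 19 (by norm_num), r2 20 (by norm_num),
      r2 21 (by norm_num)]
    exact hA1 h
  · rw [hCr 19 (by norm_num) (by norm_num), r2 19 (by norm_num)]
    exact hA2 h

end FairANN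
namespace FairANN

/-! ### Analysis of the sampling loop -/

/-- Everything that is known about the memory when sampling starts. -/
structure Sampling (I : Image) (E : Env) (qid et ec : ℕ → ℕ) (w e : ℕ) : Prop where
  fits : I.Fits E
  dict : I.Dict E
  q_le : ∀ g < I.G, qid g ≤ I.n
  w_pos : 0 < w
  w_le : w ≤ I.n + 1
  e_lt : e < I.X
  chunk : ∀ i < e, et i < I.L ∧ ec i ≤ I.n
  Z_lt : e * w < E.W
  sum_eq : ∀ F : ℕ → ℕ → ℝ, chunkSum (fun t => I.bucketLen (I.qkey qid t)) et ec w e F =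
    ∑ t ∈ Finset.range I.L, ∑ j ∈ Finset.range (I.bucketLen (I.qkey qid t)), F t j

open Classical in
/-- The number of tables in which `x` shares a bucket with the query. -/
noncomputable def Image.deg (I : Image) (qid : ℕ → ℕ) (x : ℕ) : ℕ :=
  ((Finset.range I.L).filter fun t => I.Coll qid t x).card

open Classical in
/-- The near points that share a bucket with the query in some table. -/
noncomputable def Image.nearSet (I : Image) (E : Env) (qid : ℕ → ℕ) : Finset ℕ :=
  (Finset.range I.n).filter fun x => E.near x ≠ 0 ∧ ∃ t < I.L, I.Coll qid t x

lemma Image.deg_pos {I : Image} {E : Env} {qid : ℕ → ℕ} {x : ℕ} (hx : x ∈ I.nearSet E qid) :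
    0 < I.deg qid x := by
  classical
  obtain ⟨_, _, t, ht, hc⟩ := Finset.mem_filter.1 hx
  exact Finset.card_pos.2 ⟨t, Finset.mem_filter.2 ⟨Finset.mem_range.2 ht, hc⟩⟩

open Classical in
lemma bucket_sum {I : Image} {E : Env} (hD : I.Dict E) {qid : ℕ → ℕ}
    (hq : ∀ g < I.G, qid g ≤ I.n) {t : ℕ} (ht : t < I.L) (f : ℕ → ℝ) :
    ∑ j ∈ Finset.range (I.bucketLen (I.qkey qid t)), f (I.point qid t j) =
      ∑ x ∈ Finset.range I.n, if I.Coll qid t x then f x else 0 := by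
  have h3 := hq _ (hD.ga_lt t ht)
  have h4 := hq _ (hD.gb_lt t ht)
  rw [← Finset.sum_filter]
  refine Finset.sum_bij (fun j _ => I.point qid t j) ?_ ?_ ?_ (fun _ _ => rfl)
  · intro j hj
    have hj' := Finset.mem_range.1 hj
    have hlt := hD.point_lt t ht _ h3 _ h4 j hj'
    exact Finset.mem_filter.2 ⟨Finset.mem_range.2 hlt,
      (hD.point_iff t ht _ h3 _ h4 _ hlt).1 ⟨j, hj', rfl⟩⟩
  · intro j hj i hi h
    exact hD.point_inj t ht _ h3 _ h4 j (Finset.mem_range.1 hj) i (Finset.mem_range.1 hi) h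
  · intro x hx
    obtain ⟨hx1, hx2⟩ := Finset.mem_filter.1 hx
    obtain ⟨j, hj, h⟩ := (hD.point_iff t ht _ h3 _ h4 x (Finset.mem_range.1 hx1)).2 hx2
    exact ⟨j, Finset.mem_range.2 hj, h⟩

lemma sum_bucketLen {I : Image} {E : Env} (hD : I.Dict E) {qid : ℕ → ℕ}
    (hq : ∀ g < I.G, qid g ≤ I.n) :
    ∑ t ∈ Finset.range I.L, I.bucketLen (I.qkey qid t) =
      ∑ x ∈ Finset.range I.n, I.deg qid x := by
  classical
  have : ((∑ t ∈ Finset.range I.L, I.bucketLen (I.qkey qid t) : ℕ) : ℝ) =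
      ((∑ x ∈ Finset.range I.n, I.deg qid x : ℕ) : ℝ) := by
    push_cast
    calc _ = ∑ t ∈ Finset.range I.L, ∑ x ∈ Finset.range I.n,
          if I.Coll qid t x then (1 : ℝ) else 0 := by
          refine Finset.sum_congr rfl fun t ht => ?_
          rw [← bucket_sum hD hq (Finset.mem_range.1 ht) (fun _ => 1)]
          simp
      _ = _ := by
          rw [Finset.sum_comm]
          refine Finset.sum_congr rfl fun x _ => ?_
          rw [Image.deg, Finset.card_filter]
          push_cast
          rfl
  exact_mod_cast this

lemma sum_range_mul' (f : ℕ → ℕ → ℝ) {w : ℕ} (hw : 0 < w) (e : ℕ) :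
    ∑ y ∈ Finset.range (e * w), f (y / w) (y % w) =
      ∑ i ∈ Finset.range e, ∑ o ∈ Finset.range w, f i o := by
  induction e with
  | zero => simp
  | succ e ih =>
    rw [Nat.succ_mul, Finset.sum_range_add, ih, Finset.sum_range_succ]
    congr 1
    refine Finset.sum_congr rfl fun o ho => ?_
    have ho' := Finset.mem_range.1 ho
    rw [mul_comm e w, Nat.mul_add_div hw, Nat.div_eq_of_lt ho', Nat.mul_add_mod,
      Nat.mod_eq_of_lt ho', add_zero]

section
variable {I : Image} {E : Env} {qid et ec : ℕ → ℕ} {w e : ℕ}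

/-- The point at position `y`. -/
def Image.slotPoint (I : Image) (qid et ec : ℕ → ℕ) (w y : ℕ) : ℕ :=
  I.point qid (et (y / w)) (ec (y / w) + y % w)

lemma Sampling.slotPoint_mem (hS : Sampling I E qid et ec w e) {y : ℕ} (hy : y < e * w)
    (h : I.Hit E qid et ec w y) :
    I.slotPoint qid et ec w y ∈ I.nearSet E qid ∧ et (y / w) < I.L ∧
      I.Coll qid (et (y / w)) (I.slotPoint qid et ec w y) := by
  classical
  have hie : y / w < e := Nat.div_lt_of_lt_mul (by rwa [mul_comm])
  obtain ⟨ht, hc⟩ := hS.chunk _ hie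
  have h3 := hS.q_le _ (hS.dict.ga_lt _ ht)
  have h4 := hS.q_le _ (hS.dict.gb_lt _ ht)
  have hlt := hS.dict.point_lt _ ht _ h3 _ h4 _ h.1
  have hcoll := (hS.dict.point_iff _ ht _ h3 _ h4 _ hlt).1 ⟨_, h.1, rfl⟩
  exact ⟨Finset.mem_filter.2 ⟨Finset.mem_range.2 hlt, h.2, _, ht, hcoll⟩, ht, hcoll⟩

open Classical in
-- A near point occupies one position in each table that it shares with the query, so a sum over
-- hits counts it `deg` times. These weights are what the rejection step has to cancel.
lemma Sampling.hit_sum (hS : Sampling I E qid et ec w e) (φ : ℕ → ℝ) :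
    ∑ y ∈ Finset.range (e * w),
      (if I.Hit E qid et ec w y then φ (I.slotPoint qid et ec w y) else 0) =
      ∑ x ∈ I.nearSet E qid, I.deg qid x * φ x := by
  have h1 : ∑ y ∈ Finset.range (e * w),
      (if I.Hit E qid et ec w y then φ (I.slotPoint qid et ec w y) else 0) =
      chunkSum (fun t => I.bucketLen (I.qkey qid t)) et ec w e
        (fun t j => if E.near (I.point qid t j) ≠ 0 then φ (I.point qid t j) else 0) := by
    rw [chunkSum, ← sum_range_mul' _ hS.w_pos]
    refine Finset.sum_congr rfl fun y _ => ?_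
    simp only [Image.Hit, Image.slotPoint]
    by_cases h1 : ec (y / w) + y % w < I.bucketLen (I.qkey qid (et (y / w))) <;>
      by_cases h2 : E.near (I.point qid (et (y / w)) (ec (y / w) + y % w)) = 0 <;> simp [h1, h2]
  rw [h1, hS.sum_eq]
  calc _ = ∑ t ∈ Finset.range I.L, ∑ x ∈ Finset.range I.n,
        if I.Coll qid t x then (if E.near x ≠ 0 then φ x else 0) else 0 := by
        refine Finset.sum_congr rfl fun t ht => ?_
        exact bucket_sum hS.dict hS.q_le (Finset.mem_range.1 ht)
          (fun x => if E.near x ≠ 0 then φ x else 0)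
    _ = ∑ x ∈ Finset.range I.n, I.deg qid x * (if E.near x ≠ 0 then φ x else 0) := by
        rw [Finset.sum_comm]
        refine Finset.sum_congr rfl fun x _ => ?_
        rw [Image.deg, Finset.card_filter, ← Finset.sum_filter]
        simp
    _ = _ := by
        rw [Image.nearSet, Finset.sum_filter]
        refine Finset.sum_congr rfl fun x _ => ?_
        by_cases h1 : E.near x ≠ 0
        · by_cases h2 : ∃ t < I.L, I.Coll qid t x
          · rw [if_pos h1, if_pos ⟨h1, h2⟩]
          · have : I.deg qid x = 0 := by
              rw [Image.deg, Finset.card_eq_zero, Finset.filter_eq_empty_iff]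
              intro t ht hc
              exact h2 ⟨t, Finset.mem_range.1 ht, hc⟩
            simp [this]
        · rw [if_neg h1, if_neg (fun h => h1 h.1), mul_zero]

lemma prepare_spec (hS : Sampling I E qid et ec w e) {τ : State} (hR : Ready I τ qid et ec w e) :
    (ex E prepare τ).mem = τ.mem ∧ ∀ y < 30, (ex E prepare τ).reg y =
      if y = 22 then (if τ.reg 19 ≠ 0 then I.L else e * w) else τ.reg y := by
  have hX := hS.fits.hW
  have hL := hS.fits.L_le
  have hLW : I.L < E.W := by omega
  by_cases h : τ.reg 19 ≠ 0
  · simp only [prepare, ex, if_pos h]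
    refine ⟨by simp [ex_copy, hR.loaded.r4, hLW], fun y hy => ?_⟩
    simp [ex_copy, hR.loaded.r4, hLW]
    grind
  · simp only [prepare, ex, if_neg h]
    refine ⟨by simp [ex_copy, hR.r17, hS.Z_lt], fun y hy => ?_⟩
    simp [ex_copy, hR.r17, hS.Z_lt]
    grind

open Classical in
lemma round_probe (hS : Sampling I E qid et ec w e) {τ : State} (hR : Ready I τ qid et ec w e)
    {s z : ℕ} (h19 : τ.reg 19 = 0) (h18 : τ.reg 18 = s) (hs : s < e * w) (hz : z < e * w) :
    Ready I (afterRound E τ z) qid et ec w e ∧ (afterRound E τ z).reg 0 = τ.reg 0 ∧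
      (afterRound E τ z).reg 18 = (if I.Hit E qid et ec w s then s else s + 1) ∧
      (afterRound E τ z).reg 26 = (if (afterRound E τ z).reg 18 < e * w then 1 else 0) ∧
      (I.Hit E qid et ec w z → (afterRound E τ z).reg 19 = 1 ∧
        (afterRound E τ z).reg 21 = et (z / w) ∧
        (afterRound E τ z).reg 20 = I.slotPoint qid et ec w z) ∧
      (¬ I.Hit E qid et ec w z → (afterRound E τ z).reg 19 = 0) := by
  obtain ⟨m1, r1⟩ := prepare_spec hS hR
  have hR' : Ready I ((ex E prepare τ).setReg 23 z) qid et ec w e := by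
    refine hR.congr (fun y h1 h2 => ?_) (by simpa using m1)
    have : y ≠ 22 ∧ y ≠ 23 := by omega
    simp [this, r1 y (by omega)]
  have h19' : ((ex E prepare τ).setReg 23 z).reg 19 = 0 := by simp [r1, h19]
  obtain ⟨m2, a1, a2, a3, a4⟩ := probeBoth_spec hS.fits hS.dict hR' hS.q_le hS.w_pos hS.w_le
    hS.e_lt hS.chunk hS.Z_lt hz hs (by simp [r1, h18]) (by simp) h19'
  have heq : afterRound E τ z =
      (ex E probeBoth ((ex E prepare τ).setReg 23 z)).test 26 18 17 := by
    rw [afterRound, react, ex, if_neg (fun h => h h19')]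
  rw [heq]
  generalize hσ : ex E probeBoth ((ex E prepare τ).setReg 23 z) = σ' at *
  have hR'' : Ready I σ' qid et ec w e := hR'.congr (fun y h1 h2 => a1 y h2) m2
  refine ⟨hR''.congr (fun y h1 h2 => ?_) (by simp), ?_, ?_, ?_, fun h => ?_, fun h => ?_⟩
  · have : y ≠ 26 := by omega
    simp [this]
  · simp [a1, r1]
  · simp [a2]
  · simp [hR''.r17]
  · simpa [Image.slotPoint] using a3 h
  · simpa using a4 h

open Classical in
lemma round_resolve (hS : Sampling I E qid et ec w e) {τ : State} (hR : Ready I τ qid et ec w e)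
    {s z x t : ℕ} (h19 : τ.reg 19 ≠ 0) (h18 : τ.reg 18 = s) (hs : s < e * w) (hx : x < I.n)
    (ht : t < I.L) (hz : z < I.L) (h20 : τ.reg 20 = x) (h21 : τ.reg 21 = t) :
    Ready I (afterRound E τ z) qid et ec w e ∧
      (I.Coll qid z x → z = t →
        (afterRound E τ z).reg 0 = x + 1 ∧ (afterRound E τ z).reg 26 = 0) ∧
      (I.Coll qid z x → z ≠ t → (afterRound E τ z).reg 19 = 0 ∧ (afterRound E τ z).reg 18 = s ∧
        (afterRound E τ z).reg 26 = 1) ∧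
      (¬ I.Coll qid z x → (afterRound E τ z).reg 19 ≠ 0 ∧ (afterRound E τ z).reg 18 = s ∧
        (afterRound E τ z).reg 26 = 1 ∧ (afterRound E τ z).reg 20 = x ∧
        (afterRound E τ z).reg 21 = t) := by
  obtain ⟨m1, r1⟩ := prepare_spec hS hR
  have hR' : Ready I ((ex E prepare τ).setReg 23 z) qid et ec w e := by
    refine hR.congr (fun y h1 h2 => ?_) (by simpa using m1)
    have : y ≠ 22 ∧ y ≠ 23 := by omega
    simp [this, r1 y (by omega)]
  have h19' : ((ex E prepare τ).setReg 23 z).reg 19 ≠ 0 := by simpa [r1] using h19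
  obtain ⟨m2, a⟩ := resolve_spec hS.fits hS.dict hR' hS.q_le hS.Z_lt hx ht hz
    (by simp [r1, h20]) (by simp [r1, h21]) (by simp)
  have heq : afterRound E τ z =
      (ex E resolve ((ex E prepare τ).setReg 23 z)).test 26 18 17 := by
    rw [afterRound, react, ex, if_pos h19']
  rw [heq]
  generalize hσ : ex E resolve ((ex E prepare τ).setReg 23 z) = σ' at *
  have hR'' : Ready I σ' qid et ec w e := by
    refine hR'.congr (fun y h1 h2 => ?_) m2
    rw [a y (by omega)]
    have : y ≠ 0 ∧ y ≠ 18 ∧ y ≠ 19 := by omega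
    simp [this]
  refine ⟨hR''.congr (fun y h1 h2 => ?_) (by simp), fun h1 h2 => ?_, fun h1 h2 => ?_, fun h1 => ?_⟩
  · have : y ≠ 26 := by omega
    simp [this]
  · subst h2
    simp [hR''.r17, a, h1]
  · simp [hR''.r17, a, h1, h2, r1, h18, hs]
  · simp [hR''.r17, a, h1, r1, h18, hs, h19, h20, h21]

/-! ### Potentials for the sampling loop -/

lemma avg_le {θ Φ : ℝ} (hθ : 0 ≤ θ) {k : ℕ} (hk : 0 < k) (v : ℕ → ℝ≥0∞) (φ : ℕ → ℝ)
    (hφ : ∀ z < k, 0 ≤ φ z) (hv : ∀ z < k, v z ≤ ENNReal.ofReal (φ z))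
    (h : θ * 300 + (∑ z ∈ Finset.range k, φ z) / k ≤ Φ) :
    ENNReal.ofReal θ * 300 + (∑ z ∈ Finset.range k, v z) / k ≤ ENNReal.ofReal Φ := by
  have hk' : (0 : ℝ) < k := by exact_mod_cast hk
  have h0 : 0 ≤ ∑ z ∈ Finset.range k, φ z :=
    Finset.sum_nonneg fun z hz => hφ z (Finset.mem_range.1 hz)
  calc _ ≤ ENNReal.ofReal θ * 300 + (∑ z ∈ Finset.range k, ENNReal.ofReal (φ z)) / k := by
        gcongr with z hz
        exact hv z (Finset.mem_range.1 hz)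
    _ = ENNReal.ofReal (θ * 300 + (∑ z ∈ Finset.range k, φ z) / k) := by
        rw [← ENNReal.ofReal_sum_of_nonneg fun z hz => hφ z (Finset.mem_range.1 hz),
          ENNReal.ofReal_add (by positivity) (by positivity), ENNReal.ofReal_mul hθ,
          ENNReal.ofReal_div_of_pos hk', ENNReal.ofReal_natCast]
        norm_num
    _ ≤ _ := ENNReal.ofReal_le_ofReal h

open Classical in
-- The loop is a Markov chain with one state for "nothing pending" and one for each pending point.
-- `Φ0` and `Φ1 x` are the exact solutions of its linear equations at a cost of `300 * θ` per round,
-- so both one-step inequalities hold with equality and induction on the fuel gives the bound. In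
-- `Φ0` the rewards `ρ (x + 1)` enter with equal weights `1 / k`: this is the uniformity of the
-- answer.
lemma Sampling.val_le_of_nonempty (hS : Sampling I E qid et ec w e) {θ : ℝ} (hθ : 0 ≤ θ)
    {ρ : ℕ → ℝ} (hρ : ∀ v, 0 ≤ ρ v) {r : State → ℝ≥0∞}
    (hr : ∀ σ, r σ ≤ ENNReal.ofReal (ρ (σ.reg 0))) (hne : (I.nearSet E qid).Nonempty)
    {τ : State} (hR : Ready I τ qid et ec w e) (h18 : τ.reg 18 = 0) (h19 : τ.reg 19 = 0)
    (h26 : τ.reg 26 = if τ.reg 18 < e * w then 1 else 0) (N : ℕ) :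
    val E (ENNReal.ofReal θ) r N ([sampleHead], τ) ≤ ENNReal.ofReal
      ((e * w * (300 * θ) + (I.nearSet E qid).card * I.L * (300 * θ) +
        ∑ x ∈ I.nearSet E qid, (θ + ρ (x + 1))) / (I.nearSet E qid).card) := by
  set NS := I.nearSet E qid with hNS
  set k := NS.card with hk
  have hk0 : (0 : ℝ) < k := by exact_mod_cast Finset.card_pos.2 hne
  have hL0 : (0 : ℝ) < I.L := by exact_mod_cast hS.fits.L_pos
  set Φ0 : ℝ := (e * w * (300 * θ) + k * I.L * (300 * θ) + ∑ x ∈ NS, (θ + ρ (x + 1))) / k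
    with hΦ0
  have hsum0 : 0 ≤ ∑ x ∈ NS, (θ + ρ (x + 1)) :=
    Finset.sum_nonneg fun x _ => add_nonneg hθ (hρ _)
  have hΦ0n : 0 ≤ Φ0 := by positivity
  have hΦ0k : k * Φ0 = e * w * (300 * θ) + k * I.L * (300 * θ) + ∑ x ∈ NS, (θ + ρ (x + 1)) := by
    rw [hΦ0]; field_simp
  -- With `x` pending, `L / deg x` further rounds are expected; then one outcome out of `deg x`
  -- accepts and the others return to `Φ0`.
  let Φ1 : ℕ → ℝ := fun x => (I.L * (300 * θ) + (θ + ρ (x + 1)) + ((I.deg qid x : ℝ) - 1) * Φ0) /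
    I.deg qid x
  have hdeg : ∀ x ∈ NS, (1 : ℝ) ≤ I.deg qid x := fun x hx => by
    exact_mod_cast Image.deg_pos hx
  have hΦ1n : ∀ x ∈ NS, 0 ≤ Φ1 x := fun x hx => by
    have h1 := hdeg x hx
    have h2 := hρ (x + 1)
    have h3 : 0 ≤ ((I.deg qid x : ℝ) - 1) * Φ0 := mul_nonneg (by linarith) hΦ0n
    exact div_nonneg (by positivity) (by linarith)
  have hΦ1k : ∀ x ∈ NS, I.deg qid x * Φ1 x =
      I.L * (300 * θ) + (θ + ρ (x + 1)) + ((I.deg qid x : ℝ) - 1) * Φ0 := fun x hx => by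
    have h1 := hdeg x hx
    simp only [Φ1]
    field_simp
  -- A hit at or after the pointer means that the scan cannot end the loop, so acceptance is the
  -- only way out.
  let Live : State → Prop := fun τ => Ready I τ qid et ec w e ∧ τ.reg 26 = 1 ∧
    ∃ y, τ.reg 18 ≤ y ∧ y < e * w ∧ I.Hit E qid et ec w y
  have hex : ∃ y < e * w, I.Hit E qid et ec w y := by
    by_contra hno
    push Not at hno
    have h1 := hS.hit_sum fun _ => 1
    rw [Finset.sum_eq_zero fun y hy => if_neg (hno y (Finset.mem_range.1 hy))] at h1
    have h2 : (0 : ℝ) < ∑ x ∈ NS, I.deg qid x * (1 : ℝ) :=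
      Finset.sum_pos (fun x hx => by have := hdeg x hx; linarith) hne
    exact h2.ne h1
  have key : ∀ N τ, Live τ →
      (τ.reg 19 = 0 → val E (ENNReal.ofReal θ) r N ([sampleHead], τ) ≤ ENNReal.ofReal Φ0) ∧
      (∀ x t, τ.reg 19 ≠ 0 → τ.reg 20 = x → τ.reg 21 = t → x ∈ NS → t < I.L → I.Coll qid t x →
        val E (ENNReal.ofReal θ) r N ([sampleHead], τ) ≤ ENNReal.ofReal (Φ1 x)) := by
    intro N
    induction N with
    | zero => intro τ _; simp [val]
    | succ N ih =>
      rintro τ ⟨hR, h26, y, hy1, hy2, hy3⟩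
      have hs : τ.reg 18 < e * w := by omega
      obtain ⟨-, hp⟩ := prepare_spec hS hR
      constructor
      · intro h19
        have hk22 : (ex E prepare τ).reg 22 = e * w := by simp [hp, h19]
        refine (val_round E _ r N τ (by simp [h26]) hk22 (by omega)).trans ?_
        refine avg_le hθ (by omega) _ (fun z => if I.Hit E qid et ec w z then
          Φ1 (I.slotPoint qid et ec w z) else Φ0) ?_ ?_ ?_
        · intro z hz
          split_ifs with h
          · exact hΦ1n _ (hS.slotPoint_mem hz h).1
          · exact hΦ0n
        · intro z hz
          obtain ⟨b1, b2, b3, b4, b5, b6⟩ := round_probe hS hR h19 rfl hs hz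
          have hlive : Live (afterRound E τ z) := by
            have hle : (afterRound E τ z).reg 18 ≤ y := by
              rw [b3]
              split_ifs with h
              · exact hy1
              · have : τ.reg 18 ≠ y := fun h' => h (h' ▸ hy3)
                omega
            exact ⟨b1, by rw [b4, if_pos (by omega)], y, hle, hy2, hy3⟩
          split_ifs with h
          · obtain ⟨c1, c2, c3⟩ := b5 h
            obtain ⟨d1, d2, d3⟩ := hS.slotPoint_mem hz h
            exact (ih _ hlive).2 _ _ (by rw [c1]; norm_num) c3 c2 d1 d2 d3
          · exact (ih _ hlive).1 (b6 h)
        · have h1 : ∑ z ∈ Finset.range (e * w), (if I.Hit E qid et ec w z then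
              Φ1 (I.slotPoint qid et ec w z) else Φ0) =
              ∑ z ∈ Finset.range (e * w), (if I.Hit E qid et ec w z then
              (fun x => Φ1 x - Φ0) (I.slotPoint qid et ec w z) else 0) + e * w * Φ0 := by
            have : (e : ℝ) * w * Φ0 = ∑ z ∈ Finset.range (e * w), Φ0 := by simp
            rw [this, ← Finset.sum_add_distrib]
            refine Finset.sum_congr rfl fun z _ => ?_
            split_ifs <;> simp
          -- The factor `deg` from `hit_sum` cancels the denominator of `Φ1 x`. What remains is the
          -- defining equation of `Φ0`.
          have h2 : ∑ x ∈ NS, I.deg qid x * (Φ1 x - Φ0) = - (e * w * (300 * θ)) := by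
            have h3 : ∑ x ∈ NS, I.deg qid x * (Φ1 x - Φ0) =
                ∑ x ∈ NS, (I.L * (300 * θ) - Φ0 + (θ + ρ (x + 1))) := by
              refine Finset.sum_congr rfl fun x hx => ?_
              rw [mul_sub, hΦ1k x hx]; ring
            rw [h3, Finset.sum_add_distrib, Finset.sum_const, nsmul_eq_mul, ← hk, mul_sub, hΦ0k]
            ring
          rw [h1, hS.hit_sum (fun x => Φ1 x - Φ0), ← hNS, h2]
          have hZ0 : (0 : ℝ) < (e : ℝ) * w := by
            have : 0 < e * w := by omega
            exact_mod_cast this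
          push_cast
          generalize (e : ℝ) * w = Z at *
          refine le_of_eq ?_
          field_simp
          ring
      · intro x t h19 h20 h21 hx ht hc
        have hk22 : (ex E prepare τ).reg 22 = I.L := by simp [hp, h19]
        have hxn : x < I.n := Finset.mem_range.1 (Finset.mem_filter.1 hx).1
        refine (val_round E _ r N τ (by simp [h26]) hk22 hS.fits.L_pos).trans ?_
        refine avg_le hθ hS.fits.L_pos _ (fun z => if I.Coll qid z x then
          (if z = t then θ + ρ (x + 1) else Φ0) else Φ1 x) ?_ ?_ ?_
        · intro z hz
          split_ifs
          · exact add_nonneg hθ (hρ _)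
          · exact hΦ0n
          · exact hΦ1n x hx
        · intro z hz
          obtain ⟨b1, b2, b3, b4⟩ := round_resolve hS hR h19 rfl hs hxn ht hz h20 h21
          split_ifs with h h'
          · obtain ⟨c1, c2⟩ := b2 h h'
            refine (val_exit E _ r N _ c2).trans ?_
            rw [ENNReal.ofReal_add hθ (hρ _)]
            gcongr
            exact (hr _).trans (by rw [c1])
          · obtain ⟨c1, c2, c3⟩ := b3 h h'
            exact (ih _ ⟨b1, c3, y, by omega, hy2, hy3⟩).1 c1
          · obtain ⟨c1, c2, c3, c4, c5⟩ := b4 h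
            exact (ih _ ⟨b1, c3, y, by omega, hy2, hy3⟩).2 x t c1 c4 c5 hx ht hc
        · have h1 : ∑ z ∈ Finset.range I.L, (if I.Coll qid z x then
              (if z = t then θ + ρ (x + 1) else Φ0) else Φ1 x) =
              ∑ z ∈ Finset.range I.L, ((if I.Coll qid z x then Φ0 - Φ1 x else 0) +
                (if z = t then θ + ρ (x + 1) - Φ0 else 0) + Φ1 x) := by
            refine Finset.sum_congr rfl fun z _ => ?_
            split_ifs with h h' h'
            · ring
            · ring
            · exact absurd (h' ▸ hc) h
            · ring
          have h2 : ∑ z ∈ Finset.range I.L, (if I.Coll qid z x then Φ0 - Φ1 x else 0) =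
              I.deg qid x * (Φ0 - Φ1 x) := by
            rw [← Finset.sum_filter, Finset.sum_const, nsmul_eq_mul]; rfl
          rw [h1, Finset.sum_add_distrib, Finset.sum_add_distrib, h2,
            Finset.sum_ite_eq' (Finset.range I.L) t, if_pos (Finset.mem_range.2 ht),
            Finset.sum_const, Finset.card_range, nsmul_eq_mul, mul_sub, hΦ1k x hx]
          refine le_of_eq ?_
          field_simp
          ring
  obtain ⟨y, hy1, hy2⟩ := hex
  refine (key N τ ⟨hR, ?_, y, by omega, hy1, hy2⟩).1 h19
  rw [h26, if_pos (by omega)]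

/-- Without hits no random choice has any influence: each round advances the pointer by one, and
register `0` keeps its initial value, which encodes `⊥`. -/
lemma Sampling.val_le_of_empty (hS : Sampling I E qid et ec w e) {θ : ℝ} (hθ : 0 ≤ θ)
    {ρ : ℕ → ℝ} (hρ : ∀ v, 0 ≤ ρ v) {r : State → ℝ≥0∞}
    (hr : ∀ σ, r σ ≤ ENNReal.ofReal (ρ (σ.reg 0))) (hem : I.nearSet E qid = ∅)
    {τ : State} (hR : Ready I τ qid et ec w e) (h0 : τ.reg 0 = 0) (h18 : τ.reg 18 = 0)
    (h19 : τ.reg 19 = 0) (h26 : τ.reg 26 = if τ.reg 18 < e * w then 1 else 0) (N : ℕ) :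
    val E (ENNReal.ofReal θ) r N ([sampleHead], τ) ≤ ENNReal.ofReal
      (e * w * (300 * θ) + (θ + ρ 0)) := by
  have hno : ∀ y < e * w, ¬ I.Hit E qid et ec w y := fun y hy h => by
    have := (hS.slotPoint_mem hy h).1
    rw [hem] at this
    exact absurd this (Finset.notMem_empty _)
  have key : ∀ N s τ, Ready I τ qid et ec w e → τ.reg 0 = 0 → τ.reg 19 = 0 → τ.reg 18 = s →
      s ≤ e * w → (τ.reg 26 = if s < e * w then 1 else 0) →
      val E (ENNReal.ofReal θ) r N ([sampleHead], τ) ≤ ENNReal.ofReal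
      ((e * w - s) * (300 * θ) + (θ + ρ 0)) := by
    intro N
    induction N with
    | zero => intros; simp [val]
    | succ N ih =>
      intro s τ hR h0 h19 h18 hs h26
      by_cases hlt : s < e * w
      · rw [if_pos hlt] at h26
        obtain ⟨-, hp⟩ := prepare_spec hS hR
        have hk22 : (ex E prepare τ).reg 22 = e * w := by simp [hp, h19]
        have hlt' : (s : ℝ) + 1 ≤ e * w := by exact_mod_cast hlt
        refine (val_round E _ r N τ (by simp [h26]) hk22 (by omega)).trans ?_
        have hn : 0 ≤ ((e : ℝ) * w - (s + 1)) * (300 * θ) + (θ + ρ 0) := by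
          have := hρ 0
          have : 0 ≤ ((e : ℝ) * w - (s + 1)) * (300 * θ) :=
            mul_nonneg (by linarith) (by positivity)
          positivity
        refine avg_le hθ (by omega) _
          (fun z => (e * w - (s + 1)) * (300 * θ) + (θ + ρ 0)) (fun z _ => hn) ?_ ?_
        · intro z hz
          obtain ⟨b1, b2, b3, b4, b5, b6⟩ := round_probe hS hR h19 h18 hlt hz
          rw [if_neg (hno s hlt)] at b3
          have := ih (s + 1) _ b1 (b2.trans h0) (b6 (hno z hz)) b3 hlt (by rw [b4, b3])
          exact_mod_cast this
        · rw [Finset.sum_const, Finset.card_range, nsmul_eq_mul]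
          have hZ0 : (0 : ℝ) < ((e * w : ℕ) : ℝ) := by
            have : 0 < e * w := by omega
            exact_mod_cast this
          rw [mul_div_cancel_left₀ _ hZ0.ne']
          linarith
      · rw [if_neg hlt] at h26
        obtain rfl : s = e * w := by omega
        refine (val_exit E _ r (N + 1) τ h26).trans ?_
        push_cast
        rw [sub_self, zero_mul, zero_add, ENNReal.ofReal_add hθ (hρ _)]
        gcongr
        exact (hr _).trans (by rw [h0])
  have := key N 0 τ hR h0 h19 h18 (Nat.zero_le _) (by rw [h26, h18])
  simpa using this

end

end FairANN
namespace FairANN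

/-! ### The query program -/

/-- The query program. -/
def queryCmd : Cmd :=
  loadParams ;; stageOne ;; stageTwo ;; stageThree ;;
    (.const 0 0 ;; .const 18 0 ;; .const 19 0) ;; sampleLoop

/-- A bound for the number of steps before sampling starts. -/
def Image.prepSteps (I : Image) : ℕ :=
  I.G * (I.n.size * (I.kap * 14 + 61) + 40) + I.L * 350 + 200

/-- The point `x` and the query have the same labels in the table `t`. -/
def Image.Same (I : Image) (E : Env) (t x : ℕ) : Prop :=
  I.cm E (I.T 3 t) x = 0 ∧ I.cm E (I.T 4 t) x = 0

open Classical in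
/-- The number of tables in which `x` has the labels of the query. -/
noncomputable def Image.multiplicity (I : Image) (E : Env) (x : ℕ) : ℕ :=
  ((Finset.range I.L).filter fun t => I.Same E t x).card

open Classical in
/-- The near points that have the labels of the query in some table. -/
noncomputable def Image.found (I : Image) (E : Env) : Finset ℕ :=
  (Finset.range I.n).filter fun x => E.near x ≠ 0 ∧ ∃ t < I.L, I.Same E t x

/-- What makes the image a correct memory content for the query described by the machine `E`. -/
structure Image.Valid (I : Image) (E : Env) : Prop where
  fits : I.Fits E
  header : I.Header
  sorted : I.Sorted E
  dict : I.Dict E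

section
variable {I : Image} {E : Env}

lemma coll_iff_same (hV : I.Valid E) {qid : ℕ → ℕ} (hq : ∀ g < I.G, I.IsGroup E g (qid g))
    {t x : ℕ} (ht : t < I.L) (hx : x < I.n) : I.Coll qid t x ↔ I.Same E t x :=
  and_congr ((hq _ (hV.dict.ga_lt t ht)).2 x hx) ((hq _ (hV.dict.gb_lt t ht)).2 x hx)

lemma deg_eq_multiplicity (hV : I.Valid E) {qid : ℕ → ℕ} (hq : ∀ g < I.G, I.IsGroup E g (qid g))
    {x : ℕ} (hx : x < I.n) : I.deg qid x = I.multiplicity E x := by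
  classical
  rw [Image.deg, Image.multiplicity]
  congr 1
  exact Finset.filter_congr fun t ht => coll_iff_same hV hq (Finset.mem_range.1 ht) hx

lemma nearSet_eq_found (hV : I.Valid E) {qid : ℕ → ℕ}
    (hq : ∀ g < I.G, I.IsGroup E g (qid g)) : I.nearSet E qid = I.found E := by
  classical
  refine Finset.filter_congr fun x hx => and_congr Iff.rfl (exists_congr fun t => ?_)
  exact and_congr_right fun ht => coll_iff_same hV hq ht (Finset.mem_range.1 hx)

/-- The expected reward and cost of sampling. -/
noncomputable def sampleBound (I : Image) (E : Env) (ρ : ℕ → ℝ) : ℝ :=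
  if I.found E = ∅ then ρ 0 else (∑ x ∈ I.found E, ρ (x + 1)) / (I.found E).card

/-- Price and reward are left free because the estimate is used twice: with price `E.d` and no
reward for the expected time, and with price `0` and an indicator reward for the law of the answer.
-/
lemma val_query (hV : I.Valid E) {σ : State} (hm : ∀ r < 12, ∀ i < I.X, arr σ r i = I.T r i)
    {θ : ℝ} (hθ : 0 ≤ θ) {ρ : ℕ → ℝ} (hρ : ∀ v, 0 ≤ ρ v) {r : State → ℝ≥0∞}
    (hr : ∀ σ, r σ ≤ ENNReal.ofReal (ρ (σ.reg 0))) (N : ℕ) :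
    val E (ENNReal.ofReal θ) r N ([queryCmd], σ) ≤ ENNReal.ofReal
      (θ * (I.prepSteps + 1 + 300 * ((2 * (∑ x ∈ Finset.range I.n, I.multiplicity E x : ℕ) + I.L) /
        (max (I.found E).card 1 : ℕ) + I.L)) + sampleBound I E ρ) := by
  obtain ⟨σ₁, run₁, hL₁⟩ := run_loadParams hV.fits hV.header hm
  obtain ⟨σ₂, run₂, hL₂, hq₂⟩ := run_stageOne hV.fits hV.sorted hL₁
  set qid : ℕ → ℕ := arr σ₂ 12 with hqid
  have hqle : ∀ g < I.G, qid g ≤ I.n := fun g hg => (hq₂ g hg).1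
  obtain ⟨σ₃, run₃, hL₃, hq₃, hl₃, hs₃, h11⟩ := run_stageTwo hV.fits hV.dict hL₂ hqle
    (fun _ _ => rfl)
  have hlen : ∀ t < I.L, I.bucketLen (I.qkey qid t) ≤ I.n := fun t ht =>
    hV.dict.len_le t ht _ (hqle _ (hV.dict.ga_lt t ht)) _ (hqle _ (hV.dict.gb_lt t ht))
  obtain ⟨m, hmm⟩ : ∃ m, m = ∑ t ∈ Finset.range I.L, I.bucketLen (I.qkey qid t) := ⟨_, rfl⟩
  obtain ⟨σ₄, et, ec, w, e, run₄, hR₄, hw, hwn, he, heX, hchunk, hsum⟩ :=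
    run_stageThree hV.fits hL₃ hq₃ hl₃ hs₃ hlen (h11.trans hmm.symm) hmm
  have hmn : m ≤ I.n * I.L := by
    rw [hmm]
    refine (Finset.sum_le_card_nsmul _ _ I.n fun s hs => ?_).trans (by simp [mul_comm])
    exact hlen s (Finset.mem_range.1 hs)
  have hZ := hV.fits.Z
  have hS : Sampling I E qid et ec w e := ⟨hV.fits, hV.dict, hqle, hw, hwn, heX, hchunk,
    by omega, hsum⟩
  have hmdeg : m = ∑ x ∈ Finset.range I.n, I.multiplicity E x := by
    rw [hmm, sum_bucketLen hV.dict hqle]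
    exact Finset.sum_congr rfl fun x hx => deg_eq_multiplicity hV hq₂ (Finset.mem_range.1 hx)
  have hns := nearSet_eq_found hV hq₂
  set A : Cmd := .const 0 0 ;; .const 18 0 ;; .const 19 0 with hA
  have hAr : ∀ y, (ex E A σ₄).reg y = if y = 0 ∨ y = 18 ∨ y = 19 then 0 else σ₄.reg y := by
    intro y
    simp [hA, ex]
    grind
  have hRA : Ready I (ex E A σ₄) qid et ec w e := by
    refine hR₄.congr (fun y h1 h2 => ?_) (by simp [hA, ex])
    rw [hAr, if_neg (by omega)]
  obtain ⟨τ, hτ⟩ : ∃ τ, τ = (ex E A σ₄).test 26 18 17 := ⟨_, rfl⟩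
  have hred : Red E ([queryCmd], σ) ([sampleHead], τ) I.prepSteps := by
    have h6 : Run E A σ₄ (ex E A σ₄) 10 := (run_ex E A σ₄ (by simp [hA, straight])).mono (by decide)
    have h7 : Red E ([sampleLoop], ex E A σ₄) ([sampleHead], τ) 2 := by
      rw [hτ]
      exact .step rfl (red_test E 26 18 17 _ _)
    have := Red.step (E := E) (t := _) (c := queryCmd) (K := []) (σ := σ) rfl
      ((run₁ _).trans (.step rfl ((run₂ _).trans (.step rfl ((run₃ _).trans (.step rfl
        ((run₄ _).trans (.step rfl ((h6 _).trans h7)))))))))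
    refine this.mono ?_
    unfold Image.prepSteps
    omega
  have hRτ : Ready I τ qid et ec w e := by
    rw [hτ]
    refine hRA.congr (fun y h1 h2 => ?_) rfl
    have : y ≠ 26 := by omega
    simp [this]
  have h0 : τ.reg 0 = 0 := by simp [hτ, hAr]
  have h18 : τ.reg 18 = 0 := by simp [hτ, hAr]
  have h19 : τ.reg 19 = 0 := by simp [hτ, hAr]
  have h26 : τ.reg 26 = if τ.reg 18 < e * w then 1 else 0 := by
    rw [h18, ← hR₄.r17]; simp [hτ, hAr]
  have hZm : (e : ℝ) * w ≤ 2 * m + I.L := by exact_mod_cast he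
  rw [← hmdeg]
  have hnn : (0 : ℝ) ≤ (2 * m + I.L) / (max (I.found E).card 1 : ℕ) := by positivity
  have hfin : ∀ Φ : ℝ, 0 ≤ Φ → val E (ENNReal.ofReal θ) r N ([sampleHead], τ) ≤ ENNReal.ofReal Φ →
      Φ ≤ θ * (1 + 300 * ((2 * m + I.L) / (max (I.found E).card 1 : ℕ) + I.L)) +
        sampleBound I E ρ → val E (ENNReal.ofReal θ) r N ([queryCmd], σ) ≤ ENNReal.ofReal
      (θ * (I.prepSteps + 1 + 300 * ((2 * m + I.L) /
        (max (I.found E).card 1 : ℕ) + I.L)) + sampleBound I E ρ) := by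
    intro Φ hΦ0 h1 h2
    refine (val_red hred _ r N).trans ?_
    calc _ ≤ ENNReal.ofReal θ * (I.prepSteps : ℝ≥0∞) + ENNReal.ofReal Φ := by gcongr
      _ = ENNReal.ofReal (θ * I.prepSteps + Φ) := by
          rw [ENNReal.ofReal_add (by positivity) hΦ0, ENNReal.ofReal_mul hθ,
            ENNReal.ofReal_natCast]
      _ ≤ _ := ENNReal.ofReal_le_ofReal (by linarith)
  by_cases hem : I.found E = ∅
  · refine hfin _ (add_nonneg (by positivity) (add_nonneg hθ (hρ 0)))
      (hS.val_le_of_empty hθ hρ hr (hns.trans hem) hRτ h0 h18 h19 h26 N) ?_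
    rw [sampleBound, if_pos hem, hem]
    simp only [Finset.card_empty, zero_le, sup_of_le_right, Nat.cast_one, div_one]
    nlinarith [mul_le_mul_of_nonneg_left hZm hθ, mul_nonneg hθ (Nat.cast_nonneg (α := ℝ) I.L)]
  · have hne : (I.nearSet E qid).Nonempty := by
      rw [hns]; exact Finset.nonempty_iff_ne_empty.2 hem
    refine hfin _ ?_ (hS.val_le_of_nonempty hθ hρ hr hne hRτ h18 h19 h26 N) ?_
    · have := Finset.sum_nonneg (s := I.nearSet E qid) (f := fun x => θ + ρ (x + 1))
        fun x _ => add_nonneg hθ (hρ _)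
      positivity
    · rw [hns] at hne ⊢
      have hk : 1 ≤ (I.found E).card := Finset.card_pos.2 hne
      rw [sampleBound, if_neg hem, max_eq_left hk, Finset.sum_add_distrib, Finset.sum_const,
        nsmul_eq_mul]
      have hk' : (0 : ℝ) < (I.found E).card := by exact_mod_cast hk
      generalize ((I.found E).card : ℝ) = k at *
      have h1 : (e * w * (300 * θ) + k * I.L * (300 * θ) + (k * θ + ∑ x ∈ I.found E, ρ (x + 1))) / k
          = 300 * (θ * (e * w / k)) + 300 * (θ * I.L) + θ + (∑ x ∈ I.found E, ρ (x + 1)) / k := by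
        field_simp
        ring
      rw [h1]
      have h2 : θ * (e * w / k) ≤ θ * ((2 * m + I.L) / k) := by gcongr
      linarith

/-- The uniform distribution on a set of points, or `⊥` if the set is empty. -/
noncomputable def fairOn (n : ℕ) (S : Finset ℕ) : Answer n → ℝ
  | some i => if i.val ∈ S then 1 / S.card else 0
  | none => if S = ∅ then 1 else 0

lemma sum_fairOn {n : ℕ} {S : Finset ℕ} (hS : S ⊆ Finset.range n) :
    ∑ a : Answer n, fairOn n S a = 1 := by
  rw [Fintype.sum_option]
  simp only [fairOn]
  have h1 : ∑ i : Fin n, (if i.val ∈ S then 1 / (S.card : ℝ) else 0) =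
      ∑ x ∈ S, 1 / (S.card : ℝ) := by
    rw [Fin.sum_univ_eq_sum_range (fun x => if x ∈ S then 1 / (S.card : ℝ) else 0),
      ← Finset.sum_filter]
    congr 1
    ext x
    simp only [Finset.mem_filter]
    exact ⟨fun h => h.2, fun h => ⟨hS h, h⟩⟩
  rw [h1, Finset.sum_const, nsmul_eq_mul]
  by_cases h : S = ∅
  · simp [h]
  · have : (S.card : ℝ) ≠ 0 := by
      exact_mod_cast (Finset.card_pos.2 (Finset.nonempty_iff_ne_empty.2 h)).ne'
    rw [if_neg h]
    field_simp
    simp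

lemma fairOn_nonneg (n : ℕ) (S : Finset ℕ) (a : Answer n) : 0 ≤ fairOn n S a := by
  cases a <;> simp only [fairOn] <;> split_ifs <;> positivity

lemma found_subset : I.found E ⊆ Finset.range I.n := by
  classical
  exact Finset.filter_subset _ _

lemma expTime_query (hV : I.Valid E) (hd : 1 ≤ E.d) {σ : State}
    (hm : ∀ r < 12, ∀ i < I.X, arr σ r i = I.T r i) :
    expTime E ([queryCmd], σ) ≤ ENNReal.ofReal
      (E.d * (I.prepSteps + 1 + 300 * ((2 * (∑ x ∈ Finset.range I.n, I.multiplicity E x : ℕ) +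
        I.L) / (max (I.found E).card 1 : ℕ) + I.L))) := by
  refine expTime_le_of_val E hd _ _ fun N => ?_
  have := val_query hV hm (θ := E.d) (Nat.cast_nonneg _) (ρ := fun _ => 0) (fun _ => le_rfl)
    (r := fun _ => 0) (fun _ => zero_le) N
  rw [ENNReal.ofReal_natCast] at this
  refine this.trans (ENNReal.ofReal_le_ofReal ?_)
  simp [sampleBound]

/-- The upper bounds for the single answers add up to `1`, and the true probabilities add up to at
least `1` because the expected time is finite. Hence no upper bound can be strict. -/
lemma ansProb_query (hV : I.Valid E) (hd : 1 ≤ E.d) {σ : State}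
    (hm : ∀ r < 12, ∀ i < I.X, arr σ r i = I.T r i) (a : Answer I.n) :
    ansProb E ([queryCmd], σ) a = ENNReal.ofReal (fairOn I.n (I.found E) a) := by
  have hle : ∀ a : Answer I.n, ansProb E ([queryCmd], σ) a ≤
      ENNReal.ofReal (fairOn I.n (I.found E) a) := by
    intro a
    refine ansProb_le_of_val E _ a _ fun N => ?_
    have := val_query hV hm (θ := 0) le_rfl (ρ := fun v => if decode I.n v = a then 1 else 0)
      (fun v => by split_ifs <;> norm_num)
      (r := fun σ => if decode I.n (σ.reg 0) = a then 1 else 0)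
      (fun σ => by split_ifs <;> simp) N
    rw [ENNReal.ofReal_zero] at this
    refine this.trans (ENNReal.ofReal_le_ofReal ?_)
    rw [zero_mul, zero_add, sampleBound]
    have hdec : ∀ x (hx : x < I.n), decode I.n (x + 1) = some ⟨x, hx⟩ := fun x hx => by
      simp [decode, hx]
    have hdec0 : decode I.n 0 = none := by simp [decode]
    by_cases hem : I.found E = ∅
    · rw [if_pos hem, hdec0]
      cases a <;> simp [fairOn, hem]
    · rw [if_neg hem]
      cases a with
      | none =>
        rw [Finset.sum_eq_zero]
        · simp [fairOn, hem]
        · intro x hx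
          rw [hdec x (Finset.mem_range.1 (found_subset hx))]
          simp
      | some i =>
        have hsum : ∑ x ∈ I.found E, (if decode I.n (x + 1) = some i then (1 : ℝ) else 0) =
            ∑ x ∈ I.found E, if x = i.val then (1 : ℝ) else 0 := by
          refine Finset.sum_congr rfl fun x hx => ?_
          rw [hdec x (Finset.mem_range.1 (found_subset hx))]
          simp [Fin.ext_iff]
        rw [hsum, Finset.sum_ite_eq']
        simp only [fairOn]
        split_ifs <;> simp
  have hne : ∀ a : Answer I.n, ENNReal.ofReal (fairOn I.n (I.found E) a) ≠ ∞ :=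
    fun _ => ENNReal.ofReal_ne_top
  have h1 : 1 ≤ ∑ a : Answer I.n, ansProb E ([queryCmd], σ) a :=
    one_le_sum_ansProb E hd _ (ne_top_of_le_ne_top ENNReal.ofReal_ne_top (expTime_query hV hd hm))
  have h2 : ∑ a : Answer I.n, ENNReal.ofReal (fairOn I.n (I.found E) a) = 1 := by
    rw [← ENNReal.ofReal_sum_of_nonneg fun a _ => fairOn_nonneg _ _ a, sum_fairOn found_subset,
      ENNReal.ofReal_one]
  by_contra hne'
  have hlt := lt_of_le_of_ne (hle a) hne'
  have h3 : ∑ a : Answer I.n, ansProb E ([queryCmd], σ) a <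
      ∑ a : Answer I.n, ENNReal.ofReal (fairOn I.n (I.found E) a) := by
    classical
    rw [← Finset.add_sum_erase _ _ (Finset.mem_univ a),
      ← Finset.add_sum_erase (a := a) _ (fun a => ENNReal.ofReal _) (Finset.mem_univ a)]
    refine ENNReal.add_lt_add_of_lt_of_le ?_ hlt (Finset.sum_le_sum fun b _ => hle b)
    refine ne_top_of_le_ne_top ?_ (Finset.sum_le_sum fun b _ => hle b)
    exact ENNReal.sum_ne_top.2 fun b _ => hne b
  rw [h2] at h3
  exact absurd h1 (not_le.2 h3)

end

end FairANN
namespace FairANN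

/-! ### Existence of the dictionary -/

/-- After sorting by key, the entries with key `k` form an interval, whose ends are the numbers of
entries with key less than `k` and with key at most `k`. -/
lemma exists_bucket_order {N : ℕ} (K : Fin N → ℕ) :
    ∃ (B : Equiv.Perm (Fin N)) (start len : ℕ → ℕ), (∀ k, start k + len k ≤ N) ∧
      ∀ k (i : Fin N), (start k ≤ i ∧ i < start k + len k) ↔ K (B i) = k := by
  classical
  let B := Tuple.sort K
  have hB : Monotone (K ∘ B) := Tuple.monotone_sort K
  have hB' : Monotone (fun i => K (B i) + 1) := fun i j h => Nat.add_le_add_right (hB h) 1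
  let lo : ℕ → ℕ := fun k => (Finset.univ.filter fun i => K (B i) + 1 ≤ k).card
  let hi : ℕ → ℕ := fun k => (Finset.univ.filter fun i => K (B i) ≤ k).card
  have hlo : ∀ k (i : Fin N), i < lo k ↔ K (B i) + 1 ≤ k := fun k i =>
    Tuple.lt_card_le_iff_apply_le_of_monotone hB'
  have hhi : ∀ k (i : Fin N), i < hi k ↔ K (B i) ≤ k := fun k i =>
    Tuple.lt_card_le_iff_apply_le_of_monotone hB
  have hlh : ∀ k, lo k ≤ hi k := fun k => Finset.card_le_card fun i hi => by
    simp only [Finset.mem_filter] at hi ⊢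
    exact ⟨hi.1, by omega⟩
  refine ⟨B, lo, fun k => hi k - lo k, fun k => ?_, fun k i => ?_⟩
  · have : hi k ≤ N := (Finset.card_le_univ _).trans (by simp)
    have := hlh k
    change lo k + (hi k - lo k) ≤ N
    omega
  · have := hlo k i
    have := hhi k i
    have := hlh k
    change lo k ≤ i ∧ i < lo k + (hi k - lo k) ↔ _
    omega

/-- The equivalence is claimed for every `k`, not only for keys that occur: for an absent key it
says that the lookup yields an empty bucket. -/
lemma exists_dictionary {p : ℕ} (hp : p.Prime) {N : ℕ} (hN : 0 < N) (K : Fin N → ℕ)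
    (hK : ∀ e, K e < p) :
    ∃ (α : ℕ) (β off sz RK RS RL : ℕ → ℕ) (B : Equiv.Perm (Fin N)), α < p ∧ (∀ i, β i < p) ∧
      (∀ i, 0 < sz i) ∧ (∀ i, off i + sz i ≤ 5 * N) ∧ (∀ s, RK s ≤ p) ∧
      (∀ s, RS s + RL s ≤ N) ∧ ∀ k e, K e = k ↔
        ∃ i < if RK (slot p N α β off sz k) = k + 1 then RL (slot p N α β off sz k) else 0,
          ∃ h : RS (slot p N α β off sz k) + i < N, B ⟨RS (slot p N α β off sz k) + i, h⟩ = e := by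
  classical
  obtain ⟨B, start, len, hsl, hB⟩ := exists_bucket_order K
  obtain ⟨α, β, off, sz, hα, hβ, hsz, hoff, hinj⟩ := exists_perfect_hash hp
    (Finset.univ.image K) (by simpa using hK) hN
    (Finset.card_image_le.trans (by simp))
  -- Only indices below `N` are ever looked up. The default values make the numerical bounds hold
  -- for all `i`, so that every memory word stays small.
  let off' : ℕ → ℕ := fun i => if i < N then off i else 0
  let sz' : ℕ → ℕ := fun i => if i < N then sz i else 1
  have hslot : ∀ k, slot p N α β off' sz' k = slot p N α β off sz k := fun k => by
    have : α * k % p % N < N := Nat.mod_lt _ hN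
    simp [slot, off', sz', this]
  let s : ℕ → ℕ := slot p N α β off sz
  -- A partial inverse of the slot function, well defined on the occurring keys by injectivity.
  -- Slots of no key get `none` and are filled with zeros.
  let key : ℕ → Option ℕ := fun j =>
    if h : ∃ e, s (K e) = j then some (K h.choose) else none
  have hkey : ∀ e, key (s (K e)) = some (K e) := fun e => by
    have h : ∃ e', s (K e') = s (K e) := ⟨e, rfl⟩
    simp only [key, dif_pos h, Option.some.injEq]
    exact hinj (by simp) (by simp) h.choose_spec
  have hkey' : ∀ j k, key j = some k → ∃ e, K e = k := fun j k h => by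
    simp only [key] at h
    split_ifs at h with h'
    exact ⟨_, Option.some.inj h⟩
  refine ⟨α, β, off', sz', fun j => (key j).elim 0 (· + 1), fun j => (key j).elim 0 start,
    fun j => (key j).elim 0 len, B, hα, hβ, fun i => ?_, fun i => ?_, fun j => ?_, fun j => ?_,
    fun k e => ?_⟩
  · simp only [sz']; split_ifs <;> simp [hsz]
  · simp only [off', sz']
    split_ifs with h
    · exact hoff i h
    · omega
  · show (key j).elim 0 (· + 1) ≤ p
    rcases h : key j with _ | k
    · simp
    · obtain ⟨e, rfl⟩ := hkey' j k h
      exact hK e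
  · show (key j).elim 0 start + (key j).elim 0 len ≤ N
    rcases key j with _ | k
    · simp
    · exact hsl k
  · rw [hslot]
    change _ ↔ ∃ i < if (key (s k)).elim 0 (· + 1) = k + 1 then (key (s k)).elim 0 len else 0, _
    constructor
    · rintro rfl
      have h1 := hkey e
      have h2 := (hB (K e) (B.symm e)).2 (by simp)
      change ∃ i < if (key (s (K e))).elim 0 (· + 1) = K e + 1 then (key (s (K e))).elim 0 len
        else 0, ∃ h : (key (s (K e))).elim 0 start + i < N,
          B ⟨(key (s (K e))).elim 0 start + i, h⟩ = e
      simp only [h1, Option.elim_some, if_true]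
      refine ⟨(B.symm e).val - start (K e), by omega, ?_, ?_⟩
      · have := (B.symm e).isLt; omega
      · have h3 : ∀ h, (⟨start (K e) + ((B.symm e).val - start (K e)), h⟩ : Fin N) = B.symm e :=
          fun h => Fin.ext (by simp only; omega)
        exact (congrArg B (h3 _)).trans (B.apply_symm_apply e)
    · rintro ⟨i, hi, h, he⟩
      split_ifs at hi with hk
      · rcases hks : key (s k) with _ | k'
        · simp [hks] at hk
        · rw [hks, Option.elim_some, Nat.add_right_cancel_iff] at hk
          subst hk
          rw [hks, Option.elim_some] at hi
          change (key (s k')).elim 0 start + i < N at h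
          change B ⟨(key (s k')).elim 0 start + i, _⟩ = e at he
          rw [← he]
          refine (hB k' _).1 ?_
          simp only [hks, Option.elim_some]
          omega
      · omega

/-! ### Lexicographic comparison -/

lemma lexCmp_eq_zero {f : ℕ → ℕ} {i k : ℕ} : lexCmp f i k = 0 ↔ ∀ l < k, f (i + l) = 0 := by
  induction k generalizing i with
  | zero => simp [lexCmp]
  | succ k ih =>
    rw [lexCmp]
    split_ifs with h
    · simp only [h, false_iff, not_forall]
      exact ⟨0, by omega, h⟩
    · rw [ih]
      refine ⟨fun h' l hl => ?_, fun h' l hl => ?_⟩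
      · rcases l with _ | l
        · simpa using h
        · have := h' l (by omega)
          rwa [add_right_comm, add_assoc] at this
      · have := h' (l + 1) (by omega)
        rwa [add_right_comm, add_assoc]

lemma lexCmp_eq {f : ℕ → ℕ} {i k v : ℕ} (hv : v ≠ 0) :
    lexCmp f i k = v ↔ ∃ l < k, (∀ j < l, f (i + j) = 0) ∧ f (i + l) = v := by
  induction k generalizing i with
  | zero => simp [lexCmp, hv.symm]
  | succ k ih =>
    rw [lexCmp]
    split_ifs with h
    · constructor
      · intro h'
        exact ⟨0, by omega, by simp, h'⟩
      · rintro ⟨l, hl, h1, h2⟩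
        rcases l with _ | l
        · exact h2
        · exact absurd (h1 0 (by omega)) h
    · rw [ih]
      constructor
      · rintro ⟨l, hl, h1, h2⟩
        refine ⟨l + 1, by omega, fun j hj => ?_, ?_⟩
        · rcases j with _ | j
          · simpa using h
          · have := h1 j (by omega)
            rwa [add_right_comm, add_assoc] at this
        · rwa [add_right_comm, add_assoc] at h2
      · rintro ⟨l, hl, h1, h2⟩
        rcases l with _ | l
        · rw [add_zero] at h2
          exact absurd (h2 ▸ hv) h
        · refine ⟨l, by omega, fun j hj => ?_, ?_⟩
          · have := h1 (j + 1) (by omega)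
            rwa [add_right_comm, add_assoc]
          · rwa [add_right_comm, add_assoc]

section
variable {U : Type*} [LinearOrder U] {k i : ℕ} {a b : Fin k → U} {f : ℕ → ℕ}

/-- `f (i + l)` is the result of comparing the labels `a l` and `b l`. -/
def Compares (f : ℕ → ℕ) (i : ℕ) (a b : Fin k → U) : Prop :=
  ∀ l : Fin k, f (i + l) = if a l < b l then 1 else if b l < a l then 2 else 0

lemma toLex_lt_toLex_iff : toLex a < toLex b ↔ ∃ i, (∀ j < i, a j = b j) ∧ a i < b i := Iff.rfl

lemma Compares.zero_iff (hf : Compares f i a b) (l : Fin k) : f (i + l) = 0 ↔ a l = b l := by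
  rw [hf l]
  rcases lt_trichotomy (a l) (b l) with h | h | h
  · simp [h, h.ne]
  · simp [h]
  · simp [h, h.not_gt, h.ne']

lemma Compares.one_iff (hf : Compares f i a b) (l : Fin k) : f (i + l) = 1 ↔ a l < b l := by
  rw [hf l]
  split_ifs <;> simp_all

lemma Compares.two_iff (hf : Compares f i a b) (l : Fin k) : f (i + l) = 2 ↔ b l < a l := by
  rw [hf l]
  rcases lt_trichotomy (a l) (b l) with h | h | h
  · simp [h, h.not_gt]
  · simp [h]
  · simp [h, h.not_gt]

lemma Compares.lexCmp_zero (hf : Compares f i a b) : lexCmp f i k = 0 ↔ a = b := by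
  rw [lexCmp_eq_zero, funext_iff]
  exact ⟨fun h l => (hf.zero_iff l).1 (h l l.2), fun h l hl => (hf.zero_iff ⟨l, hl⟩).2 (h _)⟩

lemma Compares.lexCmp_one (hf : Compares f i a b) : lexCmp f i k = 1 ↔ toLex a < toLex b := by
  rw [lexCmp_eq one_ne_zero, toLex_lt_toLex_iff]
  constructor
  · rintro ⟨l, hl, h1, h2⟩
    exact ⟨⟨l, hl⟩, fun j hj => (hf.zero_iff j).1 (h1 j hj), (hf.one_iff ⟨l, hl⟩).1 h2⟩
  · rintro ⟨l, h1, h2⟩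
    exact ⟨l, l.2, fun j hj => (hf.zero_iff ⟨j, hj.trans l.2⟩).2 (h1 _ hj), (hf.one_iff l).2 h2⟩

lemma Compares.lexCmp_two (hf : Compares f i a b) : lexCmp f i k = 2 ↔ toLex b < toLex a := by
  rw [lexCmp_eq two_ne_zero, toLex_lt_toLex_iff]
  constructor
  · rintro ⟨l, hl, h1, h2⟩
    exact ⟨⟨l, hl⟩, fun j hj => ((hf.zero_iff j).1 (h1 j hj)).symm, (hf.two_iff ⟨l, hl⟩).1 h2⟩
  · rintro ⟨l, h1, h2⟩
    exact ⟨l, l.2, fun j hj => (hf.zero_iff ⟨j, hj.trans l.2⟩).2 (h1 _ hj).symm,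
      (hf.two_iff l).2 h2⟩

lemma Compares.lexCmp_le (hf : Compares f i a b) : lexCmp f i k ≤ 2 := by
  rcases lt_trichotomy (toLex a) (toLex b) with h | h | h
  · rw [hf.lexCmp_one.2 h]; norm_num
  · rw [hf.lexCmp_zero.2 (toLex_inj.1 h)]; norm_num
  · rw [hf.lexCmp_two.2 h]

end

end FairANN
namespace FairANN

/-! ### The memory image of a dataset -/

/-- The parameters of the data structure: `n` points, `R` repetitions, each with `2 * m` half
tables, which use concatenations of `kap` hash functions. -/
structure Params where
  (n kap m R : ℕ)

namespace Params
variable (A : Params)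

/-- The number of tables: each repetition combines its `m` first halves with its `m` second
halves. -/
def L : ℕ := A.R * (A.m * A.m)

/-- The number of half tables. -/
def G : ℕ := A.R * (2 * A.m)

/-- A bound for the dictionary keys. -/
def keyMax : ℕ := (A.L * (A.n + 1) + A.n) * (A.n + 1) + A.n

/-- The length of the arrays. -/
def X : ℕ := 5 * (A.L * A.n) + A.G * A.n + 3 * A.L + A.G + 8

/-- The first half of the table `t`. -/
def ga (t : ℕ) : ℕ := t / (A.m * A.m) * (2 * A.m) + t / A.m % A.m

/-- The second half of the table `t`. -/
def gb (t : ℕ) : ℕ := t / (A.m * A.m) * (2 * A.m) + A.m + t % A.m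

/-- The words below `W` suffice. -/
structure Ok (W : ℕ) : Prop where
  n_pos : 0 < A.n
  m_pos : 0 < A.m
  R_pos : 0 < A.R
  size : 17 * A.X ≤ W
  Gkap : A.G * A.kap + A.kap < W
  key : 4 * (A.keyMax * A.keyMax) ≤ W
  Z : 3 * (A.n * A.L) + A.L + A.n < W

/-- The memory image with given content. -/
def image (p alpha : ℕ) (T : ℕ → ℕ → ℕ) : Image :=
  ⟨A.n, A.kap, A.G, A.L, A.L * A.n, p, alpha, A.X, T⟩

variable {A} {W : ℕ}

lemma Ok.L_pos (hA : A.Ok W) : 0 < A.L :=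
  Nat.mul_pos hA.R_pos (Nat.mul_pos hA.m_pos hA.m_pos)

lemma half_lt {t k : ℕ} (ht : t < A.L) (hk : k < 2 * A.m) :
    t / (A.m * A.m) * (2 * A.m) + k < A.G := by
  have h1 : t / (A.m * A.m) < A.R := Nat.div_lt_of_lt_mul (by rwa [mul_comm])
  calc _ < t / (A.m * A.m) * (2 * A.m) + 2 * A.m := by omega
    _ = (t / (A.m * A.m) + 1) * (2 * A.m) := by ring
    _ ≤ A.G := Nat.mul_le_mul_right _ h1

lemma ga_lt (hm : 0 < A.m) {t : ℕ} (ht : t < A.L) : A.ga t < A.G :=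
  half_lt ht (by have := Nat.mod_lt (t / A.m) hm; omega)

lemma gb_lt (hm : 0 < A.m) {t : ℕ} (ht : t < A.L) : A.gb t < A.G := by
  rw [gb, add_assoc]
  exact half_lt ht (by have := Nat.mod_lt t hm; omega)

lemma Ok.keyMax_ge (hA : A.Ok W) : 3 * A.n + 4 ≤ A.keyMax := by
  have h1 := hA.L_pos
  have h2 := hA.n_pos
  unfold keyMax
  have : 1 * (A.n + 1) ≤ A.L * (A.n + 1) := Nat.mul_le_mul_right _ h1
  nlinarith

lemma Ok.fits (hA : A.Ok W) {E : Env} (hE : E.W = W) (hs : E.size = 17 * A.X) {p : ℕ}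
    (hp : A.keyMax < p) (hp2 : p ≤ 2 * A.keyMax) (alpha : ℕ) (T : ℕ → ℕ → ℕ) :
    (A.image p alpha T).Fits E := by
  subst hE
  have h1 := hA.keyMax_ge
  have hK : A.keyMax * 1 ≤ A.keyMax * A.keyMax := Nat.mul_le_mul_left _ (by omega)
  have h2 := hA.key
  have hpp : p * p ≤ 2 * A.keyMax * (2 * A.keyMax) := Nat.mul_le_mul hp2 hp2
  have hX := hA.size
  have hn := hA.n_pos
  have hL := hA.L_pos
  have hX' : A.X = 5 * (A.L * A.n) + A.G * A.n + 3 * A.L + A.G + 8 := rfl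
  refine ⟨hs, hX, fun i hi r hr => ?_, fun i hi r hr => ?_, hn, hL, Nat.mul_pos hL hn, ?_, ?_, ?_,
    ?_, ?_, ?_, hA.Gkap, ?_, ?_, hp, ?_, hA.Z⟩
  all_goals simp only [image] at *
  · omega
  · omega
  · omega
  · omega
  · omega
  · omega
  · omega
  · omega
  · omega
  · change A.keyMax + 1 < E.W
    omega
  · calc p * p ≤ _ := hpp
      _ = 4 * (A.keyMax * A.keyMax) := by ring
      _ ≤ _ := h2

/-- The two-dimensional array `f`, row after row. -/
def rows {a b : ℕ} (f : Fin a → Fin b → ℕ) (i : ℕ) : ℕ :=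
  if h : i < a * b then f (finProdFinEquiv.symm ⟨i, h⟩).1 (finProdFinEquiv.symm ⟨i, h⟩).2 else 0

lemma rows_apply {a b : ℕ} (f : Fin a → Fin b → ℕ) (g : Fin a) (x : Fin b) :
    rows f (g * b + x) = f g x := by
  have h1 : (finProdFinEquiv (g, x)).val = g * b + x := by
    simp [finProdFinEquiv, mul_comm, add_comm]
  have h2 : g * b + x < a * b := h1 ▸ (finProdFinEquiv (g, x)).2
  rw [rows, dif_pos h2]
  have h3 : (⟨g * b + x, h2⟩ : Fin (a * b)) = finProdFinEquiv (g, x) := Fin.ext h1.symm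
  rw [h3, Equiv.symm_apply_apply]

lemma rows_lt {a b c : ℕ} {f : Fin a → Fin b → ℕ} (hc : 0 < c) (hf : ∀ g x, f g x < c) (i : ℕ) :
    rows f i < c := by
  rw [rows]
  split_ifs
  · exact hf _ _
  · exact hc

/-- A key is a numeral in base `n + 1` with the lower digits `u` and `v`. The base leaves room for
the digit `n`, the group number of a query whose label occurs at no data point. -/
lemma keyOf_inj {I : Image} {t u v t' u' v' : ℕ} (hu : u ≤ I.n) (hv : v ≤ I.n) (hu' : u' ≤ I.n)
    (hv' : v' ≤ I.n) : I.keyOf t u v = I.keyOf t' u' v' ↔ t = t' ∧ u = u' ∧ v = v' := by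
  have aux : ∀ {a b c d : ℕ}, b ≤ I.n → d ≤ I.n → a * (I.n + 1) + b = c * (I.n + 1) + d →
      a = c ∧ b = d := by
    intro a b c d hb hd h
    have h1 := congrArg (· / (I.n + 1)) h
    have h2 := congrArg (· % (I.n + 1)) h
    simp only [Nat.mul_comm _ (I.n + 1), Nat.mul_add_div (Nat.succ_pos I.n),
      Nat.mul_add_mod, Nat.div_eq_of_lt (Nat.lt_succ_of_le hb),
      Nat.div_eq_of_lt (Nat.lt_succ_of_le hd), Nat.mod_eq_of_lt (Nat.lt_succ_of_le hb),
      Nat.mod_eq_of_lt (Nat.lt_succ_of_le hd)] at h1 h2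
    exact ⟨by omega, h2⟩
  constructor
  · intro h
    obtain ⟨h1, h2⟩ := aux hv hv' h
    obtain ⟨h3, h4⟩ := aux hu hu' h1
    exact ⟨h3, h4, h2⟩
  · rintro ⟨rfl, rfl, rfl⟩
    rfl

/-- The content of the image that depends on the labels of the data points. -/
structure Represents {U : Type*} [LinearOrder U] (A : Params)
    (lab : Fin A.G → Fin A.n → Fin A.kap → U) (I : Image) : Prop where
  ord : ∃ o : Fin A.G → Equiv.Perm (Fin A.n), (∀ g i, I.T 1 (g.val * A.n + i.val) = o g i) ∧
    ∀ g, Monotone fun i => toLex (lab g (o g i))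
  gid : ∀ g (x y : Fin A.n), I.T 2 (g.val * A.n + x) = I.T 2 (g.val * A.n + y) ↔ lab g x = lab g y

/-- The content of the image that can be used for a query on a machine with words below `W`. -/
structure Usable (A : Params) (W : ℕ) (I : Image) : Prop where
  shape : ∃ p alpha T, A.keyMax < p ∧ p ≤ 2 * A.keyMax ∧ I = A.image p alpha T
  header : I.Header
  dict : ∀ E : Env, E.W = W → I.Dict E
  ga : ∀ t < A.L, I.T 3 t = A.ga t
  gb : ∀ t < A.L, I.T 4 t = A.gb t
  gid_lt : ∀ i, I.T 2 i < A.n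

/-- The dictionary stores one entry `e = t * n + x` for each table `t` and point `x`, under the key
formed from `t` and the two group numbers of `x`. The number of entries is therefore `L * n`, which
determines the space. -/
lemma exists_image {U : Type*} [LinearOrder U] (hA : A.Ok W)
    (lab : Fin A.G → Fin A.n → Fin A.kap → U) :
    ∃ I : Image, A.Represents lab I ∧ A.Usable W I := by
  classical
  have hn := hA.n_pos
  have hL := hA.L_pos
  have : Nonempty (Fin A.n) := ⟨⟨0, hn⟩⟩
  let o : Fin A.G → Equiv.Perm (Fin A.n) := fun g => Tuple.sort fun x => toLex (lab g x)
  -- The number of a label is the index of a fixed data point that carries it, hence below `n`.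
  let gid : Fin A.G → Fin A.n → ℕ := fun g x => (Function.invFun (lab g) (lab g x)).val
  have hgid : ∀ g x y, gid g x = gid g y ↔ lab g x = lab g y := fun g x y => by
    refine ⟨fun h => ?_, fun h => by simp only [gid, h]⟩
    rw [← Function.invFun_eq (f := lab g) ⟨x, rfl⟩, ← Function.invFun_eq (f := lab g) (b := lab g y) ⟨y, rfl⟩,
      Fin.ext h]
  have hgn : ∀ i, rows gid i < A.n := rows_lt hn fun g x => Fin.isLt _
  have hK1 := hA.keyMax_ge
  -- Bertrand's postulate yields a prime above all keys whose square is at most `4 * keyMax ^ 2` and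
  -- so still fits into a word.
  obtain ⟨p, hp, hKp, hp2⟩ := Nat.exists_prime_lt_and_le_two_mul A.keyMax (by omega)
  let I₀ : Image := A.image 0 0 fun _ _ => 0
  let K : Fin (A.L * A.n) → ℕ := fun e => I₀.keyOf (e / A.n)
    (rows gid (A.ga (e / A.n) * A.n + e % A.n)) (rows gid (A.gb (e / A.n) * A.n + e % A.n))
  have hediv : ∀ e : Fin (A.L * A.n), e / A.n < A.L := fun e =>
    Nat.div_lt_of_lt_mul (e.2.trans_eq (mul_comm _ _))
  have hK : ∀ e, K e < p := fun e => by
    refine lt_of_le_of_lt ?_ hKp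
    have h1 := (hgn (A.ga (e / A.n) * A.n + e % A.n)).le
    have h2 := (hgn (A.gb (e / A.n) * A.n + e % A.n)).le
    exact Nat.add_le_add (Nat.mul_le_mul_right _ (Nat.add_le_add (Nat.mul_le_mul_right _
      (hediv e).le) h1)) h2
  obtain ⟨α, β, off, sz, RK, RS, RL, B, hα, hβ, hsz, hoff, hRK, hRS, hdict⟩ :=
    exists_dictionary hp (Nat.mul_pos hL hn) K hK
  let BK : ℕ → ℕ := fun i => if h : i < A.L * A.n then B ⟨i, h⟩ % A.n else 0
  let T : ℕ → ℕ → ℕ := fun r i => match r with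
    | 0 => [A.n, A.kap, A.G, A.L, A.L * A.n, p, α].getD i 0
    | 1 => rows (fun g x => (o g x).val) i
    | 2 => rows gid i
    | 3 => if i < A.L then A.ga i else 0
    | 4 => if i < A.L then A.gb i else 0
    | 5 => β i
    | 6 => off i
    | 7 => sz i
    | 8 => RK i
    | 9 => RS i
    | 10 => RL i
    | 11 => BK i
    | _ => 0
  obtain ⟨I, hI⟩ : ∃ I, I = A.image p α T := ⟨_, rfl⟩
  have hT : I.T = T := by rw [hI]; rfl
  have hBKn : ∀ i, BK i < A.n := fun i => by
    simp only [BK]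
    split_ifs
    · exact Nat.mod_lt _ hn
    · exact hn
  have hpt : ∀ t < A.L, ∀ u ≤ A.n, ∀ v ≤ A.n, ∀ e : Fin (A.L * A.n),
      (∃ i < I.bucketLen (I.keyOf t u v), ∃ h : I.bucketStart (I.keyOf t u v) + i < A.L * A.n,
        B ⟨I.bucketStart (I.keyOf t u v) + i, h⟩ = e) ↔
      e / A.n = t ∧ rows gid (A.ga t * A.n + e % A.n) = u ∧
        rows gid (A.gb t * A.n + e % A.n) = v := by
    intro t ht u hu v hv e
    have h1 : K e = I.keyOf t u v ↔ e / A.n = t ∧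
        rows gid (A.ga (e / A.n) * A.n + e % A.n) = u ∧
        rows gid (A.gb (e / A.n) * A.n + e % A.n) = v := by
      rw [hI]
      exact keyOf_inj (I := I₀) (hgn _).le (hgn _).le hu hv
    have h2 := hdict (I.keyOf t u v) e
    subst hI
    refine (Iff.trans h2.symm h1).trans ⟨?_, ?_⟩
    · rintro ⟨rfl, h⟩; exact ⟨rfl, h⟩
    · rintro ⟨rfl, h⟩; exact ⟨rfl, h⟩
  have hsl : ∀ k, I.bucketStart k + I.bucketLen k ≤ A.L * A.n := by
    intro k
    rw [Image.bucketLen, Image.bucketStart, hT]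
    have := hRS (I.slotOf k)
    change RS (I.slotOf k) + (if _ then RL (I.slotOf k) else 0) ≤ _
    split_ifs
    · exact this
    · omega
  -- All entries of a bucket of the table `t` satisfy `e / n = t`, so the stored remainder `e % n`
  -- already determines the entry.
  have hpoint : ∀ t < A.L, ∀ u ≤ A.n, ∀ v ≤ A.n, ∀ i < I.bucketLen (I.keyOf t u v),
      ∀ h : I.bucketStart (I.keyOf t u v) + i < A.L * A.n,
      (B ⟨I.bucketStart (I.keyOf t u v) + i, h⟩).val =
        t * A.n + I.T 11 (I.bucketStart (I.keyOf t u v) + i) := by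
    intro t ht u hu v hv i hi h
    have h1 := ((hpt t ht u hu v hv _).1 ⟨i, hi, h, rfl⟩).1
    have h2 : I.T 11 (I.bucketStart (I.keyOf t u v) + i) =
        (B ⟨I.bucketStart (I.keyOf t u v) + i, h⟩).val % A.n := by
      rw [hT]
      change BK _ = _
      simp only [BK, dif_pos h]
    rw [h2]
    nth_rw 1 [← Nat.div_add_mod (B ⟨I.bucketStart (I.keyOf t u v) + i, h⟩).val A.n]
    rw [h1, mul_comm]
  have hN : A.L * A.n + 8 ≤ A.X := by unfold X; omega
  have hXW := hA.size
  have hKK : A.keyMax * 4 ≤ A.keyMax * A.keyMax := Nat.mul_le_mul_left _ (by omega)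
  have hkW := hA.key
  have hpW : p < W := by omega
  have hGX : A.G < A.X := by unfold X; omega
  have hLX : A.L ≤ A.X := by unfold X; omega
  have hnX : A.n ≤ A.L * A.n := Nat.le_mul_of_pos_left _ hL
  refine ⟨I, ⟨⟨o, fun g i => ?_, fun g => ?_⟩, fun g x y => ?_⟩,
    ⟨p, α, T, hKp, hp2, hI⟩, ?_, fun E hE => ?_, fun t ht => ?_, fun t ht => ?_, fun i => ?_⟩
  · rw [hT]; exact rows_apply _ g i
  · exact Tuple.monotone_sort fun x => toLex (lab g x)
  · rw [hT]
    change rows gid _ = rows gid _ ↔ _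
    rw [rows_apply, rows_apply, hgid]
  · subst hI
    exact ⟨rfl, rfl, rfl, rfl, rfl, rfl, rfl⟩
  · have hIn : I.n = A.n := by rw [hI]; rfl
    have hIL : I.L = A.L := by rw [hI]; rfl
    have hIG : I.G = A.G := by rw [hI]; rfl
    have hIX : I.X = A.X := by rw [hI]; rfl
    have hIp : I.p = p := by rw [hI]; rfl
    have hIa : I.alpha = α := by rw [hI]; rfl
    constructor
    · rw [hT, hE]
      intro r i
      have hb := hβ i
      have ho := hoff i
      have hk := hRK i
      have hs := hRS i
      have hB := hBKn i
      have hX5 : 5 * (A.L * A.n) ≤ A.X := by unfold X; omega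
      match r with
      | 0 =>
        have hGk := hA.Gkap
        have hκ : A.kap ≤ A.G * A.kap + A.kap := Nat.le_add_left _ _
        show [A.n, A.kap, A.G, A.L, A.L * A.n, p, α].getD i 0 < W
        rw [List.getD_eq_getElem?_getD]
        rcases i with _ | _ | _ | _ | _ | _ | _ | i <;> simp <;> omega
      | 1 => exact (rows_lt hn (fun g x => (o g x).2) i).trans (by omega)
      | 2 => exact (hgn i).trans (by omega)
      | 3 =>
        show (if i < A.L then A.ga i else 0) < W
        split_ifs with h
        · have := ga_lt hA.m_pos h; omega
        · omega
      | 4 =>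
        show (if i < A.L then A.gb i else 0) < W
        split_ifs with h
        · have := gb_lt hA.m_pos h; omega
        · omega
      | 5 => show β i < W; omega
      | 6 => show off i < W; omega
      | 7 => show sz i < W; omega
      | 8 => show RK i < W; omega
      | 9 => show RS i < W; omega
      | 10 => show RL i < W; omega
      | 11 => show BK i < W; omega
      | r + 12 => show 0 < W; omega
    · intro t ht
      rw [hIL] at ht
      rw [hIG, hT]
      show (if t < A.L then A.ga t else 0) < A.G
      rw [if_pos ht]
      exact ga_lt hA.m_pos ht
    · intro t ht
      rw [hIL] at ht
      rw [hIG, hT]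
      show (if t < A.L then A.gb t else 0) < A.G
      rw [if_pos ht]
      exact gb_lt hA.m_pos ht
    · rwa [hIa, hIp]
    · rw [hIp, hT]
      exact fun i _ => hβ i
    · rw [hT]
      exact fun i _ => hsz i
    · rw [hT, hIX]
      exact fun i _ => (hoff i).trans (by unfold X; omega)
    · rw [hIn, hIL]
      intro t ht u hu v hv
      -- A bucket belongs to one table and holds each point at most once, so its length is at most
      -- `n`.
      have hmap : Set.InjOn (fun i => I.T 11 (I.bucketStart (I.keyOf t u v) + i))
          (Finset.range (I.bucketLen (I.keyOf t u v)) : Finset ℕ) := by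
        intro i hi j hj hij
        simp only [Finset.coe_range, Set.mem_Iio] at hi hj
        have hs := hsl (I.keyOf t u v)
        have h1 := hpoint t ht u hu v hv i hi (by omega)
        have h2 := hpoint t ht u hu v hv j hj (by omega)
        have h3 := B.injective (Fin.ext (h1.trans ((congrArg (t * A.n + ·) hij).trans h2.symm)))
        simp only [Fin.mk.injEq] at h3
        omega
      have := Finset.card_le_card_of_injOn (t := Finset.range A.n) _ (fun i hi => by
        rw [Finset.coe_range, Set.mem_Iio, hT]; exact hBKn _) hmap
      simpa using this
    · rw [hIX]
      intro t _ u _ v _ _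
      exact (hsl _).trans (by omega)
    · rw [hIn, hT]
      intro t _ u _ v _ i _
      exact hBKn _
    · rw [hIn, hIL]
      intro t ht u hu v hv i hi j hj hij
      have hs := hsl (I.keyOf t u v)
      have h1 := hpoint t ht u hu v hv i hi (by omega)
      have h2 := hpoint t ht u hu v hv j hj (by omega)
      have h3 := B.injective (Fin.ext (h1.trans ((congrArg (t * A.n + ·) hij).trans h2.symm)))
      simp only [Fin.mk.injEq] at h3
      omega
    · rw [hIn, hIL]
      intro t ht u hu v hv x hx
      have h3 : I.T 3 t = A.ga t := by rw [hT]; exact if_pos ht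
      have h4 : I.T 4 t = A.gb t := by rw [hT]; exact if_pos ht
      have hT2 : I.T 2 = rows gid := by rw [hT]; rfl
      rw [h3, h4, hT2]
      have hs := hsl (I.keyOf t u v)
      have hlt : t * A.n + x < A.L * A.n := by
        calc _ < (t + 1) * A.n := by rw [add_mul]; omega
          _ ≤ _ := Nat.mul_le_mul_right _ ht
      have hd : (t * A.n + x) / A.n = t := by
        rw [mul_comm, Nat.mul_add_div hn, Nat.div_eq_of_lt hx, add_zero]
      have hmod : (t * A.n + x) % A.n = x := by
        rw [mul_comm, Nat.mul_add_mod, Nat.mod_eq_of_lt hx]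
      have key := hpt t ht u hu v hv ⟨t * A.n + x, hlt⟩
      simp only [hd, hmod, true_and] at key
      rw [← key]
      refine exists_congr fun i => and_congr_right fun hi => ?_
      have hlt' : I.bucketStart (I.keyOf t u v) + i < A.L * A.n := by omega
      have h1 := hpoint t ht u hu v hv i hi hlt'
      refine ⟨fun h => ⟨hlt', Fin.ext (h1.trans (congrArg (t * A.n + ·) h))⟩, ?_⟩
      rintro ⟨h2, h⟩
      have h3 := h1.symm.trans (congrArg Fin.val h)
      exact Nat.add_left_cancel h3
  · rw [hT]; exact if_pos ht
  · rw [hT]; exact if_pos ht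
  · rw [hT]; exact hgn i

end Params

end FairANN
namespace FairANN

/-! ### The data structure -/

namespace Params
variable {A : Params} {W : ℕ} {M Ω U : Type*}

/-- The labels of a point in a half table. -/
def label (A : Params) (h : Ω → M → U) (ω : Fin (A.G * A.kap) → Ω) (g : Fin A.G) (q : M) :
    Fin A.kap → U := fun l => h (ω (finProdFinEquiv (g, l))) q

/-- The first half of a table. -/
def firstHalf (hm : 0 < A.m) (t : Fin A.L) : Fin A.G := ⟨A.ga t, ga_lt hm t.2⟩

/-- The second half of a table. -/
def secondHalf (hm : 0 < A.m) (t : Fin A.L) : Fin A.G := ⟨A.gb t, gb_lt hm t.2⟩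

/-- Two points share a bucket of the table `t`. -/
def Meets (hm : 0 < A.m) (h : Ω → M → U) (ω : Fin (A.G * A.kap) → Ω) (q x : M) (t : Fin A.L) :
    Prop :=
  A.label h ω (firstHalf hm t) q = A.label h ω (firstHalf hm t) x ∧
    A.label h ω (secondHalf hm t) q = A.label h ω (secondHalf hm t) x

open Classical in
/-- The number of tables in which two points share a bucket. -/
noncomputable def meetCount (hm : 0 < A.m) (h : Ω → M → U) (ω : Fin (A.G * A.kap) → Ω)
    (q x : M) : ℕ :=
  (Finset.univ.filter fun t => Meets hm h ω q x t).card

variable [LinearOrder U]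

/-- The outcome of all comparisons between labels of data points. -/
def pattern (h : Ω → M → U) (S : Fin A.n ↪ M) (ω : Fin (A.G * A.kap) → Ω) :
    Fin (A.G * A.kap) → Fin A.n → Fin A.n → Bool :=
  fun f x y => decide (h (ω f) (S x) < h (ω f) (S y))

/-- Sorting and equality of concatenated labels depend only on the pairwise comparisons of labels of
data points. One memory image therefore serves all setups with the same pattern, and there are
finitely many patterns. -/
lemma Represents.of_pattern_eq {h : Ω → M → U} {S : Fin A.n ↪ M}
    {ω ω' : Fin (A.G * A.kap) → Ω} (hp : pattern h S ω = pattern h S ω') {I : Image}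
    (hI : A.Represents (fun g x => A.label h ω g (S x)) I) :
    A.Represents (fun g x => A.label h ω' g (S x)) I := by
  have hlt : ∀ f x y, h (ω f) (S x) < h (ω f) (S y) ↔ h (ω' f) (S x) < h (ω' f) (S y) :=
    fun f x y => by simpa [pattern] using congrFun (congrFun (congrFun hp f) x) y
  have heq : ∀ f x y, h (ω f) (S x) = h (ω f) (S y) ↔ h (ω' f) (S x) = h (ω' f) (S y) :=
    fun f x y => by
      simp only [le_antisymm_iff, ← not_lt, hlt]
  have hlex : ∀ g x y, toLex (A.label h ω g (S x)) ≤ toLex (A.label h ω g (S y)) ↔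
      toLex (A.label h ω' g (S x)) ≤ toLex (A.label h ω' g (S y)) := by
    intro g x y
    rw [← not_lt, ← not_lt]
    refine not_congr (toLex_lt_toLex_iff.trans (Iff.trans ?_ toLex_lt_toLex_iff.symm))
    simp only [label, heq, hlt]
  obtain ⟨⟨o, h1, h2⟩, h3⟩ := hI
  refine ⟨⟨o, h1, fun g i j hij => (hlex g _ _).1 (h2 g hij)⟩, fun g x y => (h3 g x y).trans ?_⟩
  simp only [funext_iff, label, heq]

open Classical in
/-- A memory image for given outcomes of the comparisons. -/
noncomputable def pick (hA : A.Ok W) (h : Ω → M → U) (S : Fin A.n ↪ M)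
    (P : Fin (A.G * A.kap) → Fin A.n → Fin A.n → Bool) : Image :=
  if hP : ∃ ω, pattern h S ω = P then
    (exists_image hA fun g x => A.label h hP.choose g (S x)).choose
  else A.image 0 0 fun _ _ => 0

lemma pick_spec (hA : A.Ok W) (h : Ω → M → U) (S : Fin A.n ↪ M) (ω : Fin (A.G * A.kap) → Ω) :
    A.Represents (fun g x => A.label h ω g (S x)) (pick hA h S (pattern h S ω)) ∧
      A.Usable W (pick hA h S (pattern h S ω)) := by
  have hP : ∃ ω', pattern h S ω' = pattern h S ω := ⟨ω, rfl⟩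
  rw [pick, dif_pos hP]
  have := (exists_image hA fun g x => A.label h hP.choose g (S x)).choose_spec
  exact ⟨this.1.of_pattern_eq hP.choose_spec, this.2⟩

section
variable (hA : A.Ok W) {h : Ω → M → U} (S : Fin A.n ↪ M) {ω : Fin (A.G * A.kap) → Ω}

lemma pick_n : (pick hA h S (pattern h S ω)).n = A.n := by
  obtain ⟨p, alpha, T, hp, hp2, hI⟩ := (pick_spec hA h S ω).2.shape
  rw [hI]; rfl

lemma pick_L : (pick hA h S (pattern h S ω)).L = A.L := by
  obtain ⟨p, alpha, T, hp, hp2, hI⟩ := (pick_spec hA h S ω).2.shape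
  rw [hI]; rfl

lemma pick_X : (pick hA h S (pattern h S ω)).X = A.X := by
  obtain ⟨p, alpha, T, hp, hp2, hI⟩ := (pick_spec hA h S ω).2.shape
  rw [hI]; rfl

/-- The number of steps of a query before sampling starts. -/
def prepSteps (A : Params) : ℕ :=
  A.G * (A.n.size * (A.kap * 14 + 61) + 40) + A.L * 350 + 200

lemma pick_prepSteps : (pick hA h S (pattern h S ω)).prepSteps = A.prepSteps := by
  obtain ⟨p, alpha, T, hp, hp2, hI⟩ := (pick_spec hA h S ω).2.shape
  rw [hI]; rfl

end

lemma Usable.valid (hA : A.Ok W) {lab : Fin A.G → Fin A.n → Fin A.kap → U} {I : Image}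
    (hR : A.Represents lab I) (hU : A.Usable W I) {E : Env} (hW : E.W = W)
    (hs : E.size = 17 * A.X) {qlab : Fin A.G → Fin A.kap → U}
    (hc : ∀ g (x : Fin A.n), Compares (fun j => E.hash j x) (g.val * A.kap) (qlab g) (lab g x)) :
    I.Valid E := by
  obtain ⟨p, alpha, T, hp, hp2, hI⟩ := hU.shape
  have hIn : I.n = A.n := by rw [hI]; rfl
  have hIk : I.kap = A.kap := by rw [hI]; rfl
  have hIG : I.G = A.G := by rw [hI]; rfl
  obtain ⟨o, ho, hmono⟩ := hR.ord
  have hcm : ∀ g x, I.cm E g x = lexCmp (fun j => E.hash j x) (g * A.kap) A.kap := fun g x => by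
    rw [Image.cm, hIk]
  refine ⟨hI ▸ hA.fits hW hs hp hp2 alpha T, hU.header, ?_, hU.dict E hW⟩
  constructor
  · rw [hIG, hIn]
    intro g hg x hx
    rw [hcm]
    exact (hc ⟨g, hg⟩ ⟨x, hx⟩).lexCmp_le
  · rw [hIG, hIn]
    intro g hg i hi
    rw [ho ⟨g, hg⟩ ⟨i, hi⟩]
    exact Fin.isLt _
  · rw [hIG, hIn]
    intro g hg x hx
    refine ⟨((o ⟨g, hg⟩).symm ⟨x, hx⟩).val, Fin.isLt _, ?_⟩
    rw [ho ⟨g, hg⟩, Equiv.apply_symm_apply]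
  · rw [hIG, hIn]
    intro g hg i j hij hj
    have hi : i < A.n := by omega
    rw [ho ⟨g, hg⟩ ⟨i, hi⟩, ho ⟨g, hg⟩ ⟨j, hj⟩, hcm, hcm, (hc ⟨g, hg⟩ _).lexCmp_one,
      (hc ⟨g, hg⟩ _).lexCmp_one]
    intro h
    exact h.trans_le (hmono ⟨g, hg⟩ (show (⟨i, hi⟩ : Fin A.n) ≤ ⟨j, hj⟩ from hij))
  · rw [hIG, hIn]
    intro g hg i j hij hj
    have hi : i < A.n := by omega
    rw [ho ⟨g, hg⟩ ⟨i, hi⟩, ho ⟨g, hg⟩ ⟨j, hj⟩, hcm, hcm, (hc ⟨g, hg⟩ _).lexCmp_two,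
      (hc ⟨g, hg⟩ _).lexCmp_two]
    intro h
    exact lt_of_le_of_lt (hmono ⟨g, hg⟩ (show (⟨i, hi⟩ : Fin A.n) ≤ ⟨j, hj⟩ from hij)) h
  · rw [hIG, hIn]
    exact fun g _ x _ => hU.gid_lt _
  · rw [hIG, hIn]
    intro g hg x hx y hy
    rw [hcm, hcm, hR.gid ⟨g, hg⟩ ⟨y, hy⟩ ⟨x, hx⟩]
    rw [(hc ⟨g, hg⟩ ⟨x, hx⟩).lexCmp_zero, (hc ⟨g, hg⟩ ⟨y, hy⟩).lexCmp_zero]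
    intro h
    rw [h, eq_comm]

variable [MeasurableSpace Ω]

lemma measurable_pattern {h : Ω → M → U} (hh : ∀ x y, MeasurableSet {ω | h ω x < h ω y})
    (S : Fin A.n ↪ M) : Measurable (pattern (A := A) h S) := by
  refine measurable_pi_iff.2 fun f => measurable_pi_iff.2 fun x => measurable_pi_iff.2 fun y => ?_
  have : MeasurableSet {ω : Fin (A.G * A.kap) → Ω | h (ω f) (S x) < h (ω f) (S y)} :=
    have hf : Measurable fun ω : Fin (A.G * A.kap) → Ω => ω f := measurable_pi_apply f
    hf (hh (S x) (S y))
  refine measurable_to_bool ?_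
  convert this using 1
  ext ω
  simp [pattern]

/-- The data structure. -/
noncomputable def dataStructure (hA : A.Ok W) {h : Ω → M → U}
    (hh : ∀ x y, MeasurableSet {ω | h ω x < h ω y}) (S : Fin A.n ↪ M) : DataStructure Ω W where
  funs := A.G * A.kap
  tables := A.L
  parts t := Finset.univ.filter fun f => (finProdFinEquiv.symm f).1 = firstHalf hA.m_pos t ∨
    (finProdFinEquiv.symm f).1 = secondHalf hA.m_pos t
  size := 17 * A.X
  init ω a := if a.val % 17 < 12 then (pick hA h S (pattern h S ω)).T (a.val % 17) (a.val / 17)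
    else 0
  measurable_init := by
    -- Patterns form a finite discrete space, so an arbitrary choice of images is measurable in the
    -- pattern.
    have : Measurable fun P => fun a : Fin (17 * A.X) => if a.val % 17 < 12 then
        (pick hA h S P).T (a.val % 17) (a.val / 17) else 0 := measurable_of_countable _
    exact this.comp (measurable_pattern hh S)
  init_lt ω a := by
    split_ifs
    · exact ((pick_spec hA h S ω).2.dict ⟨W, 0, 0, fun _ => 0, fun _ _ => 0⟩ rfl).T_lt _ _
    · have := hA.n_pos
      have := hA.Z
      omega

lemma mem_parts (hA : A.Ok W) {h : Ω → M → U}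
    (hh : ∀ x y, MeasurableSet {ω | h ω x < h ω y}) (S : Fin A.n ↪ M) {t : Fin A.L} {j : Fin (A.G * A.kap)} : j ∈ (dataStructure hA hh S).parts t ↔
    (finProdFinEquiv.symm j).1 = firstHalf hA.m_pos t ∨
      (finProdFinEquiv.symm j).1 = secondHalf hA.m_pos t := by
  simp only [dataStructure]
  exact Finset.mem_filter_univ _

section
variable [MetricSpace M] (hA : A.Ok W) {h : Ω → M → U}
  (hh : ∀ x y, MeasurableSet {ω | h ω x < h ω y}) (S : Fin A.n ↪ M)

open Classical in
/-- The near data points that share a bucket with the query. -/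
noncomputable def foundPoints (hm : 0 < A.m) (h : Ω → M → U) (S : Fin A.n ↪ M) (r : ℝ)
    (ω : Fin (A.G * A.kap) → Ω) (q : M) : Finset (Fin A.n) :=
  (nbhd S q r).filter fun i => ∃ t, Meets hm h ω q (S i) t

omit [MetricSpace M] in
lemma mem_candidates {ω : Fin (A.G * A.kap) → Ω} {q : M} {i : Fin A.n} :
    i ∈ candidates (dataStructure hA hh S) h S ω q ↔ ∃ t, Meets hA.m_pos h ω q (S i) t := by
  refine exists_congr fun t => ?_
  constructor
  · intro H
    exact ⟨funext fun l => (H _ ((mem_parts hA hh S).2 (Or.inl (by simp)))).symm,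
      funext fun l => (H _ ((mem_parts hA hh S).2 (Or.inr (by simp)))).symm⟩
  · rintro ⟨h1, h2⟩ (j : Fin (A.G * A.kap)) hj
    obtain ⟨⟨g, l⟩, rfl⟩ := finProdFinEquiv.surjective j
    rcases (mem_parts hA hh S).1 hj with hj | hj
    · rw [Equiv.symm_apply_apply] at hj
      subst hj
      exact (congrFun h1 l).symm
    · rw [Equiv.symm_apply_apply] at hj
      subst hj
      exact (congrFun h2 l).symm

lemma covered_iff {r : ℝ} {ω : Fin (A.G * A.kap) → Ω} {q : M} :
    Covered (dataStructure hA hh S) h S r ω q ↔ foundPoints hA.m_pos h S r ω q = nbhd S q r := by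
  classical
  rw [foundPoints, Finset.filter_eq_self]
  exact forall₂_congr fun i _ => mem_candidates hA hh S

variable {r : ℝ} {d : ℕ} {ω : Fin (A.G * A.kap) → Ω} {q : M}

lemma compares_queryEnv (g : Fin A.G) (x : Fin A.n) :
    Compares (fun j => (queryEnv (dataStructure hA hh S) h S r d ω q).hash j x) (g.val * A.kap)
      (A.label h ω g q) (A.label h ω g (S x)) := by
  intro l
  have h1 : (finProdFinEquiv (g, l)).val = g * A.kap + l := by
    simp [finProdFinEquiv, mul_comm, add_comm]
  have h2 : g * A.kap + l < A.G * A.kap := h1 ▸ (finProdFinEquiv (g, l)).2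
  have h3 : (⟨g * A.kap + l, h2⟩ : Fin (A.G * A.kap)) = finProdFinEquiv (g, l) := Fin.ext h1.symm
  have h4 : g.val * A.kap + l < (dataStructure hA hh S).funs := h2
  simp only [queryEnv, dif_pos h4, x.2, dif_pos, label]
  change (if h (ω ⟨g * A.kap + l, h2⟩) q < h (ω ⟨g * A.kap + l, h2⟩) (S x) then 1 else
    if h (ω ⟨g * A.kap + l, h2⟩) (S x) < h (ω ⟨g * A.kap + l, h2⟩) q then 2 else 0) = _
  rw [h3]
  rfl

lemma valid_queryEnv :
    (pick hA h S (pattern h S ω)).Valid (queryEnv (dataStructure hA hh S) h S r d ω q) :=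
  have := pick_spec hA h S ω
  Usable.valid hA this.1 this.2 rfl rfl (compares_queryEnv hA hh S)

lemma same_iff (t : Fin A.L) (x : Fin A.n) :
    (pick hA h S (pattern h S ω)).Same (queryEnv (dataStructure hA hh S) h S r d ω q) t x ↔
      Meets hA.m_pos h ω q (S x) t := by
  have hU := (pick_spec hA h S ω).2
  obtain ⟨p, alpha, T, hp, hp2, hI⟩ := hU.shape
  have hk : (pick hA h S (pattern h S ω)).kap = A.kap := by rw [hI]; rfl
  rw [Image.Same, hU.ga t t.2, hU.gb t t.2, Image.cm, Image.cm, hk]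
  exact and_congr (compares_queryEnv hA hh S (firstHalf hA.m_pos t) x).lexCmp_zero
    (compares_queryEnv hA hh S (secondHalf hA.m_pos t) x).lexCmp_zero

lemma multiplicity_eq (x : Fin A.n) : (pick hA h S (pattern h S ω)).multiplicity
    (queryEnv (dataStructure hA hh S) h S r d ω q) x = meetCount hA.m_pos h ω q (S x) := by
  classical
  rw [Image.multiplicity, meetCount, pick_L, ← Finset.card_map Fin.valEmbedding]
  congr 1
  ext t
  simp only [Finset.mem_filter, Finset.mem_range, Finset.mem_map, Finset.mem_univ, true_and,
    Fin.valEmbedding_apply]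
  constructor
  · rintro ⟨ht, h1⟩
    exact ⟨⟨t, ht⟩, (same_iff hA hh S ⟨t, ht⟩ x).1 h1, rfl⟩
  · rintro ⟨t, h1, rfl⟩
    exact ⟨t.2, (same_iff hA hh S t x).2 h1⟩

lemma found_eq : (pick hA h S (pattern h S ω)).found
    (queryEnv (dataStructure hA hh S) h S r d ω q) =
      (foundPoints hA.m_pos h S r ω q).map Fin.valEmbedding := by
  classical
  ext x
  simp only [Image.found, Finset.mem_filter, Finset.mem_range, pick_n, pick_L, Finset.mem_map,
    foundPoints, nbhd, Finset.mem_univ, true_and, Fin.valEmbedding_apply]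
  constructor
  · rintro ⟨hx, h1, t, ht, h2⟩
    refine ⟨⟨x, hx⟩, ⟨?_, ⟨t, ht⟩, (same_iff hA hh S ⟨t, ht⟩ ⟨x, hx⟩).1 h2⟩, rfl⟩
    by_contra h3
    simp [queryEnv, h3] at h1
  · rintro ⟨i, ⟨h1, t, h2⟩, rfl⟩
    exact ⟨i.2, by simp [queryEnv, h1], t, t.2, (same_iff hA hh S t i).2 h2⟩

omit [MetricSpace M] in
lemma queryStart_mem (P : Cmd) : ∀ r < 12, ∀ i < (pick hA h S (pattern h S ω)).X,
    arr (queryStart (dataStructure hA hh S) P ω).2 r i = (pick hA h S (pattern h S ω)).T r i := by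
  rw [pick_X]
  intro r hr i hi
  have h1 : 17 * i + r < (dataStructure hA hh S).size := by
    change 17 * i + r < 17 * A.X
    omega
  have h2 : (17 * i + r) % 17 = r := by omega
  have h3 : (17 * i + r) / 17 = i := by omega
  simp only [arr, queryStart, dif_pos h1]
  simp only [dataStructure, h2, h3, if_pos hr]

lemma ansLaw_eq (a : Answer A.n) : ansLaw (dataStructure hA hh S) queryCmd h S r ω q a =
    ENNReal.ofReal (fairOn A.n ((foundPoints hA.m_pos h S r ω q).map Fin.valEmbedding) a) := by
  rw [← found_eq hA hh S (d := 1)]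
  have hn := pick_n hA (h := h) S (ω := ω)
  have := ansProb_query (valid_queryEnv hA hh S (r := r) (d := 1) (ω := ω) (q := q)) le_rfl
    (queryStart_mem hA hh S queryCmd)
  revert this
  rw [hn]
  exact fun this => this a

lemma sum_ansLaw :
    ∑ a, ansLaw (dataStructure hA hh S) queryCmd h S r ω q a = 1 := by
  simp only [ansLaw_eq]
  rw [← ENNReal.ofReal_sum_of_nonneg fun a _ => fairOn_nonneg _ _ a, sum_fairOn, ENNReal.ofReal_one]
  intro x hx
  obtain ⟨i, _, rfl⟩ := Finset.mem_map.1 hx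
  exact Finset.mem_range.2 i.2

lemma fairLaw_eq (a : Answer A.n) : fairLaw S r q a =
    ENNReal.ofReal (fairOn A.n ((nbhd S q r).map Fin.valEmbedding) a) := by
  classical
  rw [fairLaw]
  split_ifs with hne
  · rw [PMF.map_apply]
    rcases a with _ | i
    · simp [fairOn, Finset.map_eq_empty, hne.ne_empty]
    · rw [tsum_eq_single i]
      · have h0 : ((nbhd S q r).card : ℝ) ≠ 0 := by
          exact_mod_cast (Finset.card_pos.2 hne).ne'
        simp only [if_true, PMF.uniformOfFinset_apply, fairOn, Finset.card_map]
        by_cases hi : i ∈ nbhd S q r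
        · have : i.val ∈ (nbhd S q r).map Fin.valEmbedding :=
            Finset.mem_map.2 ⟨i, hi, rfl⟩
          rw [if_pos hi, if_pos this, one_div, ENNReal.ofReal_inv_of_pos (by positivity),
            ENNReal.ofReal_natCast]
        · have : i.val ∉ (nbhd S q r).map Fin.valEmbedding := by
            simpa [Fin.val_inj] using hi
          rw [if_neg hi, if_neg this, ENNReal.ofReal_zero]
      · intro j hj
        simp [hj.symm]
  · rw [Finset.not_nonempty_iff_eq_empty] at hne
    rcases a with _ | i <;> simp [fairOn, hne, PMF.pure_apply]

/-- The right-hand side does not involve `ω`: as long as queries are covered, the answers reveal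
nothing about the setup. -/
lemma ansLaw_of_covered (hc : Covered (dataStructure hA hh S) h S r ω q) (a : Answer A.n) :
    ansLaw (dataStructure hA hh S) queryCmd h S r ω q a = fairLaw S r q a := by
  rw [ansLaw_eq, fairLaw_eq, (covered_iff hA hh S).1 hc]

lemma queryTime_le (hd : 1 ≤ d) :
    queryTime (dataStructure hA hh S) queryCmd h S r d ω q ≤ ENNReal.ofReal
      (d * (A.prepSteps + 1 + 300 * ((2 * (∑ x, meetCount hA.m_pos h ω q (S x) : ℕ) +
        A.L) / (max (foundPoints hA.m_pos h S r ω q).card 1 : ℕ) + A.L))) := by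
  refine (expTime_query (valid_queryEnv hA hh S (r := r) (d := d) (ω := ω) (q := q)) hd
    (queryStart_mem hA hh S queryCmd)).trans_eq ?_
  rw [found_eq, pick_prepSteps, pick_L, pick_n, Finset.card_map,
    ← Fin.sum_univ_eq_sum_range]
  simp only [multiplicity_eq]
  rfl

end

end Params

end FairANN
namespace FairANN

/-! ### The game against an adaptive adversary -/

/-- The integral of a nonnegative function is superadditive even without measurability. Lower bounds
for the game thus need no measurability of the law of the answers in `ω`. -/
lemma sum_lintegral_le {Ω ι : Type*} [MeasurableSpace Ω] (μ : Measure Ω) (s : Finset ι)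
    (f : ι → Ω → ℝ≥0∞) : ∑ i ∈ s, ∫⁻ ω, f i ω ∂μ ≤ ∫⁻ ω, ∑ i ∈ s, f i ω ∂μ := by
  classical
  induction s using Finset.induction_on with
  | empty => simp
  | insert i s hi ih =>
    simp only [Finset.sum_insert hi]
    exact (add_le_add le_rfl ih).trans (le_lintegral_add _ _)

/-! ### The game for one fixed outcome of the setup -/

section
variable {M : Type*} {n : ℕ} {law fair : M → Answer n → ℝ≥0∞} {B : Adversary M n}

lemma expAtRound_mono (law : M → Answer n → ℝ≥0∞) (B : Adversary M n) {f g : M → ℝ≥0∞}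
    (hfg : ∀ q, f q ≤ g q) (k : ℕ) (H : List (M × Answer n)) :
    expAtRound law B f k H ≤ expAtRound law B g k H := by
  induction k generalizing H with
  | zero => exact hfg _
  | succ k ih => exact Finset.sum_le_sum fun a _ => by gcongr; exact ih _

lemma expAtRound_add (law : M → Answer n → ℝ≥0∞) (B : Adversary M n) (f g : M → ℝ≥0∞)
    (k : ℕ) (H : List (M × Answer n)) :
    expAtRound law B (fun q => f q + g q) k H =
      expAtRound law B f k H + expAtRound law B g k H := by
  induction k generalizing H with
  | zero => rfl
  | succ k ih => simp only [expAtRound, ih, mul_add, Finset.sum_add_distrib]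

lemma expAtRound_const_mul (law : M → Answer n → ℝ≥0∞) (B : Adversary M n) (c : ℝ≥0∞)
    (f : M → ℝ≥0∞) (k : ℕ) (H : List (M × Answer n)) :
    expAtRound law B (fun q => c * f q) k H = c * expAtRound law B f k H := by
  induction k generalizing H with
  | zero => rfl
  | succ k ih => simp only [expAtRound, ih, Finset.mul_sum, mul_left_comm]

lemma expAtRound_const (hlaw : ∀ q, ∑ a, law q a = 1) (B : Adversary M n) (c : ℝ≥0∞) (k : ℕ)
    (H : List (M × Answer n)) : expAtRound law B (fun _ => c) k H = c := by
  induction k generalizing H with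
  | zero => rfl
  | succ k ih => simp only [expAtRound, ih, ← Finset.sum_mul, hlaw, one_mul]

open Classical in
-- The real and the fair game agree until the first query that is not good. From then on the value
-- is at most `c`, and the last sum, the expected number of such queries in the first `k` rounds of
-- the fair game, is at least the probability that one occurs.
lemma expAtRound_le_fair (hlaw : ∀ q, ∑ a, law q a = 1) {good : M → Prop}
    (hgood : ∀ q, good q → ∀ a, law q a = fair q a) {f : M → ℝ≥0∞} {c : ℝ≥0∞}
    (hf : ∀ q, f q ≤ c) (k : ℕ) (H : List (M × Answer n)) :
    expAtRound law B f k H ≤ expAtRound fair B f k H + c * ∑ j ∈ Finset.range k,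
      expAtRound fair B (fun q => if good q then 0 else 1) j H := by
  induction k generalizing H with
  | zero => simp [expAtRound]
  | succ k ih =>
    by_cases hg : good (B H)
    · calc expAtRound law B f (k + 1) H
          ≤ ∑ a, fair (B H) a * (expAtRound fair B f k (H ++ [(B H, a)]) +
            c * ∑ j ∈ Finset.range k, expAtRound fair B (fun q => if good q then 0 else 1) j
              (H ++ [(B H, a)])) :=
            Finset.sum_le_sum fun a _ => by rw [hgood _ hg]; gcongr; exact ih _
        _ = expAtRound fair B f (k + 1) H + c * ∑ j ∈ Finset.range k,
            expAtRound fair B (fun q => if good q then 0 else 1) (j + 1) H := by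
            simp only [mul_add, Finset.sum_add_distrib, expAtRound]
            congr 1
            simp only [Finset.mul_sum]
            rw [Finset.sum_comm]
            exact Finset.sum_congr rfl fun j _ => Finset.sum_congr rfl fun a _ => by ring
        _ ≤ _ := by
            rw [Finset.sum_range_succ']
            gcongr
            exact le_self_add
    · calc expAtRound law B f (k + 1) H ≤ expAtRound law B (fun _ => c) (k + 1) H :=
            expAtRound_mono law B hf _ _
        _ = c * 1 := by rw [expAtRound_const hlaw, mul_one]
        _ ≤ _ := by
            rw [Finset.sum_range_succ']
            refine le_add_left ?_
            gcongr
            refine le_add_left ?_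
            simp [expAtRound, hg]

end

/-! ### The game averaged over the setup randomness -/

section
variable {M Ω : Type*} [MeasurableSpace Ω] {n : ℕ} {ν : Measure Ω}
  {law : Ω → M → Answer n → ℝ≥0∞} {fair : M → Answer n → ℝ≥0∞} {B : Adversary M n}
  {good : Ω → M → Prop} {ε : ℝ≥0∞}

lemma measurable_expAtRound (fair : M → Answer n → ℝ≥0∞) (B : Adversary M n)
    {F : Ω → M → ℝ≥0∞} (hF : ∀ q, Measurable fun ω => F ω q) (k : ℕ) (H : List (M × Answer n)) :
    Measurable fun ω => expAtRound fair B (F ω) k H := by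
  induction k generalizing H with
  | zero => exact hF _
  | succ k ih => exact Finset.measurable_fun_sum _ fun a _ => (ih _).const_mul _

lemma lintegral_expAtRound (ν : Measure Ω) (fair : M → Answer n → ℝ≥0∞) (B : Adversary M n)
    {F : Ω → M → ℝ≥0∞} (hF : ∀ q, Measurable fun ω => F ω q) (k : ℕ) (H : List (M × Answer n)) :
    ∫⁻ ω, expAtRound fair B (F ω) k H ∂ν = expAtRound fair B (fun q => ∫⁻ ω, F ω q ∂ν) k H := by
  induction k generalizing H with
  | zero => rfl
  | succ k ih =>
    simp only [expAtRound]
    rw [lintegral_finsetSum _ fun a _ => (measurable_expAtRound fair B hF k _).const_mul _]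
    refine Finset.sum_congr rfl fun a _ => ?_
    rw [lintegral_const_mul _ (measurable_expAtRound fair B hF k _), ih]

lemma measure_sub_le_inter (hmeas : ∀ q, MeasurableSet {ω | good ω q})
    (hε : ∀ q, ν {ω | ¬ good ω q} ≤ ε) (A : Set Ω) (k : ℕ) (q : M) :
    ν A - (k + 1 : ℕ) * ε ≤ ν (A ∩ {ω | good ω q}) - k * ε := by
  rw [tsub_le_iff_right]
  calc ν A ≤ ν (A ∩ {ω | good ω q}) + ν (A \ {ω | good ω q}) :=
        (measure_inter_add_sdiff A (hmeas q)).ge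
    _ ≤ ν (A ∩ {ω | good ω q}) + ε := by
        gcongr
        exact (measure_mono fun ω hω => hω.2).trans (hε q)
    _ ≤ ν (A ∩ {ω | good ω q}) - k * ε + k * ε + ε := by gcongr; exact le_tsub_add
    _ = _ := by push_cast; ring

/-- For a fixed history the next query is a fixed point, so its failure set has measure at most `ε`
although the adversary is adaptive. The set `A` stands for the setups for which all former queries
of this history are good; carrying it through the induction replaces conditioning on the history. -/
lemma le_setLIntegral_round (hmeas : ∀ q, MeasurableSet {ω | good ω q})
    (hε : ∀ q, ν {ω | ¬ good ω q} ≤ ε) {A : Set Ω} (hA : MeasurableSet A) (k : ℕ) (q : M)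
    {V : Answer n → Ω → ℝ≥0∞} {v : Answer n → ℝ≥0∞}
    (hV : ∀ a, ∀ A : Set Ω, MeasurableSet A → (ν A - k * ε) * v a ≤ ∫⁻ ω in A, V a ω ∂ν)
    {F : Ω → ℝ≥0∞} (hF : ∀ ω, good ω q → ∑ a, fair q a * V a ω ≤ F ω) :
    (ν A - (k + 1 : ℕ) * ε) * ∑ a, fair q a * v a ≤ ∫⁻ ω in A, F ω ∂ν := by
  have hA' : MeasurableSet (A ∩ {ω | good ω q}) := hA.inter (hmeas q)
  calc (ν A - (k + 1 : ℕ) * ε) * ∑ a, fair q a * v a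
      ≤ (ν (A ∩ {ω | good ω q}) - k * ε) * ∑ a, fair q a * v a :=
        mul_le_mul' (by exact_mod_cast measure_sub_le_inter hmeas hε A k q) le_rfl
    _ = ∑ a, fair q a * ((ν (A ∩ {ω | good ω q}) - k * ε) * v a) := by
        rw [Finset.mul_sum]
        exact Finset.sum_congr rfl fun a _ => by ring
    _ ≤ ∑ a, ∫⁻ ω in A ∩ {ω | good ω q}, fair q a * V a ω ∂ν := by
        refine Finset.sum_le_sum fun a _ => ?_
        refine le_trans ?_ (lintegral_const_mul_le _ _)
        gcongr
        exact hV a _ hA'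
    _ ≤ ∫⁻ ω in A ∩ {ω | good ω q}, ∑ a, fair q a * V a ω ∂ν := sum_lintegral_le _ _ _
    _ ≤ ∫⁻ ω in A ∩ {ω | good ω q}, F ω ∂ν := setLIntegral_mono' hA' fun ω hω => hF ω hω.2
    _ ≤ ∫⁻ ω in A, F ω ∂ν := lintegral_mono_set Set.inter_subset_left

/-- Each history loses at most `k * ε` of the mass of `A`, the same amount for all histories, so the
loss factors out of the expectation over the fair transcript. -/
lemma le_setLIntegral_expAtRound (hmeas : ∀ q, MeasurableSet {ω | good ω q})
    (hε : ∀ q, ν {ω | ¬ good ω q} ≤ ε)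
    (hgood : ∀ ω q, good ω q → ∀ a, law ω q a = fair q a) (g : M → ℝ≥0∞) (k : ℕ)
    (H : List (M × Answer n)) {A : Set Ω} (hA : MeasurableSet A) :
    (ν A - k * ε) * expAtRound fair B g k H ≤ ∫⁻ ω in A, expAtRound (law ω) B g k H ∂ν := by
  induction k generalizing H A with
  | zero => simp [expAtRound, mul_comm]
  | succ k ih =>
    refine le_setLIntegral_round hmeas hε hA k (B H) (fun a A hA => ih (H ++ [(B H, a)]) hA)
      fun ω hω => ?_
    simp only [expAtRound, hgood ω _ hω, le_refl]

lemma le_setLIntegral_winProb (hmeas : ∀ q, MeasurableSet {ω | good ω q})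
    (hε : ∀ q, ν {ω | ¬ good ω q} ≤ ε)
    (hgood : ∀ ω q, good ω q → ∀ a, law ω q a = fair q a) (hfair : ∀ q, ∑ a, fair q a = 1)
    {ok : Ω → M → Answer n → Prop}
    (hok : ∀ ω q, good ω q → ∀ a, fair q a ≠ 0 → ok ω q a) (k : ℕ)
    (H : List (M × Answer n)) {A : Set Ω} (hA : MeasurableSet A) :
    ν A - k * ε ≤ ∫⁻ ω in A, winProb (law ω) B (ok ω) k H ∂ν := by
  classical
  induction k generalizing H A with
  | zero => simp [winProb]
  | succ k ih =>
    have := le_setLIntegral_round (fair := fair) (v := fun _ => 1)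
      (F := fun ω => winProb (law ω) B (ok ω) (k + 1) H) hmeas hε hA k (B H)
      (V := fun a ω => winProb (law ω) B (ok ω) k (H ++ [(B H, a)]))
      (fun a A hA => by rw [mul_one]; exact ih (H ++ [(B H, a)]) hA) fun ω hω => ?_
    · simpa only [mul_one, hfair] using this
    · simp only [winProb]
      refine Finset.sum_le_sum fun a _ => ?_
      by_cases h0 : fair (B H) a = 0
      · simp [h0]
      · rw [if_pos (hok ω _ hω a h0), hgood ω _ hω]

end

end FairANN
namespace FairANN

/-! ### Collision probabilities -/

namespace Params
variable {A : Params} {M Ω U : Type*} [MeasurableSpace Ω] {μ : Measure Ω} [IsProbabilityMeasure μ]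

/-- The hash functions of a half table. -/
def half (A : Params) (ω : Fin (A.G * A.kap) → Ω) (g : Fin A.G) : Fin A.kap → Ω :=
  fun l => ω (finProdFinEquiv (g, l))

/-- Distinct half tables use disjoint blocks of hash functions. Regrouping the product measure into
these blocks makes them independent and identically distributed. -/
lemma measure_halves (s : Finset (Fin A.G)) {V : Set (Fin A.kap → Ω)} (hV : MeasurableSet V) :
    (Measure.pi fun _ : Fin (A.G * A.kap) => μ) {ω | ∀ g ∈ s, A.half ω g ∈ V} =
      (Measure.pi fun _ : Fin A.kap => μ) V ^ s.card := by
  classical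
  let u : (Fin A.G → Fin A.kap → Ω) → Fin (A.G * A.kap) → Ω := fun η f =>
    η (finProdFinEquiv.symm f).1 (finProdFinEquiv.symm f).2
  have hu : Measurable u := measurable_pi_iff.2 fun f =>
    (measurable_pi_apply _).comp (measurable_pi_apply _)
  have hmap : (Measure.pi fun _ : Fin (A.G * A.kap) => μ) =
      (Measure.pi fun _ : Fin A.G => Measure.pi fun _ : Fin A.kap => μ).map u := by
    refine Measure.pi_eq fun E hE => ?_
    rw [Measure.map_apply hu (MeasurableSet.univ_pi hE)]
    have : u ⁻¹' Set.univ.pi E = Set.univ.pi fun g => Set.univ.pi fun l =>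
        E (finProdFinEquiv (g, l)) := by
      ext η
      simp only [Set.mem_preimage, Set.mem_univ_pi, u]
      exact ⟨fun H g l => by simpa using H (finProdFinEquiv (g, l)),
        fun H f => by
          have := H (finProdFinEquiv.symm f).1 (finProdFinEquiv.symm f).2
          rwa [Prod.mk.eta, Equiv.apply_symm_apply] at this⟩
    rw [this, Measure.pi_pi]
    simp only [Measure.pi_pi]
    rw [← Fintype.prod_prod_type', ← finProdFinEquiv.prod_comp]
  have hset : MeasurableSet {ω : Fin (A.G * A.kap) → Ω | ∀ g ∈ s, A.half ω g ∈ V} := by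
    have : {ω : Fin (A.G * A.kap) → Ω | ∀ g ∈ s, A.half ω g ∈ V} =
        ⋂ g ∈ s, (fun ω => A.half ω g) ⁻¹' V := by ext; simp
    rw [this]
    exact Finset.measurableSet_biInter _ fun g _ =>
      (measurable_pi_iff.2 fun l => measurable_pi_apply _) hV
  rw [hmap, Measure.map_apply hu hset]
  have : u ⁻¹' {ω | ∀ g ∈ s, A.half ω g ∈ V} =
      Set.univ.pi fun g => if g ∈ s then V else Set.univ := by
    ext η
    have : ∀ g, A.half (u η) g = η g := fun g => funext fun l => by
      show η (finProdFinEquiv.symm (finProdFinEquiv (g, l))).1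
        (finProdFinEquiv.symm (finProdFinEquiv (g, l))).2 = η g l
      rw [Equiv.symm_apply_apply]
    simp only [Set.mem_preimage, Set.mem_ofPred_eq, this, Set.mem_univ_pi]
    exact forall_congr' fun g => by split_ifs with h <;> simp [h]
  rw [this, Measure.pi_pi]
  simp only [apply_ite (Measure.pi fun _ : Fin A.kap => μ), measure_univ]
  rw [Finset.prod_ite]
  simp

variable [LinearOrder U] {h : Ω → M → U}

lemma measurableSet_eq (hh : ∀ x y, MeasurableSet {ω | h ω x < h ω y}) (x y : M) :
    MeasurableSet {ω | h ω x = h ω y} := by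
  have : {ω | h ω x = h ω y} = ({ω | h ω x < h ω y} ∪ {ω | h ω y < h ω x})ᶜ := by
    ext ω
    simp only [Set.mem_ofPred_eq, Set.mem_compl_iff, Set.mem_union, not_or, not_lt]
    exact le_antisymm_iff.trans and_comm
  rw [this]
  exact ((hh x y).union (hh y x)).compl

/-- The choices of `kap` hash functions that do not distinguish `x` and `y`. -/
def agree (h : Ω → M → U) (k : ℕ) (x y : M) : Set (Fin k → Ω) :=
  Set.univ.pi fun _ => {ω | h ω x = h ω y}

lemma measurableSet_agree (hh : ∀ x y, MeasurableSet {ω | h ω x < h ω y}) (k : ℕ) (x y : M) :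
    MeasurableSet (agree h k x y) := MeasurableSet.univ_pi fun _ => measurableSet_eq hh x y

omit [LinearOrder U] in
lemma measure_agree (k : ℕ) (x y : M) : (Measure.pi fun _ : Fin k => μ) (agree h k x y) =
    ENNReal.ofReal (μ.real {ω | h ω x = h ω y} ^ k) := by
  rw [agree, Measure.pi_pi, Finset.prod_const, Finset.card_univ, Fintype.card_fin,
    ENNReal.ofReal_pow measureReal_nonneg, ofReal_measureReal]

omit [MeasurableSpace Ω] [LinearOrder U] in
lemma label_eq_iff {ω : Fin (A.G * A.kap) → Ω} {g : Fin A.G} {x y : M} :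
    A.label h ω g x = A.label h ω g y ↔ A.half ω g ∈ agree h A.kap x y := by
  rw [funext_iff, agree, Set.mem_univ_pi]
  rfl

lemma first_ne_second (hm : 0 < A.m) (t : Fin A.L) : firstHalf hm t ≠ secondHalf hm t := by
  intro H
  have h1 := congrArg Fin.val H
  have h2 := Nat.mod_lt (t / A.m) hm
  simp only [firstHalf, secondHalf, ga, gb] at h1
  omega

omit [MeasurableSpace Ω] [LinearOrder U] in
lemma meets_iff {hm : 0 < A.m} {ω : Fin (A.G * A.kap) → Ω} {q x : M} {t : Fin A.L} :
    Meets hm h ω q x t ↔ ∀ g ∈ ({firstHalf hm t, secondHalf hm t} : Finset (Fin A.G)),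
      A.half ω g ∈ agree h A.kap q x := by
  simp [Meets, label_eq_iff]

lemma measurableSet_meets (hm : 0 < A.m) (hh : ∀ x y, MeasurableSet {ω | h ω x < h ω y})
    (q x : M) (t : Fin A.L) : MeasurableSet {ω | Meets hm h ω q x t} := by
  have hg : ∀ g : Fin A.G, MeasurableSet {ω | A.half ω g ∈ agree h A.kap q x} := fun g =>
    (measurable_pi_iff.2 fun l => measurable_pi_apply _ : Measurable fun ω => A.half ω g)
      (measurableSet_agree hh A.kap q x)
  have : {ω | Meets hm h ω q x t} = {ω | A.half ω (firstHalf hm t) ∈ agree h A.kap q x} ∩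
      {ω | A.half ω (secondHalf hm t) ∈ agree h A.kap q x} := by
    ext ω
    simp [Meets, label_eq_iff]
  rw [this]
  exact (hg _).inter (hg _)

lemma measure_meets (hm : 0 < A.m) (hh : ∀ x y, MeasurableSet {ω | h ω x < h ω y})
    (q x : M) (t : Fin A.L) : (Measure.pi fun _ => μ) {ω | Meets hm h ω q x t} =
      ENNReal.ofReal ((μ.real {ω | h ω q = h ω x} ^ A.kap) ^ 2) := by
  simp only [meets_iff]
  rw [measure_halves _ (measurableSet_agree hh A.kap q x), measure_agree,
    Finset.card_pair (first_ne_second hm t),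
    ← ENNReal.ofReal_pow (pow_nonneg measureReal_nonneg _)]

lemma measurable_meetCount (hm : 0 < A.m) (hh : ∀ x y, MeasurableSet {ω | h ω x < h ω y})
    (q x : M) : Measurable fun ω => (meetCount hm h ω q x : ℝ≥0∞) := by
  classical
  simp only [meetCount, Finset.card_filter, Nat.cast_sum, Nat.cast_ite, Nat.cast_one,
    Nat.cast_zero]
  exact Finset.measurable_fun_sum _ fun t _ =>
    Measurable.ite (measurableSet_meets hm hh q x t) measurable_const measurable_const

lemma lintegral_meetCount (hm : 0 < A.m) (hh : ∀ x y, MeasurableSet {ω | h ω x < h ω y})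
    (q x : M) : ∫⁻ ω, (meetCount hm h ω q x : ℝ≥0∞) ∂(Measure.pi fun _ => μ) =
      ENNReal.ofReal (A.L * (μ.real {ω | h ω q = h ω x} ^ A.kap) ^ 2) := by
  classical
  have h1 : ∀ ω, (meetCount hm h ω q x : ℝ≥0∞) =
      ∑ t, {ω | Meets hm h ω q x t}.indicator (fun _ => (1 : ℝ≥0∞)) ω := fun ω => by
    simp only [meetCount, Finset.card_filter, Nat.cast_sum, Nat.cast_ite, Nat.cast_one,
      Nat.cast_zero, Set.indicator_apply, Set.mem_ofPred_eq]
  simp only [h1]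
  rw [lintegral_finsetSum _ fun t _ =>
    measurable_const.indicator (measurableSet_meets hm hh q x t)]
  simp only [lintegral_indicator (measurableSet_meets hm hh q x _), lintegral_const,
    Measure.restrict_apply_univ, one_mul, measure_meets hm hh]
  rw [Finset.sum_const, Finset.card_univ, Fintype.card_fin, nsmul_eq_mul,
    ENNReal.ofReal_mul (Nat.cast_nonneg _), ENNReal.ofReal_natCast]

/-- The half table with a given position. -/
def halfIndex (A : Params) (σ : Fin A.R → Bool) (z : Fin A.R × Fin A.m) : Fin A.G :=
  ⟨z.1 * (2 * A.m) + ((if σ z.1 then A.m else 0) + z.2), by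
    have h1 := z.1.2
    have h2 := z.2.2
    calc z.1 * (2 * A.m) + ((if σ z.1 then A.m else 0) + z.2)
        < z.1 * (2 * A.m) + 2 * A.m := by split_ifs <;> omega
      _ = (z.1 + 1) * (2 * A.m) := by ring
      _ ≤ A.R * (2 * A.m) := Nat.mul_le_mul_right _ h1⟩

lemma halfIndex_injective (σ : Fin A.R → Bool) : Function.Injective (A.halfIndex σ) := by
  rintro ⟨ρ, i⟩ ⟨ρ', i'⟩ H
  have h1 := congrArg Fin.val H
  simp only [halfIndex] at h1
  have hi := i.2
  have hi' := i'.2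
  have h2 : ∀ (ρ : Fin A.R) (i : Fin A.m), (ρ * (2 * A.m) + ((if σ ρ then A.m else 0) + i)) /
      (2 * A.m) = ρ := fun ρ i => by
    have hi := i.2
    rw [mul_comm, Nat.mul_add_div (by omega), Nat.div_eq_of_lt (by split_ifs <;> omega), add_zero]
  have h3 : ρ = ρ' := Fin.ext (by rw [← h2 ρ i, h1, h2])
  subst h3
  exact Prod.ext rfl (Fin.ext (by simp only; omega))

/-- Every pair of a first and a second half of a repetition is a table; its number is `m ^ 2 * ρ + m
* i + j`. -/
lemma exists_table (hm : 0 < A.m) (ρ : Fin A.R) (i j : Fin A.m) : ∃ t : Fin A.L,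
    (firstHalf hm t).val = ρ * (2 * A.m) + i ∧
      (secondHalf hm t).val = ρ * (2 * A.m) + (A.m + j) := by
  have hi := i.2
  have hj := j.2
  have hij : A.m * i + j < A.m * A.m := by
    calc A.m * i + j < A.m * i + A.m := by omega
      _ = A.m * (i + 1) := by ring
      _ ≤ A.m * A.m := Nat.mul_le_mul_left _ hi
  have ht : A.m * A.m * ρ + (A.m * i + j) < A.L := by
    calc _ < A.m * A.m * ρ + A.m * A.m := by omega
      _ = (ρ + 1) * (A.m * A.m) := by ring
      _ ≤ A.L := Nat.mul_le_mul_right _ ρ.2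
  have h1 : (A.m * A.m * ρ + (A.m * i + j)) / (A.m * A.m) = ρ := by
    rw [Nat.mul_add_div (Nat.mul_pos hm hm), Nat.div_eq_of_lt hij, add_zero]
  have h2 : (A.m * A.m * ρ + (A.m * i + j)) / A.m = A.m * ρ + i := by
    rw [mul_assoc, ← add_assoc, ← mul_add, Nat.mul_add_div hm, Nat.div_eq_of_lt hj, add_zero]
  have h3 : (A.m * A.m * ρ + (A.m * i + j)) % A.m = j := by
    rw [mul_assoc, ← add_assoc, ← mul_add, Nat.mul_add_mod, Nat.mod_eq_of_lt hj]
  refine ⟨⟨_, ht⟩, ?_, ?_⟩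
  · simp only [firstHalf, ga, h1, h2]
    rw [Nat.mul_add_mod, Nat.mod_eq_of_lt hi]
  · simp only [secondHalf, gb, h1, h3, add_assoc]

/-- If no table of a repetition unites `q` and `x`, then all its first halves or all its second
halves separate them. Let `σ` record which alternative holds in each repetition. For each of the `2
^ R` choices of `σ` this is an event about `m * R` independent half tables, and a union bound gives
`(2 * (1 - c) ^ m) ^ R`. -/
lemma measure_not_meets_le (hm : 0 < A.m) (hh : ∀ x y, MeasurableSet {ω | h ω x < h ω y})
    {q x : M} (hx : (1 - μ.real {ω | h ω q = h ω x} ^ A.kap) ^ A.m ≤ 3 / 8) :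
    (Measure.pi fun _ => μ) {ω | ¬ ∃ t, Meets hm h ω q x t} ≤
      ENNReal.ofReal ((3 / 4) ^ A.R) := by
  classical
  let V := agree h A.kap q x
  have hV : MeasurableSet V := measurableSet_agree hh A.kap q x
  let c := μ.real {ω | h ω q = h ω x} ^ A.kap
  have hc1 : c ≤ 1 := pow_le_one₀ measureReal_nonneg measureReal_le_one
  have hVc : (Measure.pi fun _ : Fin A.kap => μ) Vᶜ = ENNReal.ofReal (1 - c) := by
    rw [prob_compl_eq_one_sub hV, measure_agree, ENNReal.ofReal_sub _ (by positivity),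
      ENNReal.ofReal_one]
  let s : (Fin A.R → Bool) → Finset (Fin A.G) := fun σ => Finset.univ.image (A.halfIndex σ)
  have hs : ∀ σ, (s σ).card = A.m * A.R := fun σ => by
    rw [Finset.card_image_of_injective _ (halfIndex_injective σ)]
    simp [mul_comm]
  have hsub : {ω : Fin (A.G * A.kap) → Ω | ¬ ∃ t, Meets hm h ω q x t} ⊆
      ⋃ σ : Fin A.R → Bool, {ω | ∀ g ∈ s σ, A.half ω g ∈ Vᶜ} := by
    intro ω hω
    have key : ∀ ρ : Fin A.R, ∃ b : Bool, ∀ i : Fin A.m, ∀ g : Fin A.G,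
        g.val = ρ * (2 * A.m) + ((if b then A.m else 0) + i) → A.half ω g ∈ Vᶜ := by
      intro ρ
      by_contra hcon
      push Not at hcon
      obtain ⟨i, g, hg, hgi⟩ := hcon false
      obtain ⟨j, g', hg', hgj⟩ := hcon true
      obtain ⟨t, h1, h2⟩ := exists_table hm ρ i j
      refine hω ⟨t, ?_⟩
      have e1 : firstHalf hm t = g := Fin.ext (by rw [h1, hg]; simp)
      have e2 : secondHalf hm t = g' := Fin.ext (by rw [h2, hg']; simp)
      simp only [Set.mem_compl_iff, not_not] at hgi hgj
      exact ⟨label_eq_iff.2 (e1 ▸ hgi), label_eq_iff.2 (e2 ▸ hgj)⟩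
    choose σ hσ using key
    refine Set.mem_iUnion.2 ⟨σ, fun g hg => ?_⟩
    obtain ⟨z, _, rfl⟩ := Finset.mem_image.1 hg
    exact hσ z.1 z.2 _ rfl
  calc (Measure.pi fun _ => μ) {ω | ¬ ∃ t, Meets hm h ω q x t}
      ≤ (Measure.pi fun _ => μ) (⋃ σ : Fin A.R → Bool, {ω | ∀ g ∈ s σ, A.half ω g ∈ Vᶜ}) :=
        measure_mono hsub
    _ ≤ ∑ σ : Fin A.R → Bool, (Measure.pi fun _ => μ) {ω | ∀ g ∈ s σ, A.half ω g ∈ Vᶜ} :=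
        measure_iUnion_fintype_le _ _
    _ = ∑ σ : Fin A.R → Bool, ENNReal.ofReal (((1 - c) ^ A.m) ^ A.R) := by
        refine Finset.sum_congr rfl fun σ _ => ?_
        rw [measure_halves _ hV.compl, hVc, hs, ← pow_mul, ENNReal.ofReal_pow (by linarith)]
    _ = ENNReal.ofReal ((2 * (1 - c) ^ A.m) ^ A.R) := by
        rw [Finset.sum_const, Finset.card_univ, Fintype.card_fun, Fintype.card_bool,
          Fintype.card_fin, nsmul_eq_mul, mul_pow, ENNReal.ofReal_mul (by positivity)]
        congr 1
        rw [ENNReal.ofReal_pow (by norm_num)]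
        simp
    _ ≤ _ := by
        refine ENNReal.ofReal_le_ofReal (pow_le_pow_left₀ ?_ ?_ _)
        · have : 0 ≤ 1 - c := by linarith
          positivity
        · linarith

end Params

end FairANN
namespace FairANN

/-! ### The expected query time -/

namespace Params
variable {A : Params} {W : ℕ} {M Ω U : Type*} [MeasurableSpace Ω] [LinearOrder U] [MetricSpace M]

/-- The parameters fit to the collision probabilities. -/
structure Tuned (A : Params) (μ : Measure Ω) (h : Ω → M → U) (c r : ℝ) (Q : ℕ) : Prop where
  Q_pos : 0 < Q
  near : ∀ x y, dist x y ≤ r → (1 - μ.real {ω | h ω x = h ω y} ^ A.kap) ^ A.m ≤ 3 / 8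
  mid : ∀ x y, r < dist x y → (A.m * μ.real {ω | h ω x = h ω y} ^ A.kap) ^ 2 ≤ 4
  far : ∀ x y, c * r ≤ dist x y → A.n * (μ.real {ω | h ω x = h ω y} ^ A.kap) ^ 2 ≤ 1
  rep : A.n * (3 / 4 : ℝ) ^ A.R ≤ 1 / (2 * (A.n * Q))

variable (hA : A.Ok W) {h : Ω → M → U} (hh : ∀ x y, MeasurableSet {ω | h ω x < h ω y})
  (S : Fin A.n ↪ M) {μ : Measure Ω} [IsProbabilityMeasure μ] {c r : ℝ} {Q d : ℕ}

lemma measurableSet_covered (q : M) :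
    MeasurableSet {ω : Fin (A.G * A.kap) → Ω | Covered (dataStructure hA hh S) h S r ω q} := by
  have : {ω : Fin (A.G * A.kap) → Ω | Covered (dataStructure hA hh S) h S r ω q} =
      ⋂ i ∈ nbhd S q r, ⋃ t, {ω | Meets hA.m_pos h ω q (S i) t} := by
    ext ω
    simp only [Set.mem_ofPred_eq, Covered, Set.mem_iInter, Set.mem_iUnion]
    exact forall₂_congr fun i _ => mem_candidates hA hh S
  rw [this]
  exact Finset.measurableSet_biInter _ fun i _ =>
    MeasurableSet.iUnion fun t => measurableSet_meets hA.m_pos hh q (S i) t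

lemma measure_not_covered_le (hT : A.Tuned μ h c r Q) (q : M) :
    (Measure.pi fun _ : Fin (A.G * A.kap) => μ)
      {ω | ¬ Covered (dataStructure hA hh S) h S r ω q} ≤
        ENNReal.ofReal (1 / (2 * (A.n * Q))) := by
  have hsub : {ω : Fin (A.G * A.kap) → Ω | ¬ Covered (dataStructure hA hh S) h S r ω q} ⊆
      ⋃ i ∈ nbhd S q r, {ω | ¬ ∃ t, Meets hA.m_pos h ω q (S i) t} := by
    intro ω hω
    simp only [Set.mem_ofPred_eq, Covered, not_forall] at hω
    obtain ⟨i, hi, hn⟩ := hω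
    exact Set.mem_iUnion₂.2 ⟨i, hi, fun ht => hn ((mem_candidates hA hh S).2 ht)⟩
  calc _ ≤ _ := measure_mono hsub
    _ ≤ ∑ i ∈ nbhd S q r, (Measure.pi fun _ : Fin (A.G * A.kap) => μ)
        {ω | ¬ ∃ t, Meets hA.m_pos h ω q (S i) t} := measure_biUnion_finset_le _ _
    _ ≤ ∑ i ∈ nbhd S q r, ENNReal.ofReal ((3 / 4) ^ A.R) := by
        refine Finset.sum_le_sum fun i hi => measure_not_meets_le hA.m_pos hh (hT.near _ _ ?_)
        rw [dist_comm]
        simpa [nbhd] using hi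
    _ ≤ A.n * ENNReal.ofReal ((3 / 4) ^ A.R) := by
        rw [Finset.sum_const, nsmul_eq_mul]
        gcongr
        exact (Finset.card_le_univ _).trans (by simp)
    _ = ENNReal.ofReal (A.n * (3 / 4) ^ A.R) := by
        rw [ENNReal.ofReal_mul (Nat.cast_nonneg _), ENNReal.ofReal_natCast]
    _ ≤ _ := ENNReal.ofReal_le_ofReal hT.rep

open Classical in
lemma measurable_not_covered (q : M) : Measurable fun ω : Fin (A.G * A.kap) → Ω =>
    if Covered (dataStructure hA hh S) h S r ω q then (0 : ℝ≥0∞) else 1 :=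
  Measurable.ite (measurableSet_covered hA hh S q) measurable_const measurable_const

open Classical in
lemma lintegral_not_covered_le (hT : A.Tuned μ h c r Q) (q : M) :
    ∫⁻ ω, (if Covered (dataStructure hA hh S) h S r ω q then (0 : ℝ≥0∞) else 1)
      ∂(Measure.pi fun _ : Fin (A.G * A.kap) => μ) ≤ ENNReal.ofReal (1 / (2 * (A.n * Q))) := by
  refine le_trans (le_of_eq ?_) (measure_not_covered_le hA hh S hT q)
  refine Eq.trans ?_ (lintegral_indicator_one (measurableSet_covered hA hh S q).compl)
  refine lintegral_congr fun ω => ?_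
  by_cases hc : Covered (dataStructure hA hh S) h S r ω q
  · rw [if_pos hc]
    exact (Set.indicator_of_notMem (s := {ω : Fin (A.G * A.kap) → Ω |
      Covered (dataStructure hA hh S) h S r ω q}ᶜ)
      (fun hn => hn hc) (1 : (Fin (A.G * A.kap) → Ω) → ℝ≥0∞)).symm
  · rw [if_neg hc]
    exact (Set.indicator_of_mem (s := {ω : Fin (A.G * A.kap) → Ω |
      Covered (dataStructure hA hh S) h S r ω q}ᶜ) hc
      (1 : (Fin (A.G * A.kap) → Ω) → ℝ≥0∞)).symm

open Classical in
/-- The points at a distance in `(r, R]` from the query. -/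
noncomputable def ring (S : Fin A.n ↪ M) (q : M) (r R : ℝ) : Finset (Fin A.n) :=
  Finset.univ.filter fun i => r < dist (S i) q ∧ dist (S i) q ≤ R

open Classical in
/-- The points at a distance greater than `R` from the query. -/
noncomputable def outside (S : Fin A.n ↪ M) (q : M) (R : ℝ) : Finset (Fin A.n) :=
  Finset.univ.filter fun i => R < dist (S i) q

lemma ring_card_le (q : M) : (ring S q r (c * r)).card ≤ density S q (c * r) := by
  classical
  refine Finset.card_le_card fun i hi => ?_
  simp only [ring, Finset.mem_filter, nbhd] at hi ⊢
  exact ⟨hi.1, hi.2.2⟩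

lemma sum_split (hrc : r ≤ c * r) (q : M) (f : Fin A.n → ℕ) : ∑ x, f x =
    ∑ x ∈ nbhd S q r, f x + ∑ x ∈ ring S q r (c * r), f x + ∑ x ∈ outside S q (c * r), f x := by
  classical
  simp only [nbhd, ring, outside, Finset.sum_filter, ← Finset.sum_add_distrib]
  refine Finset.sum_congr rfl fun x _ => ?_
  rcases le_or_gt (dist (S x) q) r with h1 | h1
  · have h2 : dist (S x) q ≤ c * r := h1.trans hrc
    simp [h1, h2, h1.not_gt, h2.not_gt]
  · rcases le_or_gt (dist (S x) q) (c * r) with h2 | h2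
    · simp [h1, h2, h1.not_ge, h2.not_gt]
    · simp [h2, h1.not_ge, h2.not_ge]

omit [MeasurableSpace Ω] [LinearOrder U] [MetricSpace M] in
lemma meetCount_le (hm : 0 < A.m) (ω : Fin (A.G * A.kap) → Ω) (q x : M) :
    meetCount hm h ω q x ≤ A.L := by
  classical
  exact (Finset.card_le_univ _).trans (by simp)

/-- A bound for the time of a query. -/
noncomputable def timeDom (c r : ℝ) (d : ℕ) (ω : Fin (A.G * A.kap) → Ω) (q : M) : ℝ≥0∞ :=
  open Classical in
  ENNReal.ofReal (d * (A.prepSteps + 1 + 1200 * A.L)) +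
    ∑ x ∈ outside S q (c * r), ENNReal.ofReal (600 * d) * meetCount hA.m_pos h ω q (S x) +
    ∑ x ∈ ring S q r (c * r), ENNReal.ofReal (600 * d / max (density S q r : ℝ) 1) *
      meetCount hA.m_pos h ω q (S x) +
    ENNReal.ofReal (600 * d * (A.n * A.L)) *
      if Covered (dataStructure hA hh S) h S r ω q then 0 else 1

open Classical in
lemma timeDom_eq (ω : Fin (A.G * A.kap) → Ω) (q : M) : timeDom hA hh S c r d ω q =
    ENNReal.ofReal (d * (A.prepSteps + 1 + 1200 * A.L) +
      600 * d * ∑ x ∈ outside S q (c * r), (meetCount hA.m_pos h ω q (S x) : ℝ) +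
      600 * d / max (density S q r : ℝ) 1 *
        ∑ x ∈ ring S q r (c * r), (meetCount hA.m_pos h ω q (S x) : ℝ) +
      600 * d * (A.n * A.L) * if Covered (dataStructure hA hh S) h S r ω q then 0 else 1) := by
  have e1 : ∀ (s : Finset (Fin A.n)) (z : ℝ), 0 ≤ z → ∑ x ∈ s, ENNReal.ofReal z *
      (meetCount hA.m_pos h ω q (S x) : ℝ≥0∞) =
        ENNReal.ofReal (z * ∑ x ∈ s, (meetCount hA.m_pos h ω q (S x) : ℝ)) := by
    intro s z hz
    rw [← Finset.mul_sum, ENNReal.ofReal_mul hz,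
      ENNReal.ofReal_sum_of_nonneg fun _ _ => Nat.cast_nonneg _]
    simp only [ENNReal.ofReal_natCast]
  have e2 : (if Covered (dataStructure hA hh S) h S r ω q then (0 : ℝ≥0∞) else 1) =
      ENNReal.ofReal (if Covered (dataStructure hA hh S) h S r ω q then 0 else 1) := by
    split_ifs <;> simp
  have h0 : (0 : ℝ) ≤ if Covered (dataStructure hA hh S) h S r ω q then 0 else 1 := by
    split_ifs <;> norm_num
  have h1 : ∀ s : Finset (Fin A.n), 0 ≤ ∑ x ∈ s, (meetCount hA.m_pos h ω q (S x) : ℝ) :=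
    fun s => Finset.sum_nonneg fun _ _ => Nat.cast_nonneg _
  have h2 : (0 : ℝ) ≤ 600 * d / max (density S q r : ℝ) 1 := by positivity
  have h3 : (0 : ℝ) ≤ 600 * d * (A.n * A.L) := by positivity
  have h4 : (0 : ℝ) ≤ 600 * d := by positivity
  have h5 : (0 : ℝ) ≤ d * (A.prepSteps + 1 + 1200 * A.L) := by positivity
  have h6 := mul_nonneg h4 (h1 (outside S q (c * r)))
  have h7 := mul_nonneg h2 (h1 (ring S q r (c * r)))
  rw [timeDom, e1 _ _ h4, e1 _ _ h2, e2, ← ENNReal.ofReal_mul h3, ← ENNReal.ofReal_add h5 h6,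
    ← ENNReal.ofReal_add (add_nonneg h5 h6) h7,
    ← ENNReal.ofReal_add (add_nonneg (add_nonneg h5 h6) h7) (mul_nonneg h3 h0)]

/-- Time is proportional to the number of bucket positions per near point found. Each near point
found accounts for at most `L` positions, so these cost `O(L)` after division. Points outside `c *
r` are not divided at all. Points in the ring are divided by the full `n(q, r)` if the query is
covered; otherwise the crude bound `n * L` is charged to the last term. -/
lemma queryTime_le_timeDom (hd : 1 ≤ d) (hrc : r ≤ c * r) (ω : Fin (A.G * A.kap) → Ω) (q : M) :
    queryTime (dataStructure hA hh S) queryCmd h S r d ω q ≤ timeDom hA hh S c r d ω q := by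
  classical
  refine (queryTime_le hA hh S hd).trans ?_
  let f : Fin A.n → ℕ := fun x => meetCount hA.m_pos h ω q (S x)
  have hfL : ∀ x, f x ≤ A.L := fun x => meetCount_le hA.m_pos ω q (S x)
  let a : ℝ := ∑ x ∈ outside S q (c * r), (f x : ℝ)
  let b : ℝ := ∑ x ∈ ring S q r (c * r), (f x : ℝ)
  let u : ℝ := if Covered (dataStructure hA hh S) h S r ω q then 0 else 1
  let K : ℝ := (max (foundPoints hA.m_pos h S r ω q).card 1 : ℕ)
  have hK1 : 1 ≤ K := by
    show (1 : ℝ) ≤ (max (foundPoints hA.m_pos h S r ω q).card 1 : ℕ)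
    exact_mod_cast le_max_right _ _
  have ha : 0 ≤ a := Finset.sum_nonneg fun _ _ => Nat.cast_nonneg _
  have hb : 0 ≤ b := Finset.sum_nonneg fun _ _ => Nat.cast_nonneg _
  have hu : 0 ≤ u := by simp only [u]; split_ifs <;> norm_num
  have hnear : (∑ x ∈ nbhd S q r, (f x : ℝ)) ≤ K * A.L := by
    have h1 : ∑ x ∈ nbhd S q r, f x = ∑ x ∈ foundPoints hA.m_pos h S r ω q, f x := by
      rw [foundPoints, Finset.sum_filter_of_ne]
      intro x _ hx
      obtain ⟨t, ht⟩ := Finset.card_pos.1 (Nat.pos_of_ne_zero hx)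
      exact ⟨t, (Finset.mem_filter.1 ht).2⟩
    have h2 : ∑ x ∈ foundPoints hA.m_pos h S r ω q, f x ≤
        (max (foundPoints hA.m_pos h S r ω q).card 1) * A.L :=
      (Finset.sum_le_card_nsmul _ _ A.L fun x _ => hfL x).trans
        (Nat.mul_le_mul_right _ (le_max_left _ _))
    rw [← h1] at h2
    have h3 : ((∑ x ∈ nbhd S q r, f x : ℕ) : ℝ) ≤ K * A.L := by
      refine (Nat.cast_le.2 h2).trans_eq ?_
      rw [Nat.cast_mul]
    rwa [Nat.cast_sum] at h3
  have hmid : b / K ≤ b / max (density S q r : ℝ) 1 + u * (A.n * A.L) := by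
    by_cases hc : Covered (dataStructure hA hh S) h S r ω q
    · have hKe : K = max (density S q r : ℝ) 1 := by
        simp only [K, (covered_iff hA hh S).1 hc, density, Nat.cast_max, Nat.cast_one]
      rw [hKe]
      have : 0 ≤ u * (A.n * A.L) :=
        mul_nonneg hu (mul_nonneg (Nat.cast_nonneg _) (Nat.cast_nonneg _))
      linarith
    · have h1 : b ≤ A.n * A.L := by
        have h2 : ∑ x ∈ ring S q r (c * r), f x ≤ A.n * A.L := by
          refine (Finset.sum_le_card_nsmul _ _ A.L fun x _ => hfL x).trans ?_
          exact Nat.mul_le_mul_right _ ((Finset.card_le_univ _).trans (by simp))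
        have h3 : ((∑ x ∈ ring S q r (c * r), f x : ℕ) : ℝ) ≤ A.n * A.L := by exact_mod_cast h2
        rwa [Nat.cast_sum] at h3
      have h3 : b / K ≤ b := div_le_self hb hK1
      have h4 : u = 1 := if_neg hc
      have h5 : 0 ≤ b / max (density S q r : ℝ) 1 :=
        div_nonneg hb (zero_le_one.trans (le_max_right _ _))
      rw [h4]
      linarith
  have hL : (A.L : ℝ) / K ≤ A.L := div_le_self (Nat.cast_nonneg _) hK1
  have haK : a / K ≤ a := div_le_self ha hK1
  have hsum : ((∑ x, f x : ℕ) : ℝ) = ∑ x ∈ nbhd S q r, (f x : ℝ) + b + a := by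
    rw [sum_split S hrc q f]
    push_cast
    rfl
  have hnK : (∑ x ∈ nbhd S q r, (f x : ℝ)) / K ≤ A.L := by
    rw [div_le_iff₀ (by linarith)]
    linarith
  have hmain : (2 * ((∑ x, f x : ℕ) : ℝ) + A.L) / K + A.L ≤
      4 * A.L + 2 * a + 2 * (b / max (density S q r : ℝ) 1) + 2 * (u * (A.n * A.L)) := by
    rw [hsum]
    have : (2 * (∑ x ∈ nbhd S q r, (f x : ℝ) + b + a) + A.L) / K =
      2 * ((∑ x ∈ nbhd S q r, (f x : ℝ)) / K) + 2 * (b / K) + 2 * (a / K) + A.L / K := by ring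
    rw [this]
    linarith
  rw [timeDom_eq]
  refine ENNReal.ofReal_le_ofReal ?_
  calc _ ≤ d * (A.prepSteps + 1 + 300 * (4 * A.L + 2 * a +
        2 * (b / max (density S q r : ℝ) 1) + 2 * (u * (A.n * A.L)))) :=
        mul_le_mul_of_nonneg_left (by linarith [hmain]) (Nat.cast_nonneg _)
    _ = _ := by ring

lemma measurable_timeDom (q : M) :
    Measurable fun ω : Fin (A.G * A.kap) → Ω => timeDom hA hh S c r d ω q := by
  unfold timeDom
  refine ((measurable_const.add ?_).add ?_).add ((measurable_not_covered hA hh S q).const_mul _)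
  · exact Finset.measurable_fun_sum _ fun x _ =>
      (measurable_meetCount hA.m_pos hh q (S x)).const_mul _
  · exact Finset.measurable_fun_sum _ fun x _ =>
      (measurable_meetCount hA.m_pos hh q (S x)).const_mul _

/-- A bound for the expected time of a query. -/
noncomputable def expectedTime (S : Fin A.n ↪ M) (c r : ℝ) (d : ℕ) (q : M) : ℝ :=
  d * (A.prepSteps + 1 + 2100 * A.L +
    2400 * A.R * (density S q (c * r) / max (density S q r : ℝ) 1))

/-- An outside point meets the query in at most `L / n` tables on average, and a ring point in at
most `R * 4`, since `m ^ 2` times its collision probability per table is at most `4`. The failure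
term costs at most `n * L` times `1 / (2 * n * Q)`. The multiples of `L` add up to `1200 + 600 +
300`. -/
lemma lintegral_timeDom_le (hT : A.Tuned μ h c r Q) (q : M) :
    ∫⁻ ω, timeDom hA hh S c r d ω q ∂(Measure.pi fun _ : Fin (A.G * A.kap) => μ) ≤
      ENNReal.ofReal (expectedTime S c r d q) := by
  classical
  have hn : (0 : ℝ) < A.n := Nat.cast_pos.2 hA.n_pos
  have hQ : (1 : ℝ) ≤ Q := Nat.one_le_cast.2 hT.Q_pos
  have hmc : ∀ (z : ℝ≥0∞) (x : Fin A.n), Measurable fun ω : Fin (A.G * A.kap) → Ω =>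
      z * (meetCount hA.m_pos h ω q (S x) : ℝ≥0∞) := fun z x =>
    (measurable_meetCount hA.m_pos hh q (S x)).const_mul _
  have hsum : ∀ (s : Finset (Fin A.n)) (z y : ℝ), 0 ≤ z →
      (∀ x ∈ s, A.L * (μ.real {ω | h ω q = h ω (S x)} ^ A.kap) ^ 2 ≤ y) →
      ∫⁻ ω, ∑ x ∈ s, ENNReal.ofReal z * (meetCount hA.m_pos h ω q (S x) : ℝ≥0∞)
        ∂(Measure.pi fun _ : Fin (A.G * A.kap) => μ) ≤ ENNReal.ofReal (s.card * (z * y)) := by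
    intro s z y hz hy
    rw [lintegral_finsetSum _ fun x _ => hmc _ x]
    calc _ ≤ ∑ x ∈ s, ENNReal.ofReal (z * y) := by
          refine Finset.sum_le_sum fun x hx => ?_
          rw [lintegral_const_mul _ (measurable_meetCount hA.m_pos hh q (S x)),
            lintegral_meetCount hA.m_pos hh, ← ENNReal.ofReal_mul hz]
          exact ENNReal.ofReal_le_ofReal (mul_le_mul_of_nonneg_left (hy x hx) hz)
      _ = _ := by
          rw [Finset.sum_const, nsmul_eq_mul, ENNReal.ofReal_mul (Nat.cast_nonneg _),
            ENNReal.ofReal_natCast]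
  have h1 := hsum (outside S q (c * r)) (600 * d) (A.L / A.n) (by positivity) fun x hx => by
    have : c * r ≤ dist q (S x) := by
      rw [dist_comm]
      simp only [outside, Finset.mem_filter] at hx
      exact hx.2.le
    rw [le_div_iff₀ hn]
    have := hT.far _ _ this
    nlinarith [Nat.cast_nonneg (α := ℝ) A.L]
  have h2 := hsum (ring S q r (c * r)) (600 * d / max (density S q r : ℝ) 1) (4 * A.R)
    (by positivity) fun x hx => by
    have : r < dist q (S x) := by
      rw [dist_comm]
      simp only [ring, Finset.mem_filter] at hx
      exact hx.2.1
    have := hT.mid _ _ this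
    simp only [L, Nat.cast_mul]
    nlinarith [Nat.cast_nonneg (α := ℝ) A.R]
  have h3 : ∫⁻ ω, ENNReal.ofReal (600 * d * (A.n * A.L)) *
      (if Covered (dataStructure hA hh S) h S r ω q then (0 : ℝ≥0∞) else 1)
        ∂(Measure.pi fun _ : Fin (A.G * A.kap) => μ) ≤ ENNReal.ofReal (300 * d * A.L) := by
    rw [lintegral_const_mul _ (measurable_not_covered hA hh S q)]
    calc _ ≤ ENNReal.ofReal (600 * d * (A.n * A.L)) * ENNReal.ofReal (1 / (2 * (A.n * Q))) := by
          gcongr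
          exact lintegral_not_covered_le hA hh S hT q
      _ = ENNReal.ofReal (600 * d * (A.n * A.L) * (1 / (2 * (A.n * Q)))) := by
          rw [← ENNReal.ofReal_mul (by positivity)]
      _ ≤ _ := by
          refine ENNReal.ofReal_le_ofReal ?_
          have : 600 * (d : ℝ) * (A.n * A.L) * (1 / (2 * (A.n * Q))) = 300 * d * A.L / Q := by
            field_simp
            ring
          rw [this]
          exact div_le_self (by positivity) hQ
  have hr : (ring S q r (c * r)).card * (600 * d / max (density S q r : ℝ) 1 * (4 * A.R)) ≤
      2400 * d * A.R * (density S q (c * r) / max (density S q r : ℝ) 1) := by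
    have := ring_card_le S (r := r) (c := c) q
    have : ((ring S q r (c * r)).card : ℝ) ≤ density S q (c * r) := by exact_mod_cast this
    calc _ ≤ (density S q (c * r) : ℝ) * (600 * d / max (density S q r : ℝ) 1 * (4 * A.R)) := by
          gcongr
      _ = _ := by ring
  have ho : (outside S q (c * r)).card * (600 * (d : ℝ) * (A.L / A.n)) ≤ 600 * d * A.L := by
    have h0 : (outside S q (c * r)).card ≤ A.n := (Finset.card_le_univ _).trans (by simp)
    have h0' : ((outside S q (c * r)).card : ℝ) ≤ A.n := by exact_mod_cast h0
    calc _ ≤ (A.n : ℝ) * (600 * (d : ℝ) * (A.L / A.n)) := by gcongr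
      _ = _ := by field_simp
  simp only [timeDom]
  have hadd : ∀ (z : ℝ≥0∞) (f g k : (Fin (A.G * A.kap) → Ω) → ℝ≥0∞), Measurable f →
      Measurable g → ∫⁻ ω, z + f ω + g ω + k ω ∂(Measure.pi fun _ => μ) =
        z + ∫⁻ ω, f ω ∂(Measure.pi fun _ => μ) + ∫⁻ ω, g ω ∂(Measure.pi fun _ => μ) +
          ∫⁻ ω, k ω ∂(Measure.pi fun _ => μ) := fun z f g k hf hg => by
    rw [lintegral_add_left (by fun_prop), lintegral_add_left (by fun_prop),
      lintegral_add_left (by fun_prop), lintegral_const, measure_univ, mul_one]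
  rw [hadd _ _ _ _ (Finset.measurable_fun_sum _ fun x _ => hmc _ x)
    (Finset.measurable_fun_sum _ fun x _ => hmc _ x)]
  refine (add_le_add (add_le_add (add_le_add le_rfl h1) h2) h3).trans ?_
  rw [← ENNReal.ofReal_add (by positivity) (by positivity),
    ← ENNReal.ofReal_add (by positivity) (by positivity),
    ← ENNReal.ofReal_add (by positivity) (by positivity)]
  refine ENNReal.ofReal_le_ofReal ?_
  rw [expectedTime]
  nlinarith [hr, ho]

lemma queryTime_le_max (hd : 1 ≤ d) (ω : Fin (A.G * A.kap) → Ω) (q : M) :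
    queryTime (dataStructure hA hh S) queryCmd h S r d ω q ≤
      ENNReal.ofReal (d * (A.prepSteps + 1 + 1200 * (A.n * A.L))) := by
  refine (queryTime_le hA hh S hd).trans (ENNReal.ofReal_le_ofReal ?_)
  have h1 : ∑ x, meetCount hA.m_pos h ω q (S x) ≤ A.n * A.L :=
    (Finset.sum_le_card_nsmul _ _ A.L fun x _ => meetCount_le hA.m_pos ω q (S x)).trans (by simp)
  have h1' : ((∑ x, meetCount hA.m_pos h ω q (S x) : ℕ) : ℝ) ≤ A.n * A.L := by exact_mod_cast h1
  have hK1 : (1 : ℝ) ≤ (max (foundPoints hA.m_pos h S r ω q).card 1 : ℕ) := by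
    exact_mod_cast le_max_right _ _
  have h2 : (A.L : ℝ) ≤ A.n * A.L := by
    exact_mod_cast Nat.le_mul_of_pos_left A.L hA.n_pos
  have h3 := div_le_self (a := 2 * ((∑ x, meetCount hA.m_pos h ω q (S x) : ℕ) : ℝ) + A.L)
    (by positivity) hK1
  refine mul_le_mul_of_nonneg_left ?_ (Nat.cast_nonneg _)
  linarith

omit [MeasurableSpace Ω] [LinearOrder U] in
lemma sum_fairLaw (q : M) : ∑ a, fairLaw S r q a = 1 :=
  (tsum_fintype _).symm.trans (fairLaw S r q).tsum_coe

/-- In the fair game the transcript is independent of the setup, so the integral over `ω` can be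
taken query by query. The switch to that game costs the worst-case time, which is larger than normal
by a factor of about `n`, times a failure probability of at most `Q / (2 * n * Q)`. -/
lemma lintegral_expAtRound_queryTime_le (hT : A.Tuned μ h c r Q) (hd : 1 ≤ d) (hrc : r ≤ c * r)
    (B : Adversary M A.n) {i : ℕ} (hi : i < Q) :
    ∫⁻ ω, expAtRound (ansLaw (dataStructure hA hh S) queryCmd h S r ω) B
      (queryTime (dataStructure hA hh S) queryCmd h S r d ω) i []
        ∂(Measure.pi fun _ : Fin (A.G * A.kap) => μ) ≤
      expAtRound (fun q => ⇑(fairLaw S r q)) B (fun q => ENNReal.ofReal (expectedTime S c r d q +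
        d * (A.prepSteps + 1 + 600 * A.L))) i [] := by
  classical
  have hn : (1 : ℝ) ≤ A.n := Nat.one_le_cast.2 hA.n_pos
  have hfair : ∀ q, ∑ a, fairLaw S r q a = 1 := sum_fairLaw S
  let D := dataStructure hA hh S
  let Z : ℝ≥0∞ := ENNReal.ofReal (d * (A.prepSteps + 1 + 1200 * (A.n * A.L)))
  let V : ℕ → (Fin (A.G * A.kap) → Ω) → ℝ≥0∞ := fun j ω =>
    expAtRound (fun q => ⇑(fairLaw S r q)) B (fun q => if Covered D h S r ω q then 0 else 1) j []
  have hVm := fun q => measurable_not_covered hA hh S (r := r) q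
  have hVmeas : ∀ j, Measurable (V j) := fun j => measurable_expAtRound _ B hVm j []
  have hVint : ∀ j, ∫⁻ ω, V j ω ∂(Measure.pi fun _ : Fin (A.G * A.kap) => μ) ≤
      ENNReal.ofReal (1 / (2 * (A.n * Q))) := by
    intro j
    simp only [V]
    rw [lintegral_expAtRound _ _ _ hVm]
    refine (expAtRound_mono _ B (g := fun _ => ENNReal.ofReal (1 / (2 * (A.n * Q))))
      (fun q => ?_) j []).trans_eq (expAtRound_const hfair B _ j [])
    exact lintegral_not_covered_le hA hh S hT q
  calc _ ≤ ∫⁻ ω, (expAtRound (fun q => ⇑(fairLaw S r q)) B (timeDom hA hh S c r d ω) i [] +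
        Z * ∑ j ∈ Finset.range i, V j ω) ∂(Measure.pi fun _ : Fin (A.G * A.kap) => μ) := by
        refine lintegral_mono fun ω => ?_
        refine (expAtRound_le_fair (fair := fun q => ⇑(fairLaw S r q)) (good := Covered D h S r ω)
          (fun q => sum_ansLaw hA hh S)
          (fun q hq a => ansLaw_of_covered hA hh S hq a)
          (fun q => queryTime_le_max hA hh S hd ω q) i []).trans ?_
        gcongr
        exact expAtRound_mono _ B (fun q => queryTime_le_timeDom hA hh S hd hrc ω q) i []
    _ = expAtRound (fun q => ⇑(fairLaw S r q)) B
          (fun q => ∫⁻ ω, timeDom hA hh S c r d ω q ∂(Measure.pi fun _ => μ)) i [] +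
        Z * ∑ j ∈ Finset.range i, ∫⁻ ω, V j ω ∂(Measure.pi fun _ => μ) := by
        rw [lintegral_add_left (measurable_expAtRound _ B (fun q => measurable_timeDom hA hh S q)
          i []), lintegral_expAtRound _ _ B (fun q => measurable_timeDom hA hh S q),
          lintegral_const_mul _ (Finset.measurable_fun_sum _ fun j _ => hVmeas j),
          lintegral_finsetSum _ fun j _ => hVmeas j]
    _ ≤ expAtRound (fun q => ⇑(fairLaw S r q)) B (fun q => ENNReal.ofReal (expectedTime S c r d q)) i [] +
        ENNReal.ofReal (d * (A.prepSteps + 1 + 600 * A.L)) := by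
        gcongr
        · exact expAtRound_mono _ B (fun q => lintegral_timeDom_le hA hh S hT q) i []
        · calc Z * ∑ j ∈ Finset.range i, ∫⁻ ω, V j ω ∂(Measure.pi fun _ => μ)
              ≤ Z * ∑ j ∈ Finset.range Q, ENNReal.ofReal (1 / (2 * (A.n * Q))) := by
                gcongr
                refine (Finset.sum_le_sum fun j _ => hVint j).trans ?_
                exact Finset.sum_le_sum_of_subset (Finset.range_subset_range.2 hi.le)
            _ = ENNReal.ofReal (d * (A.prepSteps + 1 + 1200 * (A.n * A.L)) *
                (Q * (1 / (2 * (A.n * Q))))) := by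
                rw [Finset.sum_const, Finset.card_range, nsmul_eq_mul,
                  ← ENNReal.ofReal_natCast Q, ← ENNReal.ofReal_mul (by positivity),
                  ← ENNReal.ofReal_mul (by positivity)]
            _ ≤ _ := by
                refine ENNReal.ofReal_le_ofReal ?_
                have hQ : (0 : ℝ) < Q := Nat.cast_pos.2 hT.Q_pos
                have e : d * (A.prepSteps + 1 + 1200 * (A.n * A.L)) * (Q * (1 / (2 * (A.n * Q)))) =
                    d * ((A.prepSteps + 1 : ℝ) / (2 * A.n) + 600 * A.L) := by
                  field_simp
                  ring
                rw [e]
                gcongr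
                exact div_le_self (by positivity) (by linarith)
    _ = _ := by
        have hnn : ∀ q, 0 ≤ expectedTime S c r d q := fun q => by
          rw [expectedTime]; positivity
        rw [← expAtRound_const hfair B (ENNReal.ofReal (d * (A.prepSteps + 1 + 600 * A.L))) i [],
          ← expAtRound_add]
        congr 1
        funext q
        rw [ENNReal.ofReal_add (hnn q) (by positivity)]

end Params

end FairANN
namespace FairANN

/-! ### The choice of the parameters -/

lemma rho_pos {p₁ p₂ : ℝ} (hp₂ : 0 < p₂) (hp : p₂ < p₁) (hp₁ : p₁ < 1) : 0 < rho p₁ p₂ := by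
  have h0 : 0 < p₁ := hp₂.trans hp
  exact div_pos (Real.log_pos (by rw [lt_div_iff₀ h0]; linarith))
    (Real.log_pos (by rw [lt_div_iff₀ hp₂]; linarith))

lemma rho_le_one {p₁ p₂ : ℝ} (hp₂ : 0 < p₂) (hp : p₂ < p₁) (hp₁ : p₁ < 1) : rho p₁ p₂ ≤ 1 := by
  have h0 : 0 < p₁ := hp₂.trans hp
  refine div_le_one_of_le₀ (Real.log_le_log (by positivity) ?_)
    (Real.log_nonneg (by rw [le_div_iff₀ hp₂]; linarith))
  exact one_div_le_one_div_of_le hp₂ hp.le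

lemma half_le_log {x : ℝ} (hx : 2 ≤ x) : 1 / 2 ≤ Real.log x := by
  have h1 := Real.log_two_gt_d9
  have h2 := Real.log_le_log two_pos hx
  linarith

lemma size_le {n : ℕ} (hn : 0 < n) : (n.size : ℝ) ≤ 2 * Real.log n + 1 := by
  have h1 : 2 ^ (n.size - 1) ≤ n := by
    by_contra h
    have := Nat.size_le.2 (not_le.1 h)
    have := Nat.size_pos.2 hn
    omega
  have h2 : ((n.size - 1 : ℕ) : ℝ) * Real.log 2 ≤ Real.log n := by
    rw [← Real.log_pow]
    exact Real.log_le_log (by positivity) (by exact_mod_cast h1)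
  have h3 : (n.size : ℝ) - 1 ≤ ((n.size - 1 : ℕ) : ℝ) := by
    have : n.size ≤ (n.size - 1) + 1 := by omega
    have : (n.size : ℝ) ≤ ((n.size - 1 : ℕ) : ℝ) + 1 := by exact_mod_cast this
    linarith
  have h4 := Real.log_two_gt_d9
  nlinarith [Nat.cast_nonneg (α := ℝ) (n.size - 1)]

lemma exists_repetitions {n Q : ℕ} (hnQ : 2 ≤ n * Q) : ∃ R : ℕ, 0 < R ∧
    n * (3 / 4 : ℝ) ^ R ≤ 1 / (2 * (n * Q)) ∧ (R : ℝ) ≤ 14 * Real.log (n * Q) := by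
  have h2 : (2 : ℝ) ≤ n * Q := by exact_mod_cast hnQ
  have hl := half_le_log h2
  have hn : 0 < n := Nat.pos_of_ne_zero fun h => by simp [h] at hnQ
  have hn' : (0 : ℝ) < n := Nat.cast_pos.2 hn
  have hQ : 0 < Q := Nat.pos_of_ne_zero fun h => by simp [h] at hnQ
  have hQ' : (1 : ℝ) ≤ Q := Nat.one_le_cast.2 hQ
  refine ⟨⌈12 * Real.log (n * Q)⌉₊, Nat.ceil_pos.2 (by linarith), ?_, ?_⟩
  · set R := ⌈12 * Real.log (n * Q)⌉₊
    have hR : 12 * Real.log (n * Q) ≤ R := Nat.le_ceil _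
    have h43 : (1 / 4 : ℝ) ≤ Real.log (4 / 3) := by
      have := Real.one_sub_inv_le_log_of_pos (show (0 : ℝ) < 4 / 3 by norm_num)
      norm_num at this ⊢
      linarith
    -- As `log (4/3) ≥ 1/4`, the factor `12` in `R` yields the cube of `n * Q`, which dominates the
    -- required `2 * (n * Q) * n`.
    have h3 : ((n : ℝ) * Q) ^ 3 ≤ (4 / 3) ^ R := by
      rw [← Real.log_le_log_iff (by positivity) (by positivity), Real.log_pow, Real.log_pow]
      push_cast
      nlinarith
    have h5 : 2 * (n * Q) * (n : ℝ) ≤ (n * Q) ^ 3 := by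
      have h6 : (n : ℝ) ≤ n * Q := by nlinarith
      calc 2 * (n * Q) * (n : ℝ) ≤ (n * Q) * (n * Q) * (n * Q) := by gcongr
        _ = _ := by ring
    rw [le_div_iff₀ (by positivity)]
    have h7 : (3 / 4 : ℝ) ^ R * (4 / 3) ^ R = 1 := by rw [← mul_pow]; norm_num
    calc n * (3 / 4 : ℝ) ^ R * (2 * (n * Q)) = 2 * (n * Q) * n * (3 / 4 : ℝ) ^ R := by ring
      _ ≤ (4 / 3) ^ R * (3 / 4 : ℝ) ^ R := by gcongr; exact h5.trans h3
      _ = 1 := by rw [mul_comm]; exact h7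
  · have := (Nat.ceil_lt_add_one (show 0 ≤ 12 * Real.log (n * Q) by linarith)).le
    linarith

/-- Half of the usual number of concatenated functions is enough, because a table combines two
halves. Accordingly the reciprocal of the near collision probability is of order `n ^ (ρ / 2)` only;
rounding up costs the factor `p₁⁻¹`. -/
lemma exists_concatenation {p₁ p₂ : ℝ} (hp₂ : 0 < p₂) (hp : p₂ < p₁) (hp₁ : p₁ < 1) {n : ℕ}
    (hn : 0 < n) : ∃ kap : ℕ, n * (p₂ ^ kap) ^ 2 ≤ 1 ∧
      (p₁ ^ kap)⁻¹ ≤ p₁⁻¹ * (n : ℝ) ^ (rho p₁ p₂ / 2) ∧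
      kap ≤ Real.log n / (2 * Real.log (1 / p₂)) + 1 := by
  have h0 : 0 < p₁ := hp₂.trans hp
  have hn' : (0 : ℝ) < n := Nat.cast_pos.2 hn
  have hln : 0 ≤ Real.log n := Real.log_natCast_nonneg n
  have hl2 : 0 < Real.log (1 / p₂) := Real.log_pos (by rw [lt_div_iff₀ hp₂]; linarith)
  have hl1 : 0 < Real.log (1 / p₁) := Real.log_pos (by rw [lt_div_iff₀ h0]; linarith)
  set kap := ⌈Real.log n / (2 * Real.log (1 / p₂))⌉₊
  have h1 : Real.log n / (2 * Real.log (1 / p₂)) ≤ kap := Nat.le_ceil _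
  have h2 : kap ≤ Real.log n / (2 * Real.log (1 / p₂)) + 1 :=
    (Nat.ceil_lt_add_one (by positivity)).le
  refine ⟨kap, ?_, ?_, h2⟩
  · rw [← Real.log_le_log_iff (by positivity) one_pos, Real.log_one,
      Real.log_mul hn'.ne' (by positivity), Real.log_pow, Real.log_pow]
    rw [div_le_iff₀ (by positivity)] at h1
    rw [one_div, Real.log_inv] at h1
    push_cast
    linarith
  · rw [← Real.log_le_log_iff (by positivity) (by positivity), Real.log_inv, Real.log_pow,
      Real.log_mul (by positivity) (by positivity), Real.log_rpow hn', Real.log_inv]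
    have h3 : kap * Real.log (1 / p₁) ≤
        (Real.log n / (2 * Real.log (1 / p₂)) + 1) * Real.log (1 / p₁) := by gcongr
    have h4 : (Real.log n / (2 * Real.log (1 / p₂)) + 1) * Real.log (1 / p₁) =
        rho p₁ p₂ / 2 * Real.log n + Real.log (1 / p₁) := by
      rw [rho]
      field_simp
    rw [h4, one_div, Real.log_inv] at h3
    linarith

/-- The number `m` is tuned to the given `p` rather than to `p₁`; the upper bound `m * p ^ kap ≤ 2`
is what limits the collisions at intermediate distances. There are only `n ^ (ρ / 2)` half tables up
to constants and a logarithm, and the two factors `log n` of a binary search are absorbed by the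
remaining `n ^ (ρ / 2)`. -/
lemma exists_parameters {p₁ p₂ : ℝ} (hp₂ : 0 < p₂) (hp : p₂ < p₁) (hp₁ : p₁ < 1) :
    ∃ K : ℝ, 1 ≤ K ∧ ∀ n Q : ℕ, 2 ≤ n * Q → ∀ p : ℝ, p₁ ≤ p → p ≤ 1 → ∃ kap m R : ℕ,
      0 < m ∧ 0 < R ∧ 1 ≤ m * p ^ kap ∧ m * p ^ kap ≤ 2 ∧ n * (p₂ ^ kap) ^ 2 ≤ 1 ∧
      n * (3 / 4 : ℝ) ^ R ≤ 1 / (2 * (n * Q)) ∧ (R : ℝ) ≤ K * Real.log (n * Q) ∧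
      ((⟨n, kap, m, R⟩ : Params).L : ℝ) ≤ K * ((n : ℝ) ^ rho p₁ p₂ * Real.log (n * Q)) ∧
      ((⟨n, kap, m, R⟩ : Params).prepSteps : ℝ) ≤
        K * ((n : ℝ) ^ rho p₁ p₂ * Real.log (n * Q)) := by
  have h0 : 0 < p₁ := hp₂.trans hp
  have hρ := rho_pos hp₂ hp hp₁
  set ρ := rho p₁ p₂
  have hl2 : 0 < Real.log (1 / p₂) := Real.log_pos (by rw [lt_div_iff₀ hp₂]; linarith)
  set lam := Real.log (1 / p₂)
  -- The constants bound in turn the number of tables, one binary search with its overhead, and all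
  -- steps before sampling. The `400` pays for the additive `200`, as the unit `t ^ 4 * ℓ` is at
  -- least `1 / 2`.
  let c₁ : ℝ := 14 * (2 * p₁⁻¹) ^ 2
  let c₂ : ℝ := (8 / ρ + 1) * (28 / (ρ * lam) + 75) + 40
  let c₃ : ℝ := 14 * (2 * (2 * p₁⁻¹)) * c₂ + 350 * c₁ + 400
  have hc₁ : 0 ≤ c₁ := by positivity
  have hc₂ : 0 ≤ c₂ := by positivity
  refine ⟨14 + c₁ + c₃, ?_, fun n Q hnQ p hpp hp1 => ?_⟩
  · have : 0 ≤ c₃ := by positivity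
    linarith
  have h2 : (2 : ℝ) ≤ n * Q := by exact_mod_cast hnQ
  have hℓ := half_le_log h2
  have hn : 0 < n := Nat.pos_of_ne_zero fun h => by simp [h] at hnQ
  have hn1 : (1 : ℝ) ≤ n := Nat.one_le_cast.2 hn
  obtain ⟨R, hR0, hR1, hR2⟩ := exists_repetitions hnQ
  obtain ⟨kap, hk1, hk2, hk3⟩ := exists_concatenation hp₂ hp hp₁ hn
  set ℓ := Real.log (n * Q)
  have hp0 : 0 < p := h0.trans_le hpp
  have hz : 0 < p ^ kap := by positivity
  have hz1 : p ^ kap ≤ 1 := pow_le_one₀ hp0.le hp1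
  have hm1 : (p ^ kap)⁻¹ ≤ ⌈(p ^ kap)⁻¹⌉₊ := Nat.le_ceil _
  have hm2 : (⌈(p ^ kap)⁻¹⌉₊ : ℝ) ≤ 2 * (p ^ kap)⁻¹ := by
    have h3 := (Nat.ceil_lt_add_one (show 0 ≤ (p ^ kap)⁻¹ by positivity)).le
    have h4 : 1 ≤ (p ^ kap)⁻¹ := (one_le_inv₀ hz).2 hz1
    linarith
  have hm0 : 0 < ⌈(p ^ kap)⁻¹⌉₊ := Nat.ceil_pos.2 (by positivity)
  set m := ⌈(p ^ kap)⁻¹⌉₊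
  -- a common unit for all bounds
  obtain ⟨t, ht⟩ : ∃ t : ℝ, t = (n : ℝ) ^ (ρ / 4) := ⟨_, rfl⟩
  have ht1 : 1 ≤ t := by rw [ht]; exact Real.one_le_rpow hn1 (by positivity)
  have ht2 : (n : ℝ) ^ (ρ / 2) = t ^ 2 := by
    rw [ht, ← Real.rpow_mul_natCast (by positivity)]; congr 1; push_cast; ring
  have ht4 : (n : ℝ) ^ ρ = t ^ 4 := by
    rw [ht, ← Real.rpow_mul_natCast (by positivity)]; congr 1; push_cast; ring
  have hlog : Real.log n ≤ 4 / ρ * t := by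
    have := Real.log_le_rpow_div (show (0 : ℝ) ≤ n by positivity) (show 0 < ρ / 4 by positivity)
    rw [← ht] at this
    calc _ ≤ _ := this
      _ = _ := by field_simp
  have hm3 : (m : ℝ) ≤ 2 * p₁⁻¹ * t ^ 2 := by
    have h3 : (p ^ kap)⁻¹ ≤ (p₁ ^ kap)⁻¹ := by gcongr
    rw [ht2] at hk2
    linarith
  have hRm : (R : ℝ) * (m * m) ≤ c₁ * (t ^ 4 * ℓ) := by
    calc (R : ℝ) * (m * m) ≤ 14 * ℓ * ((2 * p₁⁻¹ * t ^ 2) * (2 * p₁⁻¹ * t ^ 2)) := by gcongr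
      _ = c₁ * (t ^ 4 * ℓ) := by simp only [c₁]; ring
  have ht4' : 1 ≤ t ^ 4 := one_le_pow₀ ht1
  have hsz : (n.size : ℝ) ≤ (8 / ρ + 1) * t := by
    have h3 := size_le hn
    have h4 : 2 * (4 / ρ * t) = 8 / ρ * t := by ring
    linarith
  have hkap : (kap * 14 + 61 : ℝ) ≤ (28 / (ρ * lam) + 75) * t := by
    have h3 : Real.log n / (2 * lam) ≤ (4 / ρ * t) / (2 * lam) := by gcongr
    have h4 : 14 * ((4 / ρ * t) / (2 * lam)) = 28 / (ρ * lam) * t := by field_simp; ring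
    linarith
  have hprep : (R * (2 * m) : ℝ) * (n.size * (kap * 14 + 61) + 40) ≤
      14 * (2 * (2 * p₁⁻¹)) * c₂ * (t ^ 4 * ℓ) := by
    have h3 : (n.size : ℝ) * (kap * 14 + 61) + 40 ≤ c₂ * t ^ 2 := by
      calc (n.size : ℝ) * (kap * 14 + 61) + 40 ≤
          ((8 / ρ + 1) * t) * ((28 / (ρ * lam) + 75) * t) + 40 * t ^ 2 := by
            gcongr
            have : (1 : ℝ) ≤ t ^ 2 := one_le_pow₀ ht1
            linarith
        _ = c₂ * t ^ 2 := by simp only [c₂]; ring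
    calc (R * (2 * m) : ℝ) * (n.size * (kap * 14 + 61) + 40) ≤
        (14 * ℓ * (2 * (2 * p₁⁻¹ * t ^ 2))) * (c₂ * t ^ 2) := by gcongr
      _ = _ := by ring
  have hu : 1 / 2 ≤ t ^ 4 * ℓ := hℓ.trans (le_mul_of_one_le_left (by linarith) ht4')
  refine ⟨kap, m, R, hm0, hR0, ?_, ?_, hk1, hR1, ?_, ?_, ?_⟩
  · calc 1 = (p ^ kap)⁻¹ * p ^ kap := by field_simp
      _ ≤ m * p ^ kap := by gcongr
  · calc m * p ^ kap ≤ 2 * (p ^ kap)⁻¹ * p ^ kap := by gcongr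
      _ = 2 := by field_simp
  · have h3 : (14 + c₁ + c₃) * ℓ = 14 * ℓ + (c₁ + c₃) * ℓ := by ring
    have h4 : 0 ≤ (c₁ + c₃) * ℓ := by positivity
    linarith
  · rw [ht4]
    simp only [Params.L, Nat.cast_mul]
    have h4 : 0 ≤ (14 + c₃) * (t ^ 4 * ℓ) := by positivity
    linarith [hRm, h4]
  · rw [ht4]
    simp only [Params.prepSteps, Params.L, Params.G]
    push_cast
    have h4 : 0 ≤ (14 + c₁) * (t ^ 4 * ℓ) := by positivity
    have h5 : (14 + c₁ + c₃) * (t ^ 4 * ℓ) = (14 + c₁) * (t ^ 4 * ℓ) +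
      (14 * (2 * (2 * p₁⁻¹)) * c₂ * (t ^ 4 * ℓ) + 350 * (c₁ * (t ^ 4 * ℓ)) +
        400 * (t ^ 4 * ℓ)) := by simp only [c₃]; ring
    rw [h5]
    generalize 14 * (2 * (2 * p₁⁻¹)) * c₂ * (t ^ 4 * ℓ) = a at *
    generalize c₁ * (t ^ 4 * ℓ) = b at *
    linarith

end FairANN
namespace FairANN

/-! ### Assembly -/

namespace Params
variable {A : Params}

lemma le_prepSteps (hn : 0 < A.n) :
    A.G * A.kap ≤ A.prepSteps ∧ A.G ≤ A.prepSteps := by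
  have h1 : 0 < A.n.size := Nat.size_pos.2 hn
  have h2 : A.kap ≤ A.n.size * (A.kap * 14 + 61) + 40 := by nlinarith
  have h3 : A.G * A.kap ≤ A.G * (A.n.size * (A.kap * 14 + 61) + 40) := Nat.mul_le_mul_left _ h2
  have h4 : A.G * 1 ≤ A.G * (A.n.size * (A.kap * 14 + 61) + 40) :=
    Nat.mul_le_mul_left _ (by omega)
  unfold prepSteps
  omega

/-- The most demanding quantity is the square of a dictionary key, of order `K ^ 2 * N ^ 8`. Since
`N ≥ 2`, the factor `N ^ (2 * a)` absorbs all constants. -/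
lemma ok_of_le (hm : 0 < A.m) (hR : 0 < A.R) {N a : ℕ} (hn : 0 < A.n) (hnN : A.n ≤ N) (hN : 2 ≤ N)
    {K : ℝ} (hK : 1 ≤ K) (ha : 20 * K ≤ a) (hL : (A.L : ℝ) ≤ K * N ^ 2)
    (hP : (A.prepSteps : ℝ) ≤ K * N ^ 2) : A.Ok (N ^ (2 * a + 8)) := by
  obtain ⟨h1, h2⟩ := le_prepSteps hn
  have hGk : ((A.G * A.kap : ℕ) : ℝ) ≤ K * N ^ 2 := (Nat.cast_le.2 h1).trans hP
  have hG : (A.G : ℝ) ≤ K * N ^ 2 := (Nat.cast_le.2 h2).trans hP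
  have hN' : (2 : ℝ) ≤ N := by exact_mod_cast hN
  have hn' : (A.n : ℝ) ≤ N := by exact_mod_cast hnN
  have hn1 : (1 : ℝ) ≤ A.n := by exact_mod_cast hn
  have hW : 400 * K ^ 2 * (N : ℝ) ^ 8 < ((N ^ (2 * a + 8) : ℕ) : ℝ) := by
    have e1 : (20 * K) ^ 2 < ((2 : ℝ) ^ a) ^ 2 := by
      have : (a : ℝ) < 2 ^ a := by exact_mod_cast Nat.lt_two_pow_self
      have h20 : 0 ≤ 20 * K := by linarith
      gcongr
      exact ha.trans_lt this
    have e2 : ((2 : ℝ) ^ a) ^ 2 ≤ ((N : ℝ) ^ a) ^ 2 := by gcongr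
    push_cast
    calc 400 * K ^ 2 * (N : ℝ) ^ 8 = (20 * K) ^ 2 * (N : ℝ) ^ 8 := by ring
      _ < ((2 : ℝ) ^ a) ^ 2 * (N : ℝ) ^ 8 := by gcongr
      _ ≤ ((N : ℝ) ^ a) ^ 2 * (N : ℝ) ^ 8 := by gcongr
      _ = (N : ℝ) ^ (2 * a + 8) := by ring
  obtain ⟨x, hx⟩ : ∃ x : ℝ, x = K * N ^ 2 := ⟨_, rfl⟩
  rw [← hx] at hL hG hGk
  have hNx : (N : ℝ) ≤ x := by rw [hx]; nlinarith
  have hx1 : 1 ≤ x := by linarith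
  have hx3 : x * N ≤ K ^ 2 * (N : ℝ) ^ 8 := by
    calc x * N = K ^ 1 * (N : ℝ) ^ 3 := by rw [hx]; ring
      _ ≤ _ := by gcongr <;> linarith
  have hxN : x ≤ x * N := by nlinarith
  have hNxN : (N : ℝ) ≤ x * N := by nlinarith
  have h1N : 1 ≤ x * N := by linarith
  have hLn : (A.L : ℝ) * A.n ≤ x * N := by gcongr
  have hGn : (A.G : ℝ) * A.n ≤ x * N := by gcongr
  have hkey : (A.keyMax : ℝ) ≤ 7 * (x * N * N) := by
    unfold keyMax
    push_cast
    calc ((A.L * (A.n + 1) + A.n) * (A.n + 1) + A.n : ℝ)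
        ≤ (x * (N + N) + x * N) * (N + N) + x * N * N := by
          gcongr <;> nlinarith
      _ = _ := by ring
  have hkey2 : 4 * ((A.keyMax : ℝ) * A.keyMax) ≤ 196 * (K ^ 2 * (N : ℝ) ^ 8) := by
    calc 4 * ((A.keyMax : ℝ) * A.keyMax) ≤ 4 * ((7 * (x * N * N)) * (7 * (x * N * N))) := by gcongr
      _ = _ := by rw [hx]; ring
  have hG0 : 1 ≤ A.G := Nat.mul_pos hR (Nat.mul_pos two_pos hm)
  have hkap : ((A.kap : ℕ) : ℝ) ≤ x := by
    refine le_trans ?_ hGk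
    exact_mod_cast Nat.le_mul_of_pos_left _ hG0
  refine ⟨hn, hm, hR, ?_, ?_, ?_, ?_⟩
  · rw [← Nat.cast_le (α := ℝ)]
    refine le_trans ?_ hW.le
    unfold X
    push_cast
    linarith
  · rw [← Nat.cast_lt (α := ℝ)]
    refine lt_of_le_of_lt ?_ hW
    rw [Nat.cast_add]
    linarith
  · rw [← Nat.cast_le (α := ℝ)]
    refine le_trans ?_ hW.le
    push_cast
    linarith
  · rw [← Nat.cast_lt (α := ℝ)]
    refine lt_of_le_of_lt ?_ hW
    push_cast
    linarith

lemma space_le (hn : 0 < A.n) {K u : ℝ} (hK : 1 ≤ K) (hu : 1 / 2 ≤ u) (hL : (A.L : ℝ) ≤ K * u)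
    (hP : (A.prepSteps : ℝ) ≤ K * u) :
    ((A.G * A.kap : ℕ) : ℝ) + ((17 * A.X : ℕ) : ℝ) ≤ 443 * K * (A.n * u) := by
  obtain ⟨h1, h2⟩ := le_prepSteps hn
  have hGk : ((A.G * A.kap : ℕ) : ℝ) ≤ K * u := (Nat.cast_le.2 h1).trans hP
  have hG : (A.G : ℝ) ≤ K * u := (Nat.cast_le.2 h2).trans hP
  have hn1 : (1 : ℝ) ≤ A.n := by exact_mod_cast hn
  have hKu : 1 / 2 ≤ K * u := by nlinarith
  obtain ⟨y, hy⟩ : ∃ y : ℝ, y = K * u * A.n := ⟨_, rfl⟩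
  have h3 : K * u ≤ y := by rw [hy]; exact le_mul_of_one_le_right (by linarith) hn1
  have hLn : (A.L : ℝ) * A.n ≤ y := by rw [hy]; gcongr
  have hGn : (A.G : ℝ) * A.n ≤ y := by rw [hy]; gcongr
  have h4 : 443 * K * (A.n * u) = 443 * y := by rw [hy]; ring
  rw [h4]
  unfold X
  push_cast at hGk ⊢
  linarith

lemma time_le {M : Type*} [MetricSpace M] (S : Fin A.n ↪ M) {c r ρ K : ℝ} {d Q : ℕ}
    (hK : 1 ≤ K) (hu : 1 / 2 ≤ (A.n : ℝ) ^ ρ * Real.log (A.n * Q))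
    (hL : (A.L : ℝ) ≤ K * ((A.n : ℝ) ^ ρ * Real.log (A.n * Q)))
    (hP : (A.prepSteps : ℝ) ≤ K * ((A.n : ℝ) ^ ρ * Real.log (A.n * Q)))
    (hR : (A.R : ℝ) ≤ K * Real.log (A.n * Q)) (q : M) :
    expectedTime S c r d q + d * (A.prepSteps + 1 + 600 * A.L) ≤
      4800 * K * timeBound S c r ρ d Q q := by
  rw [expectedTime, timeBound]
  set ℓ := Real.log (A.n * Q)
  set u := (A.n : ℝ) ^ ρ * ℓ
  obtain ⟨x, hx⟩ : ∃ x : ℝ, x = density S q (c * r) / max (density S q r : ℝ) 1 := ⟨_, rfl⟩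
  obtain ⟨v, hv⟩ : ∃ v : ℝ, v = density S q (c * r) / (density S q r + 1 : ℝ) := ⟨_, rfl⟩
  -- The denominators `max (n(q, r)) 1` and `n(q, r) + 1` differ by at most a factor two.
  have hx0 : 0 ≤ x := by rw [hx]; positivity
  have hxv : x ≤ 2 * v := by
    rw [hx, hv, ← mul_div_assoc, div_le_div_iff₀ (by positivity) (by positivity)]
    have h1 := le_max_left (density S q r : ℝ) 1
    have h2 := le_max_right (density S q r : ℝ) 1
    have h3 : (density S q r + 1 : ℝ) ≤ 2 * max (density S q r : ℝ) 1 := by linarith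
    calc _ ≤ (density S q (c * r) : ℝ) * (2 * max (density S q r : ℝ) 1) := by gcongr
      _ = _ := by ring
  have hKu : u ≤ K * u := le_mul_of_one_le_left (by linarith) hK
  have hRx : A.R * x ≤ K * ℓ * (2 * v) := by
    calc A.R * x ≤ K * ℓ * x := by gcongr
      _ ≤ _ := by
        gcongr
        exact (Nat.cast_nonneg _).trans hR
  rw [← hx, ← hv]
  have e : 4800 * K * (d * ((A.n : ℝ) ^ ρ + v) * ℓ) = d * (4800 * (K * u) + 4800 * (K * ℓ * v)) := by
    simp only [u]; ring
  rw [e, ← mul_add]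
  refine mul_le_mul_of_nonneg_left ?_ (Nat.cast_nonneg _)
  linarith

/-- Take for `p` the infimum of the collision probabilities over pairs at distance at most `r`.
Pairs at distance at most `r` collide with probability at least `p` by definition, and pairs beyond
`r` with probability at most `p` by monotonicity. Thus one threshold gives both coverage, through
`exp (-1) ≤ 3/8`, and few collisions beyond `r`. The point `x₀` makes the set nonempty. -/
lemma exists_tuned {M Ω U : Type*} [MetricSpace M] [MeasurableSpace Ω] [LinearOrder U]
    {μ : Measure Ω} [IsProbabilityMeasure μ] {h : Ω → M → U} {c r p₁ p₂ : ℝ} (hp₂ : 0 < p₂)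
    (hp : p₂ < p₁) (hr : 0 ≤ r) (hh : IsLSH μ h c r p₁ p₂) (x₀ : M) :
    ∃ p, p₁ ≤ p ∧ p ≤ 1 ∧ ∀ n kap m R Q : ℕ, 0 < Q → 1 ≤ m * p ^ kap → m * p ^ kap ≤ 2 →
      n * (p₂ ^ kap) ^ 2 ≤ 1 → n * (3 / 4 : ℝ) ^ R ≤ 1 / (2 * (n * Q)) →
      (⟨n, kap, m, R⟩ : Params).Tuned μ h c r Q := by
  let coll : M → M → ℝ := fun x y => μ.real {ω | h ω x = h ω y}
  let Z : Set ℝ := {z | ∃ x y, dist x y ≤ r ∧ coll x y = z}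
  have hne : Z.Nonempty := ⟨_, x₀, x₀, by simpa using hr, rfl⟩
  have hbdd : BddBelow Z := ⟨0, by rintro _ ⟨x, y, _, rfl⟩; exact measureReal_nonneg⟩
  have hp₁ : p₁ ≤ sInf Z := le_csInf hne (by rintro _ ⟨x, y, hxy, rfl⟩; exact hh.near x y hxy)
  have hnear : ∀ x y, dist x y ≤ r → sInf Z ≤ coll x y := fun x y hxy =>
    csInf_le hbdd ⟨x, y, hxy, rfl⟩
  have hp0 : 0 < sInf Z := (hp₂.trans hp).trans_le hp₁
  refine ⟨sInf Z, hp₁, (hnear x₀ x₀ (by simpa using hr)).trans measureReal_le_one,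
    fun n kap m R Q hQ h1 h2 h3 h4 => ⟨hQ, fun x y hxy => ?_, fun x y hxy => ?_,
      fun x y hxy => ?_, h4⟩⟩
  · have hz := hnear x y hxy
    have hc1 : coll x y ^ kap ≤ 1 := pow_le_one₀ measureReal_nonneg measureReal_le_one
    have hpk : sInf Z ^ kap ≤ coll x y ^ kap := by gcongr
    calc (1 - coll x y ^ kap) ^ m ≤ Real.exp (-(sInf Z ^ kap)) ^ m := by
          refine pow_le_pow_left₀ (by linarith) ?_ m
          have := Real.one_sub_le_exp_neg (sInf Z ^ kap)
          linarith
      _ = Real.exp (-(m * sInf Z ^ kap)) := by rw [← Real.exp_nat_mul]; congr 1; ring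
      _ ≤ Real.exp (-1) := Real.exp_le_exp.2 (by linarith)
      _ ≤ 3 / 8 := by have := Real.exp_neg_one_lt_d9; linarith
  · have hz : coll x y ≤ sInf Z := le_csInf hne (by
      rintro _ ⟨x', y', hxy', rfl⟩
      exact hh.mono x' y' x y (hxy'.trans_lt hxy))
    have h0 : 0 ≤ coll x y := measureReal_nonneg
    calc (m * coll x y ^ kap) ^ 2 ≤ (m * sInf Z ^ kap) ^ 2 := by gcongr
      _ ≤ 2 ^ 2 := by gcongr
      _ = 4 := by norm_num
  · have hz : coll x y ≤ p₂ := hh.far x y hxy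
    have h0 : 0 ≤ coll x y := measureReal_nonneg
    calc n * (coll x y ^ kap) ^ 2 ≤ n * (p₂ ^ kap) ^ 2 := by gcongr
      _ ≤ 1 := h3

end Params

lemma correct_of_fairLaw_ne_zero {M : Type*} [MetricSpace M] {n : ℕ} (S : Fin n ↪ M) {c r : ℝ}
    (hrc : r ≤ c * r) {q : M} {a : Answer n} (ha : fairLaw S r q a ≠ 0) : Correct S c r q a := by
  classical
  rw [fairLaw] at ha
  split_ifs at ha with hne
  · rw [← PMF.mem_support_iff, PMF.mem_support_map_iff] at ha
    obtain ⟨i, hi, rfl⟩ := ha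
    rw [PMF.mem_support_uniformOfFinset_iff] at hi
    simp only [Correct, nbhd, Finset.mem_filter, Finset.mem_univ, true_and] at hi ⊢
    exact hi.trans hrc
  · rw [← PMF.mem_support_iff, PMF.mem_support_pure_iff] at ha
    subst ha
    exact Finset.not_nonempty_iff_eq_empty.1 hne

end FairANN

/-! ### The main theorem -/

theorem mainTheorem4 (p₁ p₂ : ℝ) (hp₂ : 0 < p₂) (hp : p₂ < p₁) (hp₁ : p₁ < 1) :
    ∃ (P : Cmd) (C : ℕ),
      ∀ (M Ω U : Type*) [MetricSpace M] [MeasurableSpace Ω] [LinearOrder U]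
        (μ : Measure Ω) [IsProbabilityMeasure μ] (h : Ω → M → U) (c r : ℝ) (d n Q : ℕ),
        1 ≤ c → 0 < r → 1 ≤ d → 2 ≤ n * Q → IsLSH μ h c r p₁ p₂ →
        ∀ S : Fin n ↪ M, ∃ D : DataStructure Ω ((n * Q) ^ C),
          -- space
          (D.funs + D.size : ℝ) ≤ C * (n : ℝ) ^ (1 + rho p₁ p₂) * Real.log (n * Q) ∧
          (D.tables : ℝ) ≤ C * (n : ℝ) ^ rho p₁ p₂ * Real.log (n * Q) ∧
          -- every fixed query: coverage, exact fairness, expected time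
          (∀ q : M,
            1 - 1 / ((n : ℝ≥0∞) * Q) ≤ setupLaw D μ {ω | Covered D h S r ω q} ∧
            (∀ ω, Covered D h S r ω q → ∀ a, ansLaw D P h S r ω q a = fairLaw S r q a) ∧
            ∫⁻ ω, queryTime D P h S r d ω q ∂setupLaw D μ ≤
              ENNReal.ofReal (C * timeBound S c r (rho p₁ p₂) d Q q)) ∧
          -- every adaptive adversary
          (∀ B : Adversary M n,
            -- all answers are correct with probability at least `1 - 1/n`
            1 - 1 / (n : ℝ≥0∞) ≤
              ∫⁻ ω, winProb (ansLaw D P h S r ω) B (Correct S c r) Q [] ∂setupLaw D μ ∧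
            -- all rounds are exactly fair with probability at least `1 - 1/n`
            1 - 1 / (n : ℝ≥0∞) ≤
              ∫⁻ ω, winProb (ansLaw D P h S r ω) B (fun q _ => Covered D h S r ω q) Q []
                ∂setupLaw D μ ∧
            -- the expected time of each round is within the bound for its query
            ∀ i < Q,
              ∫⁻ ω, expAtRound (ansLaw D P h S r ω) B (queryTime D P h S r d ω) i []
                  ∂setupLaw D μ ≤
                ∫⁻ ω, expAtRound (ansLaw D P h S r ω) B
                    (fun q => ENNReal.ofReal (C * timeBound S c r (rho p₁ p₂) d Q q)) i []
                  ∂setupLaw D μ) := by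
  obtain ⟨K, hK, hpar⟩ := exists_parameters hp₂ hp hp₁
  -- One number `C = 2 * a + 8` serves as exponent of the word size and as constant for space,
  -- tables and time. It is at least `40000 * K`, whereas `443 * K` is needed for space and `2 *
  -- 4800 * K` for time.
  obtain ⟨a, ha⟩ : ∃ a : ℕ, 20000 * K ≤ a := ⟨_, Nat.le_ceil _⟩
  refine ⟨queryCmd, 2 * a + 8, ?_⟩
  intro M Ω U _ _ _ μ _ h c r d n Q hc hr hd hnQ hh S
  have hn : 0 < n := Nat.pos_of_ne_zero fun h => by simp [h] at hnQ
  have hQ : 0 < Q := Nat.pos_of_ne_zero fun h => by simp [h] at hnQ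
  have hn1 : (1 : ℝ) ≤ n := Nat.one_le_cast.2 hn
  have hQ1 : (1 : ℝ) ≤ Q := Nat.one_le_cast.2 hQ
  have h2 : (2 : ℝ) ≤ n * Q := by exact_mod_cast hnQ
  have hℓ := half_le_log h2
  have hρ := rho_pos hp₂ hp hp₁
  have hρ1 := rho_le_one hp₂ hp hp₁
  have hrc : r ≤ c * r := le_mul_of_one_le_left hr.le hc
  obtain ⟨p, hp₁p, hp1, htuned⟩ := Params.exists_tuned hp₂ hp hr.le hh (S ⟨0, hn⟩)
  obtain ⟨kap, m, R, hm, hR, e1, e2, e3, e4, e5, e6, e7⟩ := hpar n Q hnQ p hp₁p hp1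
  have hT := htuned n kap m R Q hQ e1 e2 e3 e4
  set ρ := rho p₁ p₂
  set ℓ := Real.log (n * Q)
  have hnρ : 1 ≤ (n : ℝ) ^ ρ := Real.one_le_rpow hn1 hρ.le
  have hu : 1 / 2 ≤ (n : ℝ) ^ ρ * ℓ := hℓ.trans (le_mul_of_one_le_left (by linarith) hnρ)
  have huN : (n : ℝ) ^ ρ * ℓ ≤ ((n * Q : ℕ) : ℝ) ^ 2 := by
    have h3 : (n : ℝ) ≤ n * Q := le_mul_of_one_le_right (by linarith) hQ1
    have h4 : (n : ℝ) ^ ρ ≤ n * Q := by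
      calc (n : ℝ) ^ ρ ≤ (n : ℝ) ^ (1 : ℝ) := Real.rpow_le_rpow_of_exponent_le hn1 hρ1
        _ = n := Real.rpow_one _
        _ ≤ n * Q := h3
    have h5 : ℓ ≤ n * Q := Real.log_le_self (by linarith)
    push_cast
    calc (n : ℝ) ^ ρ * ℓ ≤ (n * Q) * (n * Q) := by gcongr
      _ = _ := by ring
  have hA : (⟨n, kap, m, R⟩ : Params).Ok ((n * Q) ^ (2 * a + 8)) :=
    Params.ok_of_le hm hR hn (Nat.le_mul_of_pos_right n hQ) hnQ hK (by linarith)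
      (e6.trans (by gcongr)) (e7.trans (by gcongr))
  have hmeas := hh.measurableSet_lt
  set D := Params.dataStructure hA hmeas S with hD
  have hC : 40000 * K ≤ ((2 * a + 8 : ℕ) : ℝ) := by push_cast; linarith
  have hC0 : (0 : ℝ) ≤ ((2 * a + 8 : ℕ) : ℝ) := Nat.cast_nonneg _
  have htb : ∀ q, 0 ≤ timeBound S c r ρ d Q q := fun q => by
    rw [timeBound]
    have : 0 ≤ Real.log (n * Q) := by linarith
    positivity
  -- The factor two is kept in reserve for the return from the fair game to the real one in the last
  -- claim.
  have htime : ∀ q, 2 * (Params.expectedTime (A := ⟨n, kap, m, R⟩) S c r d q +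
      d * ((⟨n, kap, m, R⟩ : Params).prepSteps + 1 + 600 * (⟨n, kap, m, R⟩ : Params).L)) ≤
        ((2 * a + 8 : ℕ) : ℝ) * timeBound S c r ρ d Q q := by
    intro q
    have h3 := Params.time_le (A := ⟨n, kap, m, R⟩) S (c := c) (r := r) (d := d) hK hu e6 e7 e5 q
    have h4 := mul_le_mul_of_nonneg_right hC (htb q)
    have h5 := mul_nonneg (by linarith : 0 ≤ K) (htb q)
    linarith
  have hcov : ∀ q, MeasurableSet {ω | Covered D h S r ω q} :=
    Params.measurableSet_covered hA hmeas S
  have hncov : ∀ q, setupLaw D μ {ω | ¬ Covered D h S r ω q} ≤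
      ENNReal.ofReal (1 / (2 * (n * Q))) := Params.measure_not_covered_le hA hmeas S hT
  have hfair : ∀ ω q, Covered D h S r ω q → ∀ a, ansLaw D queryCmd h S r ω q a =
      fairLaw S r q a := fun ω q hq a => Params.ansLaw_of_covered hA hmeas S hq a
  have : IsProbabilityMeasure (setupLaw D μ) :=
    inferInstanceAs (IsProbabilityMeasure (Measure.pi fun _ => μ))
  have hn0 : (n : ℝ≥0∞) ≠ 0 := by exact_mod_cast hn.ne'
  have hmulε : ∀ k : ℕ, (k : ℝ≥0∞) * ENNReal.ofReal (1 / (2 * (n * Q))) =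
      ENNReal.ofReal (k / (2 * (n * Q))) := fun k => by
    rw [← ENNReal.ofReal_natCast k, ← ENNReal.ofReal_mul (Nat.cast_nonneg _), mul_one_div]
  have hinv : ∀ k : ℕ, 0 < k → 1 / (k : ℝ≥0∞) = ENNReal.ofReal (1 / k) := fun k hk => by
    rw [one_div, one_div, ENNReal.ofReal_inv_of_pos (Nat.cast_pos.2 hk), ENNReal.ofReal_natCast]
  have hQε : (Q : ℝ≥0∞) * ENNReal.ofReal (1 / (2 * (n * Q))) ≤ 1 / (n : ℝ≥0∞) := by
    rw [hmulε, hinv n hn]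
    refine ENNReal.ofReal_le_ofReal ?_
    rw [div_le_div_iff₀ (by positivity) (by positivity)]
    nlinarith
  have hwin : ∀ (B : Adversary M n) (ok : (Fin D.funs → Ω) → M → Answer n → Prop),
      (∀ ω q, Covered D h S r ω q → ∀ a, fairLaw S r q a ≠ 0 → ok ω q a) →
      1 - 1 / (n : ℝ≥0∞) ≤
        ∫⁻ ω, winProb (ansLaw D queryCmd h S r ω) B (ok ω) Q [] ∂setupLaw D μ := by
    intro B ok hok
    have h3 := le_setLIntegral_winProb (ν := setupLaw D μ) (law := ansLaw D queryCmd h S r)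
      (fair := fun q => ⇑(fairLaw S r q)) (B := B) hcov hncov hfair
      (Params.sum_fairLaw (A := ⟨n, kap, m, R⟩) S) hok Q [] MeasurableSet.univ
    rw [measure_univ, Measure.restrict_univ] at h3
    exact (tsub_le_tsub_left hQε 1).trans h3
  refine ⟨D, ?_, ?_, fun q => ⟨?_, fun ω => hfair ω q, ?_⟩, fun B => ⟨?_, ?_, fun i hi => ?_⟩⟩
  · refine (Params.space_le (A := ⟨n, kap, m, R⟩) hn hK hu e6 e7).trans ?_
    have h3 : (n : ℝ) ^ (1 + ρ) = n * (n : ℝ) ^ ρ := by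
      rw [Real.rpow_add (by linarith), Real.rpow_one]
    have h4 : 443 * K * (n * ((n : ℝ) ^ ρ * ℓ)) ≤
        ((2 * a + 8 : ℕ) : ℝ) * (n * ((n : ℝ) ^ ρ * ℓ)) :=
      mul_le_mul_of_nonneg_right (by linarith) (mul_nonneg (by linarith) (by linarith))
    refine h4.trans_eq ?_
    rw [h3]
    ring
  · refine e6.trans ?_
    rw [mul_assoc]
    gcongr
    linarith
  · have h3 : {ω | Covered D h S r ω q}ᶜ = {ω | ¬ Covered D h S r ω q} := rfl
    have h4 := measure_compl (hcov q).compl (measure_ne_top (setupLaw D μ) _)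
    rw [compl_compl, measure_univ, h3] at h4
    rw [h4]
    refine tsub_le_tsub_left ((hncov q).trans ?_) 1
    have h5 := hinv (n * Q) (by positivity)
    push_cast at h5
    rw [h5]
    refine ENNReal.ofReal_le_ofReal ?_
    rw [div_le_div_iff₀ (by positivity) (by positivity)]
    linarith
  · refine (lintegral_mono fun ω =>
      Params.queryTime_le_timeDom hA hmeas S hd hrc ω q).trans
      ((Params.lintegral_timeDom_le hA hmeas S hT q).trans (ENNReal.ofReal_le_ofReal ?_))
    have h3 := htime q
    have h4 : 0 ≤ Params.expectedTime (A := ⟨n, kap, m, R⟩) S c r d q := by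
      rw [Params.expectedTime]; positivity
    have h5 : (0 : ℝ) ≤ d * ((⟨n, kap, m, R⟩ : Params).prepSteps + 1 +
      600 * (⟨n, kap, m, R⟩ : Params).L) := by positivity
    linarith
  · exact hwin B _ fun ω q _ a ha => correct_of_fairLaw_ne_zero S hrc ha
  · exact hwin B _ fun ω q hq a _ => hq
  · let f : M → ℝ≥0∞ := fun q =>
      ENNReal.ofReal (((2 * a + 8 : ℕ) : ℝ) * timeBound S c r ρ d Q q)
    have h3 := le_setLIntegral_expAtRound (ν := setupLaw D μ) (law := ansLaw D queryCmd h S r)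
      (fair := fun q => ⇑(fairLaw S r q)) (B := B) hcov hncov hfair f i [] MeasurableSet.univ
    rw [measure_univ, Measure.restrict_univ] at h3
    refine (Params.lintegral_expAtRound_queryTime_le hA hmeas S hT hd hrc B hi).trans
      (le_trans ?_ h3)
    calc _ ≤ expAtRound (fun q => ⇑(fairLaw S r q)) B (fun q => ENNReal.ofReal (1 / 2) * f q) i [] := by
          refine expAtRound_mono _ B (fun q => ?_) i []
          rw [← ENNReal.ofReal_mul (by norm_num)]
          refine ENNReal.ofReal_le_ofReal ?_
          have := htime q
          linarith
      _ = ENNReal.ofReal (1 / 2) * expAtRound (fun q => ⇑(fairLaw S r q)) B f i [] :=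
          expAtRound_const_mul _ B _ _ i []
      _ ≤ _ := by
          refine mul_le_mul' ?_ le_rfl
          -- In the first `i < Q` rounds an uncovered query occurs with probability at most `i / (2
          -- * n * Q) ≤ 1 / 2`, so the real game retains at least half of the fair expectation of
          -- the bound.
          rw [hmulε, ← ENNReal.ofReal_one, ← ENNReal.ofReal_sub _ (by positivity)]
          refine ENNReal.ofReal_le_ofReal ?_
          have hiQ : (i : ℝ) ≤ n * Q := by
            have h4 : (i : ℝ) ≤ Q := by exact_mod_cast hi.le
            nlinarith
          have : (i : ℝ) / (2 * (n * Q)) ≤ 1 / 2 := by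
            rw [div_le_div_iff₀ (by positivity) (by positivity)]
            linarith
          linarith
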